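/- **Setting.** Let $d\in\{2,3\}$, $\widehat N\ge 2$, $G\ge 2$, $\mathcal I=\{1,\dots,G\}\times\{1,\dots,\widehat N\}$, and let $\Omega\subset\mathbb R^d$ be a bounded connected open set with Lipschitz boundary and outward normal $\mathbf n$. Put $\alpha_0=1$, $\alpha_{m+1}=\frac{4(m+1)^2-1}{(m+1)\alpha_m}$, $t_m=\frac{\alpha_m^2}{2m+1}$, and let $P_m$ be the Legendre polynomials. Matrices are indexed by $\mathcal I$: $\mathbb H$ and $\Gamma_e$ are block diagonal over the groups with the blocks $\widehat{\mathbb H}_{ij}=\delta_{i,j}+\delta_{i,j-1}$ and $(\widehat\Gamma_e)_{ij}=\alpha_{2(i-1)}\alpha_{2(j-1)}\int_0^1 xP_{2(i-1)}P_{2(j-1)}\,dx$; $\tilde\Gamma_e=\mathbb H\Gamma_e^{-1}\mathbb H^T$; $\mathbb T_e$ (resp. $\mathbb T_o$) has the entry $t_m(\Sigma_t^g-\Sigma_{s,m}^{g\to g})=:t_m\Sigma_{r,m}^g$ at $((g,i),(g,i))$, the entry $-t_m\Sigma_{s,m}^{g'\to g}$ at $((g,i),(g',i))$ for $g'\ne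 g$, with $m=2(i-1)$ (resp. $m=2i-1$), and zeros elsewhere. The cross sections $\Sigma_t^g,\Sigma_{s,m}^{g'\to g}$ satisfy a.e. in $\Omega$: the numbers $t_m\Sigma^g_{r,m}$ lie between two positive constants; $|\Sigma_{s,m}^{g\to g'}|\le\varepsilon\,\Sigma_{r,m}^g$ for $g'\neq g$, with some $0<\varepsilon<\frac1{G-1}$; and $\mathbb T_o^{-1}$, $\mathbb T_e$ are uniformly bounded and uniformly positive definite. Let $\mathbf Q(\Omega)=\{\mathbf q\in\mathbf H(\mathrm{div},\Omega):\mathbf q\cdot\mathbf n\in L^2(\partial\Omega)\}$ and $$c((\mathbf p,\phi),(\mathbf q,\psi))=-(\mathbb T_o\mathbf p,\mathbf q)_\Omega+(\phi,\mathbb H^T\mathrm{div}\,\mathbf q)_\Omega+(\psi,\mathbb H^T\mathrm{div}\,\mathbf p)_\Omega+(\mathbb T_e\phi,\psi)_\Omega-(\tilde\Gamma_e(\mathbf p\cdot\mathbf n),\mathbf q\cdot\mathbf n)_{\partial\Omega},$$ $d((\mathbf p,\phi),(\mathbf q,\psi))=c((\mathbf p,\phi),(-\mathbf q,\psi))$.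 Let $\zeta=(\mathbf p,\phi)\in\mathbf Q(\Omega)^{\mathcal I}\times L^2(\Omega)^{\mathcal I}$ solve $c(\zeta,(\mathbf q,\psi))=(S_f,\psi)_\Omega$ for all $(\mathbf q,\psi)$ in this space. **Domain decomposition.** Let $\Omega$ be partitioned into Lipschitz subdomains $\Omega^*_1,\dots,\Omega^*_{n}$, let $\Gamma$ be the union of the interfaces $\Gamma_{ij}=\partial\Omega^*_i\cap\partial\Omega^*_j$ ($i<j$), and let each $\overline{\Omega^*_i}$ have a conforming mesh of simplices, or of rectangles/cuboids with edges parallel to the axes; $\mathcal T_h$ is the union of these meshes, which need not match across $\Gamma$. Let $\mathbf Q_{i,h}\subset\mathbf H(\mathrm{div},\Omega_i^*)$, $L_{i,h}$ be the Raviart–Thomas–Nédélec spaces of order $k$ ($L_{i,h}$: piecewise $\mathbb P_k$ on simplices, $\mathbb Q_k$ on boxes), $\mathbf Q_h^*=\prod_i\mathbf Q_{i,h}$, $L_h^*=\prod_iL_{i,h}$, $T_{i,h}$ the normal traces of $\mathbf Q_{i,h}$ on $\partial\Omega_i^*\cap\Gamma$, and $M_h\subset\prod_{i<j}L^2(\Gamma_{ij})$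 finite-dimensional and containing the constants on each interface. Let $[\mathbf q\cdot\mathbf n]=\mathbf q_i\cdot\mathbf n_i+\mathbf q_j\cdot\mathbf n_j$ on $\Gamma_{ij}$, and let $(\mathbf p_h,\phi_h,\ell_h)\in(\mathbf Q_h^*)^{\mathcal I}\times (L_h^*)^{\mathcal I}\times M_h^{\mathcal I}$ satisfy $$c((\mathbf p_h,\phi_h),(\mathbf q_h,\psi_h))+\int_\Gamma[\mathbf p_h\cdot\mathbf n]m_h-\int_\Gamma[\mathbf q_h\cdot\mathbf n]\ell_h=(S_f,\psi_h)_\Omega$$ for all $(\mathbf q_h,\psi_h,m_h)$ in this space (here $c$ is computed subdomain by subdomain). **Assumptions.** (A1) The entries of $\mathbb T_o$, $\mathbb T_e$ are, on each element, polynomials of degree at most $m_o$, $m_e$; $S_f\in (L_h^*)^{\mathcal I}$; $\tilde\phi_h\in H^1(\Omega)^{\mathcal I}$ is, on each element, a polynomial of degree at most $m_\phi$. (A2) The discrete $L^2$-projections $\Pi_i:T_{i,h}\to\{m\in M_h:\mathrm{supp}\,m\subset\partial\Omega^*_i\cap\Gamma\}$ and $\pi_i:M_h\to T_{i,h}$,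 given by $\int_{\partial\Omega_i^*\cap\Gamma}(\Pi_it-t)m=0$ for all $m\in M_h$ and $\int_{\partial\Omega_i^*\cap\Gamma}(\pi_im-m)t=0$ for all $t\in T_{i,h}$, satisfy, with some $\beta_h,\gamma_h>0$ and with $[\mathbf q\cdot\mathbf n]_h=\Pi_i(\mathbf q_i\cdot\mathbf n_i)+\Pi_j(\mathbf q_j\cdot\mathbf n_j)$ on $\Gamma_{ij}$, $$\int_\Gamma[\mathbf q_h\cdot\mathbf n]_h[\mathbf q_h\cdot\mathbf n]\ge\beta_h\int_\Gamma[\mathbf q_h\cdot\mathbf n]^2,\qquad \sum_{i<j}\int_{\Gamma_{ij}}\big((\pi_im_h)^2+(\pi_jm_h)^2\big)\ge\gamma_h\|m_h\|^2_{L^2(\Gamma)}$$ for all $\mathbf q_h\in\mathbf Q_h^*$, $m_h\in M_h$. **Norms and estimators.** Let $\delta_{e},\delta_o$ be the diagonal parts of $\mathbb T_{e},\mathbb T_o$, let $\delta^{\max}_{e,K},\delta^{\min}_{e,K}$ (and likewise with $o$) be the largest supremum and the smallest infimum over $K$ of their entries, $h_K=\mathrm{diam}\,K$, and $\kappa_K=|K|/h_K^d$.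 A boundary facet $F$ is a facet of an element $K_F$ with $F\subset\partial\Omega$; $h_{\perp F}$ is the altitude of $K_F$ over $F$. For $(\mathbf q,\psi)$ with $\psi\in L^2(\Omega)^{\mathcal I}$ and $\mathbf q$ in $\mathbf H(\mathrm{div},\Omega^*_i)^{\mathcal I}$ on each $\Omega_i^*$ with $\mathbf q\cdot\mathbf n\in L^2(\partial\Omega_i^*\cap\partial\Omega)^{\mathcal I}$ for all $i$, set $$\|(\mathbf q,\psi)\|_S^2=(\delta_o\mathbf q,\mathbf q)_\Omega+(\delta_e\psi,\psi)_\Omega+\sum_{K}\delta^{\max}_{o,K}h_K^2\|\mathrm{div}\,\mathbf q\|_{0,K}^2+\sum_{F}\delta^{\max}_{o,K_F}h_{\perp F}\|\tilde\Gamma_e^{1/2}(\mathbf q\cdot\mathbf n)\|^2_{0,F}$$ (sums over all elements and all boundary facets), and let $|\xi|_{+,K}$ be the supremum of $d(\xi,(\mathbf q,\psi))$ over such $(\mathbf q,\psi)$ with $\|(\mathbf q,\psi)\|_S\le1$, $\mathrm{supp}\,\psi\subset K$, and $\mathbf q$ supported in the union of the elements $K'$ of the same subdomain as $K$ with $\dim_H(\partial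 K'\cap\partial K)=d-1$. Put $\tilde\zeta_h=(\mathbf p_h,\tilde\phi_h)$ and $$\eta_{r,K}=\|\delta_e^{-1/2}(S_f-\mathbb H^T\mathrm{div}\,\mathbf p_h-\mathbb T_e\tilde\phi_h)\|_{0,K},\qquad \eta_{f,K}=\|\delta_o^{-1/2}(\mathbb T_o\mathbf p_h+\mathbb H\,\mathbf{grad}\,\tilde\phi_h)\|_{0,K},$$ $$\eta_{bc,F}=(\delta^{\max}_{o,K_F}h_{\perp F})^{-1/2}\|\tilde\Gamma_e^{-1/2}(\mathbb H\tilde\phi_h-\tilde\Gamma_e(\mathbf p_h\cdot\mathbf n))\|_{0,F}.$$ **Theorem.** Under (A1) and (A2), for every element $K$ and every boundary facet $F$, $$\eta_{r,K}\le \mathtt c\Big(\frac{\delta^{\max}_{e,K}}{\delta^{\min}_{e,K}}\Big)^{1/2}|\zeta-\tilde\zeta_h|_{+,K},\qquad \eta_{f,K}\le \mathtt C\Big(\frac{\delta^{\max}_{o,K}}{\delta^{\min}_{o,K}}\Big)^{1/2}|\zeta-\tilde\zeta_h|_{+,K},\qquad \eta_{bc,F}\le \mathsf C\,|\zeta-\tilde\zeta_h|_{+,K_F}.$$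 Here $\mathtt c,\mathtt C>0$ depend only on $d$, $k$, $m_o$, $m_e$, $m_\phi$ and on a positive lower bound of $\kappa_K$, and $\mathsf C>0$ depends only on $d$, $k$, $m_o$, $m_e$, $m_\phi$, on a positive lower bound of $\kappa_{K_F}$, and on $\widehat N$ (through the fixed matrix $\tilde\Gamma_e$). -/

import Mathlib

open MeasureTheory Filter Topology Set
open scoped Matrix ENNReal NNReal ContDiff Gradient

namespace SPN

noncomputable section

/-! ### The model: angular constants, matrices of the multigroup equations -/

/-- The Legendre polynomial of degree `m` (Rodrigues formula). -/
def legendreP (m : ℕ) : Polynomial ℝ :=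
  Polynomial.C (1 / ((2 : ℝ) ^ m * (m.factorial : ℝ))) *
    (Polynomial.derivative^[m] ((Polynomial.X ^ 2 - 1) ^ m))

/-- `α₀ = 1`, `α_{m+1} = (4 (m+1)² - 1) / ((m+1) α_m)`. -/
def alpha : ℕ → ℝ
  | 0 => 1
  | m + 1 => (4 * ((m : ℝ) + 1) ^ 2 - 1) / (((m : ℝ) + 1) * alpha m)

/-- `t_m = α_m² / (2 m + 1)`. -/
def tcoef (m : ℕ) : ℝ := alpha m ^ 2 / (2 * (m : ℝ) + 1)

/-- Indices of the unknowns: an energy group and a moment. -/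
abbrev Idx (G Nh : ℕ) := Fin G × Fin Nh

/-- The `Nh × Nh` matrix with ones on the diagonal and on the first superdiagonal. -/
def Hhat (Nh : ℕ) : Matrix (Fin Nh) (Fin Nh) ℝ :=
  fun i j => if (i : ℕ) = j ∨ (i : ℕ) + 1 = j then 1 else 0

/-- The half-range angular matrix of the vacuum boundary condition (indices start at `0`). -/
def GammaHat (Nh : ℕ) : Matrix (Fin Nh) (Fin Nh) ℝ :=
  fun i j => alpha (2 * (i : ℕ)) * alpha (2 * (j : ℕ)) *
    ∫ x in (0 : ℝ)..1, x * (legendreP (2 * (i : ℕ))).eval x * (legendreP (2 * (j : ℕ))).eval x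

/-- The group-diagonal matrix all of whose diagonal blocks are `A`. -/
def groupDiag (G : ℕ) {Nh : ℕ} (A : Matrix (Fin Nh) (Fin Nh) ℝ) :
    Matrix (Idx G Nh) (Idx G Nh) ℝ :=
  fun a b => if a.1 = b.1 then A a.2 b.2 else 0

/-- `ℍ`. -/
def matH (G Nh : ℕ) : Matrix (Idx G Nh) (Idx G Nh) ℝ := groupDiag G (Hhat Nh)

/-- `Γ_e`. -/
def matGamma (G Nh : ℕ) : Matrix (Idx G Nh) (Idx G Nh) ℝ := groupDiag G (GammaHat Nh)

/-- `Γ̃_e = ℍ Γ_e⁻¹ ℍᵀ`. -/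
def matGammaT (G Nh : ℕ) : Matrix (Idx G Nh) (Idx G Nh) ℝ :=
  matH G Nh * (matGamma G Nh)⁻¹ * (matH G Nh)ᵀ

/-- The physical space `ℝᵈ` with its Euclidean norm. -/
abbrev E (d : ℕ) := EuclideanSpace ℝ (Fin d)

/-- Macroscopic cross sections: `sigT g` is the total cross section of group `g`, and
`sigS m g' g` is the Legendre moment of order `m` of the scattering cross section from
group `g'` to group `g`. -/
structure CrossSections (d G : ℕ) where
  sigT : Fin G → E d → ℝ
  sigS : ℕ → Fin G → Fin G → E d → ℝ

variable {d G Nh n : ℕ}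

/-- The removal cross section `Σ_{r,m}^g = Σ_t^g - Σ_{s,m}^{g→g}`. -/
def CrossSections.sigR (X : CrossSections d G) (m : ℕ) (g : Fin G) (x : E d) : ℝ :=
  X.sigT g x - X.sigS m g g x

/-- The even (`par = 0`) or odd (`par = 1`) removal and scattering matrix at `x`:
the moment number `i` has order `2 i + par`. -/
def CrossSections.matT (X : CrossSections d G) (Nh par : ℕ) (x : E d) :
    Matrix (Idx G Nh) (Idx G Nh) ℝ :=
  fun a b =>
    if a.2 = b.2 then
      if a.1 = b.1 then tcoef (2 * (a.2 : ℕ) + par) * X.sigR (2 * (a.2 : ℕ) + par) a.1 x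
      else -(tcoef (2 * (a.2 : ℕ) + par) * X.sigS (2 * (a.2 : ℕ) + par) b.1 a.1 x)
    else 0

/-- `𝕋_e`. -/
def CrossSections.Te (X : CrossSections d G) (Nh : ℕ) (x : E d) :
    Matrix (Idx G Nh) (Idx G Nh) ℝ := X.matT Nh 0 x

/-- `𝕋_o`. -/
def CrossSections.To (X : CrossSections d G) (Nh : ℕ) (x : E d) :
    Matrix (Idx G Nh) (Idx G Nh) ℝ := X.matT Nh 1 x

/-- The positivity assumptions on the coefficients, almost everywhere in `Ω`. -/
structure PosSPN (Ω : Set (E d)) (X : CrossSections d G) (Nh : ℕ) : Prop where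
  removal : ∀ par < 2, ∃ lo hi : ℝ, 0 < lo ∧ 0 < hi ∧ ∀ (g : Fin G) (i : Fin Nh),
    ∀ᵐ x ∂(volume.restrict Ω),
      lo ≤ tcoef (2 * (i : ℕ) + par) * X.sigR (2 * (i : ℕ) + par) g x ∧
      tcoef (2 * (i : ℕ) + par) * X.sigR (2 * (i : ℕ) + par) g x ≤ hi
  scattering : ∃ ε : ℝ, 0 < ε ∧ ε < 1 / ((G : ℝ) - 1) ∧
    ∀ m < 2 * Nh, ∀ g g' : Fin G, g' ≠ g →
      ∀ᵐ x ∂(volume.restrict Ω), |X.sigS m g g' x| ≤ ε * X.sigR m g x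
  odd_inv : ∃ lo hi : ℝ, 0 < lo ∧ 0 < hi ∧ ∀ᵐ x ∂(volume.restrict Ω), ∀ Y : Idx G Nh → ℝ,
    lo * (Y ⬝ᵥ Y) ≤ Y ⬝ᵥ ((X.To Nh x)⁻¹ *ᵥ Y) ∧
    ((X.To Nh x)⁻¹ *ᵥ Y) ⬝ᵥ ((X.To Nh x)⁻¹ *ᵥ Y) ≤ hi ^ 2 * (Y ⬝ᵥ Y)
  even : ∃ lo hi : ℝ, 0 < lo ∧ 0 < hi ∧ ∀ᵐ x ∂(volume.restrict Ω), ∀ Y : Idx G Nh → ℝ,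
    lo * (Y ⬝ᵥ Y) ≤ Y ⬝ᵥ (X.Te Nh x *ᵥ Y) ∧
    (X.Te Nh x *ᵥ Y) ⬝ᵥ (X.Te Nh x *ᵥ Y) ≤ hi ^ 2 * (Y ⬝ᵥ Y)

/-! ### Domains, surface measure, weak derivatives and traces -/

/-- The surface measure: `(d-1)`-dimensional Hausdorff measure, normalised so that it is the
Lebesgue measure on hyperplanes. -/
def surf (d : ℕ) : Measure (E d) := μHE[d - 1]

/-- Near each of its boundary points, `U` is the strict epigraph of a Lipschitz function of the
coordinates orthogonal to some unit vector `u`. -/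
def HasLipschitzBoundary (U : Set (E d)) : Prop :=
  ∀ x ∈ frontier U, ∃ r : ℝ, 0 < r ∧ ∃ u : E d, ‖u‖ = 1 ∧ ∃ (L : ℝ≥0) (γ : E d → ℝ),
    LipschitzWith L γ ∧ (∀ (y : E d) (s : ℝ), γ (y + s • u) = γ y) ∧
    ∀ y ∈ Metric.ball x r, (y ∈ U ↔ γ y < inner ℝ y u)

/-- Bounded Lipschitz domains. -/
structure IsLipschitzDomain (U : Set (E d)) : Prop where
  isOpen : IsOpen U
  isConnected : IsConnected U
  isBounded : Bornology.IsBounded U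
  lipschitz : HasLipschitzBoundary U

/-- Smooth functions on `ℝᵈ` with compact support. -/
def IsTest (v : E d → ℝ) : Prop := ContDiff ℝ ∞ v ∧ HasCompactSupport v

/-- `q ∈ H(div, U)`, with weak divergence `dq`. -/
def IsHdiv (U : Set (E d)) (q : E d → E d) (dq : E d → ℝ) : Prop :=
  MemLp q 2 (volume.restrict U) ∧ MemLp dq 2 (volume.restrict U) ∧
  ∀ v : E d → ℝ, IsTest v → tsupport v ⊆ U →
    ∫ x in U, (inner ℝ (q x) (∇ v x) + dq x * v x) = 0

/-- For `q ∈ H(div, U)` with divergence `dq`: on the part `S ∩ ∂U` of the boundary of `U`, the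
normal trace `q · n` (outward normal) is the square-integrable function `t`, in the sense of
Green's formula against smooth functions whose support avoids the rest of the boundary. -/
def IsNormalTrace (U S : Set (E d)) (q : E d → E d) (dq t : E d → ℝ) : Prop :=
  MemLp t 2 ((surf d).restrict (S ∩ frontier U)) ∧
  ∀ v : E d → ℝ, IsTest v → Disjoint (tsupport v) (closure (frontier U \ S)) →
    ∫ x in U, (inner ℝ (q x) (∇ v x) + dq x * v x) =
      ∫ x in S ∩ frontier U, t x * v x ∂(surf d)

/-- `φ ∈ H¹(U)`, with weak gradient `g`. -/
def IsH1 (U : Set (E d)) (φ : E d → ℝ) (g : E d → E d) : Prop :=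
  MemLp φ 2 (volume.restrict U) ∧ MemLp g 2 (volume.restrict U) ∧
  ∀ v : E d → ℝ, IsTest v → tsupport v ⊆ U →
    ∫ x in U, (φ x • ∇ v x + v x • g x) = 0

/-- `t ∈ L²(∂U)` is the trace of `φ ∈ H¹(U)` (with weak gradient `g`): the limit of the boundary
values of smooth functions that converge to `φ` in `H¹(U)`. -/
def IsTrace (U : Set (E d)) (φ : E d → ℝ) (g : E d → E d) (t : E d → ℝ) : Prop :=
  MemLp t 2 ((surf d).restrict (frontier U)) ∧
  ∃ v : ℕ → E d → ℝ, (∀ j, IsTest (v j)) ∧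
    Tendsto (fun j => eLpNorm (fun x => v j x - φ x) 2 (volume.restrict U)) atTop (𝓝 0) ∧
    Tendsto (fun j => eLpNorm (fun x => ∇ (v j) x - g x) 2 (volume.restrict U)) atTop (𝓝 0) ∧
    Tendsto (fun j => eLpNorm (fun x => v j x - t x) 2 ((surf d).restrict (frontier U)))
      atTop (𝓝 0)

/-- A vector field together with its (broken) divergence and its normal trace on the outer
boundary `∂Ω`. The predicates `InQ`, `InPQ`, `InQh` say that `div` and `tr` are these; they are
then determined by `val` up to null sets. -/
structure VField (d : ℕ) where
  val : E d → E d
  div : E d → ℝ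
  tr : E d → ℝ

instance : Sub (VField d) :=
  ⟨fun p q => ⟨fun x => p.val x - q.val x, fun x => p.div x - q.div x, fun x => p.tr x - q.tr x⟩⟩

/-- `q ∈ Q(Ω)`: `q ∈ H(div, Ω)` and `q · n ∈ L²(∂Ω)`. -/
def InQ (Ω : Set (E d)) (q : VField d) : Prop :=
  IsHdiv Ω q.val q.div ∧ IsNormalTrace Ω (frontier Ω) q.val q.div q.tr

/-- The broken space of the domain decomposition: on each subdomain `Ωᵢ`, the field is in
`H(div, Ωᵢ)` and its normal trace on `∂Ωᵢ ∩ ∂Ω` is in `L²`. -/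
def InPQ (Ω : Set (E d)) (Ωs : Fin n → Set (E d)) (q : VField d) : Prop :=
  ∀ i, IsHdiv (Ωs i) q.val q.div ∧ IsNormalTrace (Ωs i) (frontier Ω) q.val q.div q.tr

/-! ### Partition, meshes, Raviart-Thomas-Nédélec spaces -/

/-- A partition of `Ω` into Lipschitz subdomains. -/
structure IsPartition (Ω : Set (E d)) (Ωs : Fin n → Set (E d)) : Prop where
  domain : ∀ i, IsLipschitzDomain (Ωs i)
  subset : ∀ i, Ωs i ⊆ Ω
  disjoint : ∀ i j, i ≠ j → Disjoint (Ωs i) (Ωs j)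
  cover : closure Ω = ⋃ i, closure (Ωs i)

/-- Closed mesh elements: nondegenerate simplices, and rectangles or cuboids with edges parallel
to the axes. -/
inductive Cell (d : ℕ) where
  | simplex (v : Fin (d + 1) → E d) (hv : AffineIndependent ℝ v) : Cell d
  | box (a b : Fin d → ℝ) (hab : ∀ i, a i < b i) : Cell d

/-- The set of points of the element. -/
def Cell.carrier : Cell d → Set (E d)
  | .simplex v _ => convexHull ℝ (range v)
  | .box a b _ => {x | ∀ i, a i ≤ x i ∧ x i ≤ b i}

/-- The set of vertices of the element. -/
def Cell.vertices : Cell d → Set (E d)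
  | .simplex v _ => range v
  | .box a b _ => {x | ∀ i, x i = a i ∨ x i = b i}

open Classical in
/-- The facets of the element. -/
def Cell.facets : Cell d → Finset (Set (E d))
  | .simplex v _ => Finset.univ.image fun i => convexHull ℝ (v '' {i}ᶜ)
  | .box a b h =>
      (Finset.univ.image fun i => {x ∈ (Cell.box a b h).carrier | x i = a i}) ∪
      (Finset.univ.image fun i => {x ∈ (Cell.box a b h).carrier | x i = b i})

/-- The diameter `h_K`. -/
def Cell.h (K : Cell d) : ℝ := Metric.diam K.carrier

/-- The shape-regularity parameter `κ_K = |K| / h_Kᵈ`. -/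
def Cell.kappa (K : Cell d) : ℝ := (volume K.carrier).toReal / K.h ^ d

/-- The altitude `h_{⊥F}` of the element associated with its facet `F`: the largest distance of a
point of the element to the hyperplane of `F`. -/
def Cell.hperp (K : Cell d) (F : Set (E d)) : ℝ :=
  sSup ((fun x => Metric.infDist x (affineSpan ℝ F : Set (E d))) '' K.carrier)

/-- The value of a polynomial in `d` variables at a point. -/
def pval (P : MvPolynomial (Fin d) ℝ) (x : E d) : ℝ := MvPolynomial.eval (fun i => x i) P

/-- The local scalar space of order `k`: `ℙ_k` on simplices, `ℚ_k` on boxes. -/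
def Cell.IsLPoly (k : ℕ) (P : MvPolynomial (Fin d) ℝ) : Cell d → Prop
  | .simplex _ _ => P.totalDegree ≤ k
  | .box _ _ _ => ∀ i, P.degreeOf i ≤ k

/-- The local space `RTN_k`: on a simplex, `a + b x` with `a ∈ (ℙ_k)ᵈ` and `b ∈ ℙ_k`; on a box, the
`i`-th component has degree at most `k + 1` in `xᵢ` and at most `k` in the other variables. -/
def Cell.IsRTNPoly (k : ℕ) (Q : Fin d → MvPolynomial (Fin d) ℝ) : Cell d → Prop
  | .simplex _ _ => ∃ (a : Fin d → MvPolynomial (Fin d) ℝ) (b : MvPolynomial (Fin d) ℝ),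
      (∀ i, (a i).totalDegree ≤ k) ∧ b.totalDegree ≤ k ∧
      ∀ i, Q i = a i + b * MvPolynomial.X i
  | .box _ _ _ => ∀ i j, (Q i).degreeOf j ≤ if j = i then k + 1 else k

/-- A mesh of `Ω` obtained by aggregating conforming meshes of the subdomains `Ωᵢ`
(which need not match across the interfaces). -/
structure DDMesh (Ωs : Fin n → Set (E d)) where
  size : ℕ
  cell : Fin size → Cell d
  /-- the subdomain to which an element belongs -/
  sub : Fin size → Fin n
  cover : ∀ i, ⋃ K ∈ {K | sub K = i}, (cell K).carrier = closure (Ωs i)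
  interior_disjoint : ∀ K K', K ≠ K' →
    Disjoint (interior (cell K).carrier) (interior (cell K').carrier)
  /-- in a subdomain, two elements meet in a common face, or not at all -/
  conforming : ∀ K K', sub K = sub K' →
    (cell K).carrier ∩ (cell K').carrier = convexHull ℝ ((cell K).vertices ∩ (cell K').vertices)

variable {Ωs : Fin n → Set (E d)}

/-- The point set of the element number `K`. -/
def DDMesh.el (T : DDMesh Ωs) (K : Fin T.size) : Set (E d) := (T.cell K).carrier

open Classical in
/-- The facets of the element `K` that lie on `∂Ω`. The pairs (`K`, such a facet `F`) are the
boundary facets of the mesh, with `K = K_F`. -/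
def DDMesh.bdryFacets (T : DDMesh Ωs) (Ω : Set (E d)) (K : Fin T.size) : Finset (Set (E d)) :=
  (T.cell K).facets.filter fun F => F ⊆ frontier Ω

/-- The neighbours of `K` (including `K`) across `(d-1)`-dimensional intersections of boundaries,
in the same subdomain. -/
def DDMesh.nbr (T : DDMesh Ωs) (K : Fin T.size) : Set (Fin T.size) :=
  {K' | dimH (frontier (T.el K') ∩ frontier (T.el K)) = ((d - 1 : ℕ) : ℝ≥0∞) ∧ T.sub K' = T.sub K}

/-- `f` agrees almost everywhere, on each element, with a polynomial of degree at most `m`. -/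
def DDMesh.PiecewisePoly (T : DDMesh Ωs) (m : ℕ) (f : E d → ℝ) : Prop :=
  ∀ K, ∃ P : MvPolynomial (Fin d) ℝ, P.totalDegree ≤ m ∧
    ∀ᵐ x ∂(volume.restrict (T.el K)), f x = pval P x

/-- `f` agrees in the interior of each element with a polynomial of degree at most `m`
(used for coefficients, whose suprema over elements are needed). -/
def DDMesh.PiecewisePolyCoef (T : DDMesh Ωs) (m : ℕ) (f : E d → ℝ) : Prop :=
  ∀ K, ∃ P : MvPolynomial (Fin d) ℝ, P.totalDegree ≤ m ∧
    ∀ x ∈ interior (T.el K), f x = pval P x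

/-- The discrete scalar space `L*_h`. -/
def DDMesh.InLh (T : DDMesh Ωs) (k : ℕ) (f : E d → ℝ) : Prop :=
  ∀ K, ∃ P : MvPolynomial (Fin d) ℝ, (T.cell K).IsLPoly k P ∧
    ∀ᵐ x ∂(volume.restrict (T.el K)), f x = pval P x

/-- The discrete vector space `Q_{i,h}` of the subdomain `Ωᵢ`: `q ∈ H(div, Ωᵢ)` is in `RTN_k` on
each element, `dq` is its divergence, and `t ∈ L²(∂Ωᵢ)` its normal trace (normal outward to `Ωᵢ`). -/
def DDMesh.InQih (T : DDMesh Ωs) (k : ℕ) (i : Fin n) (q : E d → E d) (dq t : E d → ℝ) : Prop :=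
  IsHdiv (Ωs i) q dq ∧ IsNormalTrace (Ωs i) (frontier (Ωs i)) q dq t ∧
  ∀ K, T.sub K = i → ∃ Q : Fin d → MvPolynomial (Fin d) ℝ, (T.cell K).IsRTNPoly k Q ∧
    ∀ᵐ x ∂(volume.restrict (T.el K)), ∀ j, q x j = pval (Q j) x

/-- The discrete vector space `Q*_h`, product of the spaces `Q_{i,h}`; `tn i` is the normal trace
of the restriction to `Ωᵢ` on the whole of `∂Ωᵢ`. -/
def DDMesh.InQh (T : DDMesh Ωs) (Ω : Set (E d)) (k : ℕ) (q : VField d) (tn : Fin n → E d → ℝ) :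
    Prop :=
  ∀ i, T.InQih k i q.val q.div (tn i) ∧
    ∀ᵐ x ∂((surf d).restrict (frontier Ω ∩ frontier (Ωs i))), q.tr x = tn i x

/-! ### Interfaces and the multi-domain assumption -/

/-- Pairs of subdomains `i < j`. -/
abbrev Pair (n : ℕ) := {e : Fin n × Fin n // e.1 < e.2}

/-- The interface of a pair of subdomains (up to null sets of the surface measure). -/
def iface (Ωs : Fin n → Set (E d)) (e : Pair n) : Set (E d) :=
  frontier (Ωs e.1.1) ∩ frontier (Ωs e.1.2)

/-- The pairs that contain the subdomain `i`; their interfaces make up `∂Ωᵢ ∩ Γ`. -/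
def pairsOf (i : Fin n) : Finset (Pair n) := Finset.univ.filter fun e => e.1.1 = i ∨ e.1.2 = i

/-- The jump of the normal components on the interface of a pair (both normals are outward). -/
def jump (tn : Fin n → E d → ℝ) (e : Pair n) (x : E d) : ℝ := tn e.1.1 x + tn e.1.2 x

/-- `M_h`: a finite-dimensional space of families of square-integrable functions on the
interfaces, which contains the constants on each interface. -/
structure IsMultiplierSpace (Ωs : Fin n → Set (E d)) (Mh : Submodule ℝ (Pair n → E d → ℝ)) :
    Prop where
  finite : FiniteDimensional ℝ Mh
  memLp : ∀ m ∈ Mh, ∀ e, MemLp (m e) 2 ((surf d).restrict (iface Ωs e))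
  const : ∀ e, Pi.single e (fun _ => (1 : ℝ)) ∈ Mh

/-- `m = Π_i t`: the discrete `L²`-projection on the elements of `M_h` supported in `∂Ωᵢ ∩ Γ`. -/
def IsProjM (Ωs : Fin n → Set (E d)) (Mh : Submodule ℝ (Pair n → E d → ℝ)) (i : Fin n)
    (t : E d → ℝ) (m : Pair n → E d → ℝ) : Prop :=
  m ∈ Mh ∧ (∀ e ∉ pairsOf i, ∀ᵐ x ∂((surf d).restrict (iface Ωs e)), m e x = 0) ∧
  ∀ m' ∈ Mh, ∑ e ∈ pairsOf i, ∫ x in iface Ωs e, (m e x - t x) * m' e x ∂(surf d) = 0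

/-- `t = π_i m`: the discrete `L²`-projection of `m` on the space of normal traces `T_{i,h}`. -/
def DDMesh.IsProjT (T : DDMesh Ωs) (k : ℕ) (i : Fin n) (m : Pair n → E d → ℝ) (t : E d → ℝ) :
    Prop :=
  (∃ q dq, T.InQih k i q dq t) ∧
  ∀ q dq t', T.InQih k i q dq t' →
    ∑ e ∈ pairsOf i, ∫ x in iface Ωs e, (t x - m e x) * t' x ∂(surf d) = 0

/-- The assumption on the discrete spaces of the multi-domain method: the projections are
defined, and the two lower bounds hold with positive constants. -/
def DiscreteDDAssumption (Ω : Set (E d)) (T : DDMesh Ωs) (k : ℕ)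
    (Mh : Submodule ℝ (Pair n → E d → ℝ)) : Prop :=
  (∃ β : ℝ, 0 < β ∧ ∀ (q : VField d) (tn : Fin n → E d → ℝ), T.InQh Ω k q tn →
    ∃ Pr : Fin n → Pair n → E d → ℝ, (∀ i, IsProjM Ωs Mh i (tn i) (Pr i)) ∧
      β * ∑ e, ∫ x in iface Ωs e, jump tn e x ^ 2 ∂(surf d) ≤
        ∑ e : Pair n, ∫ x in iface Ωs e,
          (Pr e.1.1 e x + Pr e.1.2 e x) * jump tn e x ∂(surf d)) ∧
  (∃ γ : ℝ, 0 < γ ∧ ∀ m ∈ Mh,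
    ∃ Pr : Fin n → E d → ℝ, (∀ i, T.IsProjT k i m (Pr i)) ∧
      γ * ∑ e, ∫ x in iface Ωs e, m e x ^ 2 ∂(surf d) ≤
        ∑ e : Pair n, ∫ x in iface Ωs e, (Pr e.1.1 x ^ 2 + Pr e.1.2 x ^ 2) ∂(surf d))

/-! ### Bilinear forms, exact and discrete problems

Integrals over `Ω` of broken quantities are sums over the subdomains, whose union has full
measure in `Ω`. -/

/-- `(𝕋_o p, q)_{0,Ω}`. -/
def formO (Ω : Set (E d)) (X : CrossSections d G) (p q : Idx G Nh → VField d) : ℝ :=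
  ∫ x in Ω, ∑ a, ∑ b, X.To Nh x a b * inner ℝ ((p b).val x) ((q a).val x)

/-- `(φ, ℍᵀ div q)_{0,Ω}`. -/
def formB (Ω : Set (E d)) (φ : Idx G Nh → E d → ℝ) (q : Idx G Nh → VField d) : ℝ :=
  ∫ x in Ω, (fun a => φ a x) ⬝ᵥ ((matH G Nh)ᵀ *ᵥ fun a => (q a).div x)

/-- `(𝕋_e φ, ψ)_{0,Ω}`. -/
def formE (Ω : Set (E d)) (X : CrossSections d G) (φ ψ : Idx G Nh → E d → ℝ) : ℝ :=
  ∫ x in Ω, (X.Te Nh x *ᵥ fun a => φ a x) ⬝ᵥ fun a => ψ a x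

/-- `(Γ̃_e (p · n), q · n)_{0,∂Ω}`. -/
def formR (Ω : Set (E d)) (p q : Idx G Nh → VField d) : ℝ :=
  ∫ x in frontier Ω, (matGammaT G Nh *ᵥ fun a => (p a).tr x) ⬝ᵥ (fun a => (q a).tr x) ∂(surf d)

/-- `(f, ψ)_{0,Ω}`. -/
def formL (Ω : Set (E d)) (f ψ : Idx G Nh → E d → ℝ) : ℝ :=
  ∫ x in Ω, (fun a => f a x) ⬝ᵥ fun a => ψ a x

/-- The bilinear form `c((p, φ), (q, ψ))`. -/
def formC (Ω : Set (E d)) (X : CrossSections d G) (p : Idx G Nh → VField d)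
    (φ : Idx G Nh → E d → ℝ) (q : Idx G Nh → VField d) (ψ : Idx G Nh → E d → ℝ) : ℝ :=
  -formO Ω X p q + formB Ω φ q + formB Ω ψ p + formE Ω X φ ψ - formR Ω p q

/-- The bilinear form `d((p, φ), (q, ψ)) = c((p, φ), (-q, ψ))`. -/
def formD (Ω : Set (E d)) (X : CrossSections d G) (p : Idx G Nh → VField d)
    (φ : Idx G Nh → E d → ℝ) (q : Idx G Nh → VField d) (ψ : Idx G Nh → E d → ℝ) : ℝ :=
  formO Ω X p q + formE Ω X φ ψ + formR Ω p q + formB Ω ψ p - formB Ω φ q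

/-- `(p, φ)` is the solution of the mixed variational formulation in `Ω`. -/
def IsExactSolution (Ω : Set (E d)) (X : CrossSections d G) (Sf : Idx G Nh → E d → ℝ)
    (p : Idx G Nh → VField d) (φ : Idx G Nh → E d → ℝ) : Prop :=
  (∀ a, InQ Ω (p a)) ∧ (∀ a, MemLp (φ a) 2 (volume.restrict Ω)) ∧
  ∀ (q : Idx G Nh → VField d) (ψ : Idx G Nh → E d → ℝ), (∀ a, InQ Ω (q a)) →
    (∀ a, MemLp (ψ a) 2 (volume.restrict Ω)) → formC Ω X p φ q ψ = formL Ω Sf ψ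

/-- `∑_a ∫_Γ [p_a · n] m_a`. -/
def formJ (Ωs : Fin n → Set (E d)) (tn : Idx G Nh → Fin n → E d → ℝ)
    (m : Idx G Nh → Pair n → E d → ℝ) : ℝ :=
  ∑ a, ∑ e, ∫ x in iface Ωs e, jump (tn a) e x * m a e x ∂(surf d)

/-- `(p, φ, ℓ)` is the solution of the discrete multi-domain formulation; `tn a i` is the normal
trace of `p a` on `∂Ωᵢ`. -/
def DDMesh.IsDiscreteSolution (T : DDMesh Ωs) (Ω : Set (E d)) (k : ℕ)
    (Mh : Submodule ℝ (Pair n → E d → ℝ)) (X : CrossSections d G) (Sf : Idx G Nh → E d → ℝ)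
    (p : Idx G Nh → VField d) (tn : Idx G Nh → Fin n → E d → ℝ) (φ : Idx G Nh → E d → ℝ)
    (l : Idx G Nh → Pair n → E d → ℝ) : Prop :=
  (∀ a, T.InQh Ω k (p a) (tn a)) ∧ (∀ a, T.InLh k (φ a)) ∧ (∀ a, l a ∈ Mh) ∧
  ∀ (q : Idx G Nh → VField d) (sn : Idx G Nh → Fin n → E d → ℝ) (ψ : Idx G Nh → E d → ℝ)
    (m : Idx G Nh → Pair n → E d → ℝ),
    (∀ a, T.InQh Ω k (q a) (sn a)) → (∀ a, T.InLh k (ψ a)) → (∀ a, m a ∈ Mh) →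
    formC Ω X p φ q ψ + formJ Ωs tn m - formJ Ωs sn l = formL Ω Sf ψ

/-! ### Norms and estimators -/

/-- `δ^max_K`: largest value in the element `K` of a diagonal coefficient of the matrix `A`. -/
def DDMesh.diagMax (T : DDMesh Ωs) (A : E d → Matrix (Idx G Nh) (Idx G Nh) ℝ) (K : Fin T.size) :
    ℝ := ⨆ a : Idx G Nh, sSup ((fun x => A x a a) '' interior (T.el K))

/-- `δ^min_K`: smallest value in the element `K` of a diagonal coefficient of the matrix `A`. -/
def DDMesh.diagMin (T : DDMesh Ωs) (A : E d → Matrix (Idx G Nh) (Idx G Nh) ℝ) (K : Fin T.size) :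
    ℝ := ⨅ a : Idx G Nh, sInf ((fun x => A x a a) '' interior (T.el K))

/-- The norm `‖(q, ψ)‖_S`; note `|Γ̃^{1/2} y|² = y · Γ̃ y`. -/
def DDMesh.normS (T : DDMesh Ωs) (Ω : Set (E d)) (X : CrossSections d G)
    (q : Idx G Nh → VField d) (ψ : Idx G Nh → E d → ℝ) : ℝ :=
  Real.sqrt (
    (∫ x in Ω, ∑ a, X.To Nh x a a * ‖(q a).val x‖ ^ 2) +
    (∫ x in Ω, ∑ a, X.Te Nh x a a * ψ a x ^ 2) +
    (∑ K, T.diagMax (X.To Nh) K * (T.cell K).h ^ 2 * ∫ x in T.el K, ∑ a, (q a).div x ^ 2) +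
    ∑ K, ∑ F ∈ T.bdryFacets Ω K, T.diagMax (X.To Nh) K * (T.cell K).hperp F *
      ∫ x in F, (fun a => (q a).tr x) ⬝ᵥ (matGammaT G Nh *ᵥ fun a => (q a).tr x) ∂(surf d))

/-- The local test space of the element `K`: broken fields supported in the neighbours of `K` in
its subdomain, and scalar functions supported in `K`. -/
def DDMesh.InLocal (T : DDMesh Ωs) (Ω : Set (E d)) (K : Fin T.size)
    (q : Idx G Nh → VField d) (ψ : Idx G Nh → E d → ℝ) : Prop :=
  (∀ a, InPQ Ω Ωs (q a)) ∧ (∀ a, MemLp (ψ a) 2 (volume.restrict Ω)) ∧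
  (∀ a, ∀ᵐ x ∂(volume.restrict Ω), x ∉ (⋃ K' ∈ T.nbr K, T.el K') → (q a).val x = 0) ∧
  (∀ a, ∀ᵐ x ∂(volume.restrict Ω), x ∉ T.el K → ψ a x = 0)

/-- The local norm `|(p, φ)|_{+,K}`, as an element of `[0, ∞]`; the supremum is not changed by
taking positive parts, because the local test space is symmetric. -/
def DDMesh.localNorm (T : DDMesh Ωs) (Ω : Set (E d)) (X : CrossSections d G) (K : Fin T.size)
    (p : Idx G Nh → VField d) (φ : Idx G Nh → E d → ℝ) : ℝ≥0∞ :=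
  ⨆ (q : Idx G Nh → VField d) (ψ : Idx G Nh → E d → ℝ) (_ : T.InLocal Ω K q ψ)
    (_ : T.normS Ω X q ψ ≤ 1), ENNReal.ofReal (formD Ω X p φ q ψ)

/-- The residual estimator `‖δ_e^{-1/2} (S_f - ℍᵀ div p_h - 𝕋_e φ̃_h)‖_{0,K}`. -/
def DDMesh.etaR (T : DDMesh Ωs) (X : CrossSections d G) (Sf : Idx G Nh → E d → ℝ)
    (p : Idx G Nh → VField d) (φ : Idx G Nh → E d → ℝ) (K : Fin T.size) : ℝ :=
  Real.sqrt (∫ x in T.el K, ∑ a, (X.Te Nh x a a)⁻¹ *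
    (Sf a x - ((matH G Nh)ᵀ *ᵥ fun b => (p b).div x) a - (X.Te Nh x *ᵥ fun b => φ b x) a) ^ 2)

/-- The flux estimator `‖δ_o^{-1/2} (𝕋_o p_h + ℍ grad φ̃_h)‖_{0,K}`, where `g = grad φ̃_h`. -/
def DDMesh.etaF (T : DDMesh Ωs) (X : CrossSections d G)
    (p : Idx G Nh → VField d) (g : Idx G Nh → E d → E d) (K : Fin T.size) : ℝ :=
  Real.sqrt (∫ x in T.el K, ∑ a, (X.To Nh x a a)⁻¹ *
    ‖∑ b, (X.To Nh x a b • (p b).val x + matH G Nh a b • g b x)‖ ^ 2)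

/-- The Robin estimator
`(δ^max_{o,K} h_{⊥F})^{-1/2} ‖Γ̃_e^{-1/2} (ℍ φ̃_h - Γ̃_e (p_h · n))‖_{0,F}` of a facet `F` of `K`,
where `t` is the trace of `φ̃_h`; note `|Γ̃^{-1/2} y|² = y · Γ̃⁻¹ y`. -/
def DDMesh.etaBC (T : DDMesh Ωs) (X : CrossSections d G)
    (p : Idx G Nh → VField d) (t : Idx G Nh → E d → ℝ) (K : Fin T.size) (F : Set (E d)) : ℝ :=
  (Real.sqrt (T.diagMax (X.To Nh) K * (T.cell K).hperp F))⁻¹ *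
  Real.sqrt (∫ x in F,
    (fun y : Idx G Nh → ℝ => y ⬝ᵥ ((matGammaT G Nh)⁻¹ *ᵥ y))
      ((matH G Nh *ᵥ fun b => t b x) - matGammaT G Nh *ᵥ fun b => (p b).tr x) ∂(surf d))

end

end SPN

/-! Each estimator is recovered by testing the error equation with one explicit pair supported in
the single element K. Subtract the formulation of the exact solution and integrate the
reconstruction by parts. For a field q supported in K whose normal trace lives on a boundary facet
F, the form d(ζ - ζ̃_h, (q, 0)) is minus the flux defect T_o p_h + H grad φ̃_h tested with q, plus
the Robin defect H φ̃_h - Γ̃_e (p_h · n) tested with q · n on F (`IsApproximation.formD_field`). For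
a scalar ψ supported in K, d(ζ - ζ̃_h, (0, ψ)) is the residual tested with ψ
(`IsApproximation.formD_scalar`). By homogeneity these values are at most ‖(q, ψ)‖_S times the local
norm (`DDMesh.InLocal.formD_le`). So it suffices to find tests whose pairing is essentially the
square of the estimator and whose norm is comparable with the estimator.

Residual: take ψ to be the residual divided by the diagonal of T_e. Pairing and squared norm both
equal the squared estimator, so the constant is 1.

Flux: on K the defect is a polynomial field of bounded degree (`IsApproximation.exists_defect_eq`).
The test is minus the defect times a smooth bump supported in a ball of radius ρ, a fixed fraction
of h_K, inside K. Inverse inequalities, obtained by compactness on the unit ball and then scaled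
(`exists_inverse`), bound the unweighted norm on a ball of radius h_K and the divergence of the test
by the weighted norm. Balls serve simplices and boxes alike, and shape regularity enters only
through h_K / ρ (`Cell.exists_isRegular`).

Robin: let z be Γ̃_e⁻¹ applied to the Robin defect. The test field points along the rays from the
centre a of the inscribed ball, with an intensity that is constant on each ray, scaled to have
normal component z on F. It is tangential to the lateral boundary of the cone over F, so its normal
trace is z on F and nothing elsewhere (`IsBase.green`), and the norms of its density and divergence
are explicit. The pairing also contains the flux defect, which is already under control. Coercivity
of Γ̃_e, with a constant independent of the number of groups (`exists_matGammaT_coercive`), compares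
the norms of z.

The cone field must be admissible in the broken space, and F must be counted once in the boundary
part of the norm. Both could fail if F touched other subdomains or elements, or if Ω lay on both
sides of F. Lipschitz regularity excludes this at almost every point of F
(`HasLipschitzBoundary.one_sided`, `IsBase.ae_isolated`). -/

namespace SPN

noncomputable section

section

variable {d G Nh n : ℕ} {Ωs : Fin n → Set (E d)}

/-! ### Coordinates along a unit vector, and cones -/

/-- The direction of the hyperplanes with normal `u`. -/
abbrev Perp (u : E d) : Submodule ℝ (E d) := (Submodule.span ℝ {u})ᗮ

theorem inner_perp (u : E d) (w : Perp u) : inner ℝ (w : E d) u = 0 := by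
  have := w.2
  rw [Submodule.mem_orthogonal_singleton_iff_inner_left] at this
  exact this

theorem finrank_perp {u : E d} (hu : ‖u‖ = 1) : Module.finrank ℝ (Perp u) = d - 1 := by
  have h := (Submodule.span ℝ {u}).finrank_add_finrank_orthogonal
  rw [finrank_span_singleton (by intro h0; simp [h0] at hu), finrank_euclideanSpace_fin] at h
  change Module.finrank ℝ (Submodule.span ℝ {u})ᗮ = d - 1
  omega

theorem pos_dim_of_unit {u : E d} (hu : ‖u‖ = 1) : 1 ≤ d := by
  rcases Nat.eq_zero_or_pos d with h | h
  · subst h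
    have : u = 0 := Subsingleton.elim _ _
    simp [this] at hu
  · exact h

/-- A point of the hyperplane with normal `u` through `p`. -/
def onPlane (p u : E d) (w : Perp u) : E d := p + (w : E d)

theorem isometry_onPlane (p u : E d) : Isometry (onPlane p u) := by
  refine Isometry.of_dist_eq fun v w => ?_
  rw [onPlane, onPlane, dist_add_left]; rfl

theorem range_onPlane (p : E d) {u : E d} :
    range (onPlane p u) = {y | inner ℝ y u = inner ℝ p u} := by
  ext y
  constructor
  · rintro ⟨w, rfl⟩
    simp [onPlane, inner_add_left, inner_perp]
  · intro h
    refine ⟨⟨y - p, ?_⟩, by simp [onPlane]⟩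
    rw [Submodule.mem_orthogonal_singleton_iff_inner_left, inner_sub_left]
    exact sub_eq_zero.2 h

/-- The surface measure is normalised to agree with Lebesgue measure on inner product spaces and
isometries preserve it, so surface integrals on a hyperplane become Lebesgue integrals over `Perp
u`. -/
theorem map_onPlane (p : E d) {u : E d} (hu : ‖u‖ = 1) :
    (volume : Measure (Perp u)).map (onPlane p u) =
      (surf d).restrict {y | inner ℝ y u = inner ℝ p u} := by
  rw [← range_onPlane, surf, ← finrank_perp hu,
    ← InnerProductSpace.euclideanHausdorffMeasure_eq_volume (V := Perp u),
    (isometry_onPlane p u).map_euclideanHausdorffMeasure]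

theorem measurePreserving_onPlane (p : E d) {u : E d} (hu : ‖u‖ = 1) {F : Set (E d)}
    (hF : MeasurableSet F) (hFp : F ⊆ {y | inner ℝ y u = inner ℝ p u}) :
    MeasurePreserving (onPlane p u) (volume.restrict (onPlane p u ⁻¹' F))
      ((surf d).restrict F) := by
  have hm : Measurable (onPlane p u) := (isometry_onPlane p u).continuous.measurable
  refine ⟨hm, ?_⟩
  rw [← Measure.restrict_map hm hF, map_onPlane p hu, Measure.restrict_restrict hF,
    inter_eq_self_of_subset_left hFp]

theorem surf_image_onPlane (p : E d) {u : E d} (hu : ‖u‖ = 1) (A : Set (Perp u)) :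
    surf d (onPlane p u '' A) = volume A := by
  rw [surf, (isometry_onPlane p u).euclideanHausdorffMeasure_image, ← finrank_perp hu,
    InnerProductSpace.euclideanHausdorffMeasure_eq_volume]

/-- Orthogonal coordinates: a height along `u` and a position in the hyperplane. Every slicing
argument below rests on them. -/
theorem measurePreserving_slices (a : E d) {u : E d} (hu : ‖u‖ = 1) :
    MeasurePreserving (fun p : ℝ × Perp u => a + (p.1 • u + (p.2 : E d))) := by
  have h1 := (LinearIsometryEquiv.toSpanUnitSingleton (𝕜 := ℝ) u hu).measurePreserving
  have h2 := ((Submodule.span ℝ {u}).measurePreserving_measurableEquivProd a).symm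
  have h3 := h2.comp (h1.prod (MeasurePreserving.id (volume : Measure (Perp u))))
  have h4 : (μHE[Module.finrank ℝ (E d)] : Measure (E d)) = volume :=
    InnerProductSpace.euclideanHausdorffMeasure_eq_volume
  rw [h4] at h3
  rw [Measure.volume_eq_prod]
  convert h3 using 1
  ext p : 1
  simp [add_comm]

/-- The slab between the hyperplanes with normal `u` through `a` and at distance `H` of it. -/
def slab (a u : E d) (H : ℝ) : Set (E d) := {y | 0 < inner ℝ (y - a) u ∧ inner ℝ (y - a) u < H}

theorem isOpen_slab (a u : E d) (H : ℝ) : IsOpen (slab a u H) := by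
  have h : Continuous fun y : E d => (inner ℝ (y - a) u : ℝ) := by fun_prop
  exact (isOpen_lt continuous_const h).inter (isOpen_lt h continuous_const)

theorem slice_mem_slab (a : E d) {u : E d} (hu : ‖u‖ = 1) (H : ℝ) (p : ℝ × Perp u) :
    a + (p.1 • u + (p.2 : E d)) ∈ slab a u H ↔ p.1 ∈ Ioo 0 H := by
  have : inner ℝ (a + (p.1 • u + (p.2 : E d)) - a) u = p.1 := by
    rw [add_sub_cancel_left, inner_add_left, inner_perp, inner_smul_left, real_inner_self_eq_norm_sq,
      hu]
    simp
  rw [slab, mem_ofPred_eq, this]; rfl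

/-- Conical coordinates with apex `a`. -/
def coneMap (a u : E d) (H : ℝ) (p : ℝ × Perp u) : E d := a + p.1 • (H • u + (p.2 : E d))

/-- The density of the conical coordinates. -/
def coneMeasure (u : E d) (H : ℝ) : Measure (ℝ × Perp u) :=
  ((volume.restrict (Ioo (0 : ℝ) 1)).withDensity
    fun s => ENNReal.ofReal (H * s ^ (d - 1))).prod volume

/-- The section of a cone at relative height `s` is its base shrunk by `s` in dimension `d - 1`;
this is where the weight `s ^ (d - 1)` comes from. -/
theorem lintegral_perp_smul {u : E d} (hu : ‖u‖ = 1) {s : ℝ} (hs : 0 < s) (f : Perp u → ℝ≥0∞) :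
    ENNReal.ofReal (s ^ (d - 1)) * ∫⁻ w, f (s • w) = ∫⁻ w, f w := by
  have h := Measure.map_addHaar_smul (volume : Measure (Perp u)) hs.ne'
  have h2 : ∫⁻ w, f (s • w) = ∫⁻ w, f w ∂(Measure.map (s • ·) (volume : Measure (Perp u))) :=
    ((Homeomorph.smulOfNeZero s hs.ne').measurableEmbedding.lintegral_map f).symm
  rw [h2, h, lintegral_smul_measure, finrank_perp hu, smul_eq_mul, ← mul_assoc,
    ← ENNReal.ofReal_mul (by positivity), abs_of_pos (by positivity),
    mul_inv_cancel₀ (by positivity)]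
  simp

theorem lintegral_slab (a : E d) {u : E d} (hu : ‖u‖ = 1) (H : ℝ) {f : E d → ℝ≥0∞}
    (hf : Measurable f) :
    ∫⁻ y in slab a u H, f y = ∫⁻ s in Ioo 0 H, ∫⁻ w : Perp u, f (a + (s • u + (w : E d))) := by
  have hm := (measurePreserving_slices a hu)
  rw [← lintegral_indicator (isOpen_slab a u H).measurableSet,
    ← hm.lintegral_comp (hf.indicator (isOpen_slab a u H).measurableSet),
    Measure.volume_eq_prod, lintegral_prod, ← lintegral_indicator measurableSet_Ioo]
  · refine lintegral_congr fun s => ?_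
    by_cases hs : s ∈ Ioo 0 H
    · rw [indicator_of_mem hs]
      refine lintegral_congr fun w => ?_
      rw [indicator_of_mem ((slice_mem_slab a hu H (s, w)).2 hs)]
    · rw [indicator_of_notMem hs]
      rw [← lintegral_zero (μ := (volume : Measure (Perp u)))]
      refine lintegral_congr fun w => ?_
      rw [indicator_of_notMem fun h => hs ((slice_mem_slab a hu H (s, w)).1 h)]
  · exact ((hf.indicator (isOpen_slab a u H).measurableSet).comp hm.measurable).aemeasurable

theorem measurable_coneMap (a u : E d) (H : ℝ) : Measurable (coneMap a u H) := by
  have : Continuous (coneMap a u H) := by unfold coneMap; fun_prop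
  exact this.measurable

theorem lintegral_Ioo_scale {H : ℝ} (hH : 0 < H) (f : ℝ → ℝ≥0∞) :
    ∫⁻ s in Ioo 0 H, f s = ∫⁻ s in Ioo (0 : ℝ) 1, ENNReal.ofReal H * f (s * H) := by
  have h := lintegral_image_eq_lintegral_abs_deriv_mul (f := fun s : ℝ => s * H) (f' := fun _ => H)
    (s := Ioo (0 : ℝ) 1) measurableSet_Ioo
    (fun x _ => by simpa using ((hasDerivAt_id x).mul_const H).hasDerivWithinAt)
    (fun x _ y _ hxy => by simpa [hH.ne'] using hxy) f
  rw [abs_of_pos hH] at h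
  rw [← h]
  congr 2
  rw [image_mul_right_Ioo _ _ hH]
  simp

/-- Change of variables slice by slice: the height `s * H` contributes a factor `H`, and rescaling
the slice at that height contributes `s ^ (d - 1)`. No Jacobian determinant in ℝᵈ has to be
computed. -/
theorem measurePreserving_coneMap (a : E d) {u : E d} (hu : ‖u‖ = 1) {H : ℝ} (hH : 0 < H) :
    MeasurePreserving (coneMap a u H) (coneMeasure u H) (volume.restrict (slab a u H)) := by
  have hm := measurable_coneMap a u H
  refine ⟨hm, ?_⟩
  refine Measure.ext_of_lintegral _ fun f hf => ?_
  rw [lintegral_map hf hm, coneMeasure, lintegral_prod (fun p => f (coneMap a u H p)) (hf.comp hm).aemeasurable,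
    lintegral_withDensity_eq_lintegral_mul₀ (by fun_prop)
      (show Measurable fun s => ∫⁻ w : Perp u, f (coneMap a u H (s, w)) from
        (hf.comp hm).lintegral_prod_right').aemeasurable,
    lintegral_slab a hu H hf, lintegral_Ioo_scale hH]
  refine setLIntegral_congr_fun measurableSet_Ioo fun s hs => ?_
  simp only [Pi.mul_apply]
  rw [ENNReal.ofReal_mul hH.le, mul_assoc,
    ← lintegral_perp_smul hu hs.1 (fun w => f (a + ((s * H) • u + (w : E d))))]
  congr 2
  refine lintegral_congr fun w => ?_
  simp [coneMap, smul_smul]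

end

section

variable {d G Nh n : ℕ} {Ωs : Fin n → Set (E d)}

/-! ### Test functions -/

theorem inner_gradient_eq (v : E d → ℝ) (x z : E d) : inner ℝ z (∇ v x) = fderiv ℝ v x z := by
  rw [inner_gradient_right]; rfl

theorem gradient_eq_toDual_symm (v : E d → ℝ) :
    ∇ v = fun x => (InnerProductSpace.toDual ℝ (E d)).symm (fderiv ℝ v x) := rfl

theorem ContDiff.continuous_gradient {v : E d → ℝ} (hv : ContDiff ℝ ∞ v) : Continuous (∇ v) := by
  rw [gradient_eq_toDual_symm]
  exact (LinearIsometryEquiv.continuous _).comp (hv.continuous_fderiv (by simp))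

theorem IsTest.continuous_gradient {v : E d → ℝ} (hv : IsTest v) : Continuous (∇ v) :=
  ContDiff.continuous_gradient hv.1

theorem HasCompactSupport.gradient {v : E d → ℝ} (hv : HasCompactSupport v) :
    HasCompactSupport (∇ v) := by
  rw [gradient_eq_toDual_symm]
  exact (hv.fderiv (𝕜 := ℝ)).comp_left (map_zero _)

theorem IsTest.exists_bound {v : E d → ℝ} (hv : IsTest v) :
    ∃ C : ℝ, ∀ x, ‖v x‖ ≤ C ∧ ‖∇ v x‖ ≤ C := by
  obtain ⟨C₁, h₁⟩ := hv.2.exists_bound_of_continuous hv.1.continuous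
  obtain ⟨C₂, h₂⟩ := (HasCompactSupport.gradient hv.2).exists_bound_of_continuous
    hv.continuous_gradient
  exact ⟨max C₁ C₂, fun x => ⟨(h₁ x).trans (le_max_left _ _), (h₂ x).trans (le_max_right _ _)⟩⟩

theorem IsTest.memLp {v : E d → ℝ} (hv : IsTest v) (μ : Measure (E d))
    [IsFiniteMeasureOnCompacts μ] (p : ℝ≥0∞) : MemLp v p μ :=
  hv.1.continuous.memLp_of_hasCompactSupport hv.2

theorem IsTest.memLp_gradient {v : E d → ℝ} (hv : IsTest v) (μ : Measure (E d))
    [IsFiniteMeasureOnCompacts μ] (p : ℝ≥0∞) : MemLp (∇ v) p μ :=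
  hv.continuous_gradient.memLp_of_hasCompactSupport (HasCompactSupport.gradient hv.2)

/-! ### Cone fields -/

/-- The radial projection with centre `a` on the hyperplane at distance `H` of `a`. -/
def conePt (a u : E d) (H : ℝ) (y : E d) : E d := a + (H / inner ℝ (y - a) u) • (y - a)

open Classical in
/-- The extension of `g` that is constant on the rays from `a`. -/
def coneExt (a u : E d) (H : ℝ) (g : E d → ℝ) (y : E d) : ℝ :=
  if y ∈ slab a u H then g (conePt a u H y) else 0

/-- The field with normal component `g` on the hyperplane, directed along the rays from `a`. -/
def coneField (a u : E d) (H : ℝ) (g : E d → ℝ) (y : E d) : E d :=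
  (coneExt a u H g y / H) • (y - a)

/-- The divergence of the cone field. -/
def coneDiv (a u : E d) (H : ℝ) (g : E d → ℝ) (y : E d) : ℝ := d * (coneExt a u H g y / H)

theorem measurable_conePt (a u : E d) (H : ℝ) : Measurable (conePt a u H) := by
  unfold conePt
  have h1 : Measurable fun y : E d => (inner ℝ (y - a) u : ℝ) := by
    have : Continuous fun y : E d => (inner ℝ (y - a) u : ℝ) := by fun_prop
    exact this.measurable
  exact measurable_const.add ((measurable_const.div h1).smul (measurable_id.sub_const a))

theorem measurable_coneExt (a u : E d) (H : ℝ) {g : E d → ℝ} (hg : Measurable g) :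
    Measurable (coneExt a u H g) := by
  unfold coneExt
  exact Measurable.ite (isOpen_slab a u H).measurableSet (hg.comp (measurable_conePt a u H))
    measurable_const

theorem inner_coneMap (a : E d) {u : E d} (hu : ‖u‖ = 1) (H : ℝ) (p : ℝ × Perp u) :
    inner ℝ (coneMap a u H p - a) u = p.1 * H := by
  rw [coneMap, add_sub_cancel_left, inner_smul_left, inner_add_left, inner_perp, inner_smul_left,
    real_inner_self_eq_norm_sq, hu]
  simp

theorem coneMap_mem_slab (a : E d) {u : E d} (hu : ‖u‖ = 1) {H : ℝ} (hH : 0 < H) {p : ℝ × Perp u}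
    (hp : p.1 ∈ Ioo (0 : ℝ) 1) : coneMap a u H p ∈ slab a u H := by
  rw [slab, mem_ofPred_eq, inner_coneMap a hu]
  exact ⟨mul_pos hp.1 hH, by nlinarith [hp.2]⟩

theorem conePt_coneMap (a : E d) {u : E d} (hu : ‖u‖ = 1) {H : ℝ} (hH : 0 < H) {p : ℝ × Perp u}
    (hp : p.1 ∈ Ioo (0 : ℝ) 1) : conePt a u H (coneMap a u H p) = onPlane (a + H • u) u p.2 := by
  have := hp.1
  rw [conePt, inner_coneMap a hu, coneMap, add_sub_cancel_left, smul_smul, onPlane, add_assoc]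
  congr 1
  rw [show H / (p.1 * H) * p.1 = 1 by field_simp, one_smul]

theorem coneExt_coneMap (a : E d) {u : E d} (hu : ‖u‖ = 1) {H : ℝ} (hH : 0 < H) {p : ℝ × Perp u}
    (hp : p.1 ∈ Ioo (0 : ℝ) 1) (g : E d → ℝ) :
    coneExt a u H g (coneMap a u H p) = g (onPlane (a + H • u) u p.2) := by
  rw [coneExt, if_pos (coneMap_mem_slab a hu hH hp), conePt_coneMap a hu hH hp]

/-- The weight of one ray: a cone of height `H` has volume `H / d` times the area of its base. -/
theorem lintegral_cone_density (hd : 1 ≤ d) {H : ℝ} (hH : 0 < H) :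
    ∫⁻ s in Ioo (0 : ℝ) 1, ENNReal.ofReal (H * s ^ (d - 1)) = ENNReal.ofReal (H / d) := by
  rw [← ofReal_integral_eq_lintegral_ofReal]
  · rw [← integral_Ioc_eq_integral_Ioo, ← intervalIntegral.integral_of_le zero_le_one,
      intervalIntegral.integral_const_mul, integral_pow]
    rw [Nat.sub_add_cancel hd]
    simp [Nat.cast_sub hd, zero_pow (show d ≠ 0 by omega), div_eq_mul_inv]
  · exact (Continuous.integrableOn_Icc (by fun_prop)).mono_set Ioo_subset_Icc_self
  · filter_upwards [ae_restrict_mem measurableSet_Ioo] with s hs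
    exact mul_nonneg hH.le (pow_nonneg hs.1.le _)

/-- A part `F` of the hyperplane with unit normal `u` at distance `H` of the point `a`. -/
structure IsBase (a u : E d) (H : ℝ) (F : Set (E d)) : Prop where
  unit : ‖u‖ = 1
  pos : 0 < H
  compact : IsCompact F
  subset : F ⊆ {y | inner ℝ y u = inner ℝ a u + H}

variable {a u : E d} {H : ℝ} {F : Set (E d)} {g : E d → ℝ}

theorem IsBase.subset' (h : IsBase a u H F) :
    F ⊆ {y | inner ℝ y u = inner ℝ (a + H • u) u} := by
  intro y hy
  have := h.subset hy
  rw [mem_ofPred_eq] at this ⊢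
  rw [this, inner_add_left, inner_smul_left, real_inner_self_eq_norm_sq, h.unit]
  simp

theorem IsBase.measurePreserving (h : IsBase a u H F) :
    MeasurePreserving (onPlane (a + H • u) u) (volume.restrict (onPlane (a + H • u) u ⁻¹' F))
      ((surf d).restrict F) :=
  measurePreserving_onPlane _ h.unit h.compact.measurableSet h.subset'

theorem IsBase.isCompact_preimage (h : IsBase a u H F) :
    IsCompact (onPlane (a + H • u) u ⁻¹' F) :=
  (isometry_onPlane _ u).isClosedEmbedding.isCompact_preimage h.compact

theorem IsBase.surf_lt_top (h : IsBase a u H F) : surf d F < ⊤ := by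
  have h1 := h.measurePreserving.measure_preimage MeasurableSet.univ.nullMeasurableSet
  rw [Measure.restrict_apply_univ] at h1
  rw [← h1, preimage_univ, Measure.restrict_apply_univ]
  exact h.isCompact_preimage.measure_lt_top

/-- The extension is constant along rays, so the integral over the cone splits into an integral over
the base and the weight of a ray. A general `Φ` yields integrability, square integrability and the
exact L² norm from one computation. -/
theorem IsBase.lintegral_coneExt (h : IsBase a u H F) (hg : Measurable g) (hgF : ∀ y ∉ F, g y = 0)
    {Φ : ℝ → ℝ≥0∞} (hΦ : Measurable Φ) (hΦ0 : Φ 0 = 0) :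
    ∫⁻ y, Φ (coneExt a u H g y) = ENNReal.ofReal (H / d) * ∫⁻ y in F, Φ (g y) ∂(surf d) := by
  have hm := measurePreserving_coneMap a h.unit h.pos
  have hs : ∫⁻ y, Φ (coneExt a u H g y) = ∫⁻ y in slab a u H, Φ (coneExt a u H g y) := by
    rw [setLIntegral_eq_of_support_subset]
    intro y hy
    by_contra hys
    exact hy (by simp [coneExt, hys, hΦ0])
  rw [hs, ← hm.lintegral_comp (f := fun y => Φ (coneExt a u H g y))
      (hΦ.comp (measurable_coneExt a u H hg)), coneMeasure,
    lintegral_prod (fun p => Φ (coneExt a u H g (coneMap a u H p)))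
      ((hΦ.comp (measurable_coneExt a u H hg)).comp hm.measurable).aemeasurable]
  have hae : ∀ᵐ s ∂((volume.restrict (Ioo (0 : ℝ) 1)).withDensity
      fun s => ENNReal.ofReal (H * s ^ (d - 1))), s ∈ Ioo (0 : ℝ) 1 :=
    (withDensity_absolutelyContinuous _ _).ae_le (ae_restrict_mem measurableSet_Ioo)
  have h2 : ∫⁻ y in F, Φ (g y) ∂(surf d) =
      ∫⁻ w : Perp u, Φ (g (onPlane (a + H • u) u w)) := by
    rw [← h.measurePreserving.lintegral_comp (f := fun y => Φ (g y)) (hΦ.comp hg)]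
    refine setLIntegral_eq_of_support_subset ?_
    intro w hw
    by_contra hwF
    exact hw (by simp only [hgF _ hwF, hΦ0])
  rw [lintegral_congr_ae (g := fun _ => ∫⁻ w : Perp u, Φ (g (onPlane (a + H • u) u w)))
    (hae.mono fun s hs => lintegral_congr fun w => by
      rw [coneExt_coneMap a h.unit h.pos (p := (s, w)) hs]),
    lintegral_const, withDensity_apply _ MeasurableSet.univ, Measure.restrict_univ,
    lintegral_cone_density (pos_dim_of_unit h.unit) h.pos, h2, mul_comm]

end

/-! ### Cone fields: integrability and Green's formula -/

section

variable {d G Nh n : ℕ} {Ωs : Fin n → Set (E d)}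

variable {a u : E d} {H : ℝ} {F : Set (E d)} {g : E d → ℝ}

theorem IsBase.memLp_coneExt (h : IsBase a u H F) (hg : Measurable g) (hgF : ∀ y ∉ F, g y = 0)
    (hg2 : MemLp g 2 ((surf d).restrict F)) : MemLp (coneExt a u H g) 2 volume := by
  refine ⟨(measurable_coneExt a u H hg).aestronglyMeasurable, ?_⟩
  rw [eLpNorm_lt_top_iff_lintegral_rpow_enorm_lt_top (by simp) (by simp)]
  rw [h.lintegral_coneExt hg hgF (Φ := fun x => ‖x‖ₑ ^ ((2 : ℝ≥0∞).toReal)) (by fun_prop)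
    (by simp)]
  have := hg2.2
  rw [eLpNorm_lt_top_iff_lintegral_rpow_enorm_lt_top (by simp) (by simp)] at this
  exact ENNReal.mul_lt_top ENNReal.ofReal_lt_top this

theorem IsBase.integrable_coneExt (h : IsBase a u H F) (hg : Measurable g)
    (hgF : ∀ y ∉ F, g y = 0) (hg2 : MemLp g 2 ((surf d).restrict F)) :
    Integrable (coneExt a u H g) volume := by
  refine ⟨(measurable_coneExt a u H hg).aestronglyMeasurable, ?_⟩
  have : IsFiniteMeasure ((surf d).restrict F) :=
    ⟨by rw [Measure.restrict_apply_univ]; exact h.surf_lt_top⟩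
  have h1 : Integrable g ((surf d).restrict F) := hg2.integrable (by norm_num)
  rw [hasFiniteIntegral_def, h.lintegral_coneExt hg hgF (Φ := fun x => ‖x‖ₑ) (by fun_prop)
    (by simp)]
  exact ENNReal.mul_lt_top ENNReal.ofReal_lt_top h1.2

theorem IsBase.integral_coneExt_sq (h : IsBase a u H F) (hg : Measurable g)
    (hgF : ∀ y ∉ F, g y = 0) :
    ∫ y, coneExt a u H g y ^ 2 = H / d * ∫ y in F, g y ^ 2 ∂(surf d) := by
  rw [integral_eq_lintegral_of_nonneg_ae (ae_of_all _ fun _ => sq_nonneg _)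
      ((measurable_coneExt a u H hg).pow_const 2).aestronglyMeasurable,
    integral_eq_lintegral_of_nonneg_ae (ae_of_all _ fun _ => sq_nonneg _)
      (hg.pow_const 2).aestronglyMeasurable,
    h.lintegral_coneExt hg hgF (Φ := fun x => ENNReal.ofReal (x ^ 2)) (by fun_prop) (by simp),
    ENNReal.toReal_mul, ENNReal.toReal_ofReal (div_nonneg h.pos.le (Nat.cast_nonneg d))]

/-- The integrand is the derivative of `s ^ d * v (a + s • z)`, and the value at the apex vanishes
because `1 ≤ d`. -/
theorem integral_cone_ray (hd : 1 ≤ d) {v : E d → ℝ} (hv : IsTest v) (a z : E d) :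
    ∫ s in Ioo (0 : ℝ) 1, (s ^ d * inner ℝ z (∇ v (a + s • z)) + d * s ^ (d - 1) * v (a + s • z)) =
      v (a + z) := by
  rw [← integral_Ioc_eq_integral_Ioo, ← intervalIntegral.integral_of_le zero_le_one]
  have hc := hv.continuous_gradient
  have hc' := hv.1.continuous
  rw [intervalIntegral.integral_eq_sub_of_hasDerivAt (f := fun s : ℝ => s ^ d * v (a + s • z))]
  · simp [zero_pow (show d ≠ 0 by omega)]
  · intro s _
    have h1 : HasDerivAt (fun s : ℝ => a + s • z) z s := by
      simpa using ((hasDerivAt_id s).smul_const z).const_add a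
    have h2 := (hv.1.differentiable (by simp) (a + s • z)).hasFDerivAt.comp_hasDerivAt s h1
    have h3 := (hasDerivAt_pow d s).mul h2
    rw [inner_gradient_eq]
    convert! h3 using 1
    simp [Function.comp]
    ring
  · exact Continuous.intervalIntegrable (by fun_prop) _ _

/-- The integrand is `coneExt`, which is integrable, times a continuous compactly supported function
built from `v`, its gradient and `y - a`. -/
theorem IsBase.integrable_green (h : IsBase a u H F) (hg : Measurable g)
    (hgF : ∀ y ∉ F, g y = 0) (hg2 : MemLp g 2 ((surf d).restrict F)) {v : E d → ℝ}
    (hv : IsTest v) :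
    Integrable fun y => inner ℝ (coneField a u H g y) (∇ v y) + coneDiv a u H g y * v y := by
  have hc := hv.continuous_gradient
  have hc' := hv.1.continuous
  have hw : Continuous fun y => (inner ℝ (y - a) (∇ v y) + d * v y) / H := by fun_prop
  have hws : HasCompactSupport fun y => (inner ℝ (y - a) (∇ v y) + d * v y) / H := by
    refine hv.2.mono' ?_
    intro y hy
    by_contra hyt
    have h1 : v y = 0 := image_eq_zero_of_notMem_tsupport hyt
    have h2 : ∇ v y = 0 := by
      rw [gradient_eq_toDual_symm]
      have : fderiv ℝ v y = 0 := by
        by_contra hf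
        exact hyt (support_fderiv_subset ℝ hf)
      simp [this]
    exact hy (by simp [h1, h2])
  obtain ⟨C, hC⟩ := hws.exists_bound_of_continuous hw
  have := (h.integrable_coneExt hg hgF hg2).mul_bdd hw.aestronglyMeasurable (ae_of_all _ hC)
  refine this.congr (ae_of_all _ fun y => ?_)
  simp only [coneField, coneDiv, inner_smul_left, conj_trivial]
  ring

/-- In conical coordinates Green's formula is the fundamental theorem of calculus on each ray. Only
the base contributes, as the field is tangential to the lateral boundary of the cone. Since nothing
is differentiated across rays, `g` may be any square-integrable function. -/
theorem IsBase.green (h : IsBase a u H F) (hg : Measurable g)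
    (hgF : ∀ y ∉ F, g y = 0) (hg2 : MemLp g 2 ((surf d).restrict F)) {v : E d → ℝ}
    (hv : IsTest v) :
    ∫ y, (inner ℝ (coneField a u H g y) (∇ v y) + coneDiv a u H g y * v y) =
      ∫ y in F, g y * v y ∂(surf d) := by
  have hm := measurePreserving_coneMap a h.unit h.pos
  have hint := h.integrable_green hg hgF hg2 hv
  set f : E d → ℝ := fun y => inner ℝ (coneField a u H g y) (∇ v y) + coneDiv a u H g y * v y
    with hf
  have hs : ∫ y, f y = ∫ y in slab a u H, f y := by
    rw [setIntegral_eq_integral_of_forall_compl_eq_zero]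
    intro y hy
    simp [hf, coneField, coneDiv, coneExt, hy]
  have hint' : Integrable (fun p => f (coneMap a u H p)) (coneMeasure u H) :=
    (hm.integrable_comp hint.restrict.aestronglyMeasurable).2 hint.restrict
  have h1 : ∫ y in slab a u H, f y = ∫ p, f (coneMap a u H p) ∂(coneMeasure u H) := by
    rw [← hm.map_eq, integral_map hm.measurable.aemeasurable]
    rw [hm.map_eq]
    exact hint.restrict.aestronglyMeasurable
  rw [hs, h1]
  unfold coneMeasure at hint' ⊢
  rw [integral_prod_symm _ hint']
  -- One ray, with its end point on the base fixed: `g` is a constant there and the factors `H` of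
  -- the density and of the field cancel.
  have h2 : ∀ w : Perp u, ∫ s, f (coneMap a u H (s, w))
      ∂((volume.restrict (Ioo (0 : ℝ) 1)).withDensity fun s => ENNReal.ofReal (H * s ^ (d - 1))) =
      g (onPlane (a + H • u) u w) * v (onPlane (a + H • u) u w) := by
    intro w
    rw [integral_withDensity_eq_integral_toReal_smul (by fun_prop)
      (ae_of_all _ fun _ => ENNReal.ofReal_lt_top)]
    have h3 : ∀ s ∈ Ioo (0 : ℝ) 1, (ENNReal.ofReal (H * s ^ (d - 1))).toReal •
        f (coneMap a u H (s, w)) = g (onPlane (a + H • u) u w) *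
        (s ^ d * inner ℝ (H • u + (w : E d)) (∇ v (a + s • (H • u + (w : E d)))) +
          d * s ^ (d - 1) * v (a + s • (H • u + (w : E d)))) := by
      intro s hs
      have hH := h.pos
      rw [ENNReal.toReal_ofReal (mul_nonneg h.pos.le (pow_nonneg hs.1.le _)), smul_eq_mul]
      simp only [hf, coneField, coneDiv]
      rw [coneExt_coneMap a h.unit h.pos (p := (s, w)) hs]
      simp only [coneMap, add_sub_cancel_left, inner_smul_left, conj_trivial]
      have hsd : s ^ d = s ^ (d - 1) * s := by
        rw [← pow_succ, Nat.sub_add_cancel (pos_dim_of_unit h.unit)]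
      rw [hsd]
      field_simp
    rw [setIntegral_congr_fun measurableSet_Ioo h3, integral_const_mul,
      integral_cone_ray (pos_dim_of_unit h.unit) hv, onPlane, add_assoc]
  simp_rw [h2]
  have hgv : AEStronglyMeasurable (fun y => g y * v y)
      (Measure.map (onPlane (a + H • u) u) (volume.restrict (onPlane (a + H • u) u ⁻¹' F))) :=
    (hg.mul hv.1.continuous.measurable).aestronglyMeasurable
  rw [← h.measurePreserving.map_eq,
    integral_map h.measurePreserving.measurable.aemeasurable hgv,
    setIntegral_eq_integral_of_forall_compl_eq_zero]
  intro w hw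
  rw [hgF _ hw, zero_mul]

/-- The cone over `F` lies in every convex set that contains `F` and the apex. -/
theorem IsBase.coneExt_eq_zero (h : IsBase a u H F) (hgF : ∀ y ∉ F, g y = 0) {K : Set (E d)}
    (hK : Convex ℝ K) (haK : a ∈ K) (hFK : F ⊆ K) {y : E d} (hy : y ∉ K) :
    coneExt a u H g y = 0 := by
  by_cases hs : y ∈ slab a u H
  · rw [coneExt, if_pos hs]
    refine hgF _ fun hF => hy ?_
    have h1 := hs.1
    have hH := h.pos
    have hy' : y = a + (inner ℝ (y - a) u / H) • (conePt a u H y - a) := by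
      rw [conePt, add_sub_cancel_left, smul_smul,
        show inner ℝ (y - a) u / H * (H / inner ℝ (y - a) u) = 1 by field_simp, one_smul]
      simp
    rw [hy']
    exact hK.add_smul_sub_mem haK (hFK hF)
      ⟨(div_pos h1 hH).le, ((div_lt_one hH).2 hs.2).le⟩
  · rw [coneExt, if_neg hs]

end

section

variable {d G Nh n : ℕ} {Ωs : Fin n → Set (E d)}

/-! ### Geometry of the elements -/

/-- The volume of the unit ball of a hyperplane. -/
def ballVol (d : ℕ) : ℝ := (volume (Metric.ball (0 : E (d - 1)) 1)).toReal

theorem ballVol_pos : 0 < ballVol d :=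
  ENNReal.toReal_pos (Metric.measure_ball_pos _ _ one_pos).ne' Metric.isBounded_ball.measure_lt_top.ne

theorem volume_unit_ball_perp {u : E d} (hu : ‖u‖ = 1) :
    volume (Metric.ball (0 : Perp u) 1) = ENNReal.ofReal (ballVol d) := by
  rw [ballVol, ENNReal.ofReal_toReal Metric.isBounded_ball.measure_lt_top.ne]
  let b : OrthonormalBasis (Fin (d - 1)) ℝ (Perp u) :=
    (stdOrthonormalBasis ℝ (Perp u)).reindex (finCongr (finrank_perp hu))
  have h := b.measurePreserving_repr.measure_preimage
    (s := Metric.ball (0 : E (d - 1)) 1) measurableSet_ball.nullMeasurableSet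
  rw [← h]
  congr 1
  ext w
  simp

/-- The set fits in a cylinder of height `w` over a ball of radius `h` of the hyperplane. Read
backwards, a lower bound of the volume forces a lower bound of the width. -/
theorem volume_le_of_slab {u : E d} (hu : ‖u‖ = 1) {K : Set (E d)} (hK : MeasurableSet K)
    {z : E d} {h α w : ℝ} (h0 : 0 ≤ h) (hz : K ⊆ Metric.closedBall z h)
    (hs : ∀ y ∈ K, α ≤ inner ℝ y u ∧ inner ℝ y u ≤ α + w) :
    volume K ≤ ENNReal.ofReal (w * h ^ (d - 1) * ballVol d) := by
  rcases K.eq_empty_or_nonempty with rfl | ⟨y₀, hy₀⟩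
  · simp
  have hw : 0 ≤ w := by have := hs y₀ hy₀; linarith
  rw [← (measurePreserving_slices z hu).measure_preimage hK.nullMeasurableSet]
  have hsub : (fun p : ℝ × Perp u => z + (p.1 • u + (p.2 : E d))) ⁻¹' K ⊆
      Icc (α - inner ℝ z u) (α - inner ℝ z u + w) ×ˢ Metric.closedBall (0 : Perp u) h := by
    rintro ⟨s, p⟩ hp
    have h1 := hs _ hp
    have h2 := hz hp
    have huu : (inner ℝ u u : ℝ) = 1 := by rw [real_inner_self_eq_norm_sq, hu]; norm_num
    simp only [inner_add_left, inner_smul_left, inner_perp, huu, conj_trivial] at h1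
    rw [mem_closedBall_iff_norm, add_sub_cancel_left] at h2
    refine ⟨⟨by linarith, by linarith⟩, ?_⟩
    rw [mem_closedBall_zero_iff]
    have h3 : ‖s • u + (p : E d)‖ ^ 2 = ‖s • u‖ ^ 2 + ‖(p : E d)‖ ^ 2 := by
      rw [norm_add_sq_real, inner_smul_left, real_inner_comm, inner_perp]
      simp
    have h4 : ‖p‖ = ‖(p : E d)‖ := rfl
    rw [h4]
    refine le_trans ?_ h2
    rw [← sq_le_sq₀ (norm_nonneg _) (norm_nonneg _), h3]
    exact le_add_of_nonneg_left (sq_nonneg _)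
  refine (measure_mono hsub).trans ?_
  rw [Measure.volume_eq_prod, Measure.prod_prod, Real.volume_Icc, Measure.addHaar_closedBall _ _ h0,
    volume_unit_ball_perp hu, finrank_perp hu, add_sub_cancel_left, ← ENNReal.ofReal_mul (by positivity),
    ← ENNReal.ofReal_mul hw, mul_assoc]

/-- The element is a bounded intersection of half spaces that cut out its facets; `a` is a point
whose distance to every facet is at least a fixed fraction of the width of the element. -/
structure Cell.HasHalfSpaces (K : Cell d) {ι : Type} (u : ι → E d) (c w : ι → ℝ) (a : E d) :
    Prop where
  unit : ∀ j, ‖u j‖ = 1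
  carrier_eq : K.carrier = {y | ∀ j, inner ℝ y (u j) ≤ c j}
  facet : ∀ F ∈ K.facets, ∃ j, F = {y ∈ K.carrier | inner ℝ y (u j) = c j}
  width_pos : ∀ j, 0 < w j
  width : ∀ j, ∀ y ∈ K.carrier, c j - w j ≤ inner ℝ y (u j)
  deep : ∀ j, inner ℝ a (u j) ≤ c j - w j / (d + 1)
  compact : IsCompact K.carrier

/-- The centre is at half the width from every facet; `1 ≤ d` makes this at least the fraction `1 /
(d + 1)` reached by the centroid of a simplex. -/
theorem Cell.exists_halfSpaces_box (a b : Fin d → ℝ) (hab : ∀ i, a i < b i) (hd : 1 ≤ d) :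
    ∃ (ι : Type) (_ : Fintype ι) (u : ι → E d) (c w : ι → ℝ) (z : E d),
      (Cell.box a b hab).HasHalfSpaces u c w z := by
  have hd' : (1 : ℝ) ≤ d := by exact_mod_cast hd
  refine ⟨Fin d ⊕ Fin d, inferInstance,
    Sum.elim (fun i => EuclideanSpace.single i (1 : ℝ)) (fun i => -EuclideanSpace.single i (1 : ℝ)),
    Sum.elim b (fun i => -a i), Sum.elim (fun i => b i - a i) (fun i => b i - a i),
    WithLp.toLp 2 (fun i => (a i + b i) / 2), ?_⟩
  have hin : ∀ (y : E d) (i : Fin d), inner ℝ y (EuclideanSpace.single i (1 : ℝ)) = y i := by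
    intro y i
    rw [EuclideanSpace.inner_single_right]; simp
  refine ⟨?_, ?_, ?_, ?_, ?_, ?_, ?_⟩
  · rintro (i | i) <;> simp
  · ext y
    simp only [Cell.carrier, mem_ofPred_eq, Sum.forall, Sum.elim_inl, Sum.elim_inr, hin,
      inner_neg_right, neg_le_neg_iff]
    exact ⟨fun h => ⟨fun i => (h i).2, fun i => (h i).1⟩, fun h i => ⟨h.2 i, h.1 i⟩⟩
  · intro F hF
    simp only [Cell.facets, Finset.mem_union, Finset.mem_image, Finset.mem_univ, true_and] at hF
    rcases hF with ⟨i, rfl⟩ | ⟨i, rfl⟩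
    · exact ⟨Sum.inr i, by ext y; simp [hin]⟩
    · exact ⟨Sum.inl i, by ext y; simp [hin]⟩
  · rintro (i | i) <;> simp [hab i]
  · rintro (i | i) y hy
    · simp only [Sum.elim_inl, hin]; have := hy i; linarith
    · simp only [Sum.elim_inr, hin, inner_neg_right]; have := hy i; linarith
  · have key : ∀ i, (b i - a i) / (d + 1) ≤ (b i - a i) / 2 := fun i =>
      div_le_div_of_nonneg_left (by linarith [hab i]) (by norm_num) (by linarith)
    rintro (i | i)
    · simp only [Sum.elim_inl, hin]; have := key i; linarith
    · simp only [Sum.elim_inr, hin, inner_neg_right]; have := key i; linarith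
  · have : (Cell.box a b hab).carrier =
        (EuclideanSpace.equiv (Fin d) ℝ).toHomeomorph ⁻¹' (Set.univ.pi fun i => Icc (a i) (b i)) := by
      ext y
      simp [Cell.carrier, Pi.le_def, forall_and]
    rw [this]
    exact (Homeomorph.isCompact_preimage _).2 (isCompact_univ_pi fun i => isCompact_Icc)

/-- The i-th barycentric coordinate is affine with gradient `q i`. The outward normal of the
opposite facet is `-q i` normalised, the width is the altitude `‖q i‖⁻¹`, and all barycentric
coordinates of the centroid are `1 / (d + 1)`. -/
theorem Cell.exists_halfSpaces_simplex (v : Fin (d + 1) → E d) (hv : AffineIndependent ℝ v)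
    (hd : 1 ≤ d) :
    ∃ (ι : Type) (_ : Fintype ι) (u : ι → E d) (c w : ι → ℝ) (z : E d),
      (Cell.simplex v hv).HasHalfSpaces u c w z := by
  have htop : affineSpan ℝ (range v) = ⊤ :=
    (hv.affineSpan_eq_top_iff_card_eq_finrank_add_one).2 (by simp)
  let b : AffineBasis (Fin (d + 1)) ℝ (E d) := ⟨v, hv, htop⟩
  have hbv : ∀ i, b i = v i := fun i => rfl
  have hbv' : ⇑b = v := rfl
  have hcar : (Cell.simplex v hv).carrier = {y | ∀ i, 0 ≤ b.coord i y} := by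
    rw [← b.convexHull_eq_nonneg_coord]; rfl
  let q : Fin (d + 1) → E d := fun i =>
    (InnerProductSpace.toDual ℝ (E d)).symm (LinearMap.toContinuousLinearMap (b.coord i).linear)
  have hq : ∀ i y, b.coord i y = b.coord i 0 + inner ℝ y (q i) := by
    intro i y
    have h1 : b.coord i y = (b.coord i).linear y + b.coord i 0 := by
      have := (b.coord i).map_vadd 0 y
      simpa using this
    rw [h1, real_inner_comm, InnerProductSpace.toDual_symm_apply]
    simp [add_comm]
  have hnt : Nontrivial (Fin (d + 1)) := Fin.nontrivial_iff_two_le.2 (by omega)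
  -- A barycentric coordinate is 1 at one vertex and 0 at another, so it is not constant.
  have hq0 : ∀ i, 0 < ‖q i‖ := by
    intro i
    rw [norm_pos_iff]
    intro h0
    obtain ⟨j, hj⟩ := exists_ne i
    have h1 := hq i (b i)
    have h2 := hq i (b j)
    rw [h0, inner_zero_right, b.coord_apply_eq] at h1
    rw [h0, inner_zero_right, b.coord_apply_ne hj.symm] at h2
    linarith
  have hin : ∀ i y, inner ℝ y (-(‖q i‖⁻¹ • q i)) = (b.coord i 0 - b.coord i y) * ‖q i‖⁻¹ := by
    intro i y
    rw [hq i y, inner_neg_right, inner_smul_right]; ring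
  have hle1 : ∀ y ∈ (Cell.simplex v hv).carrier, ∀ i, b.coord i y ≤ 1 := by
    intro y hy i
    rw [hcar] at hy
    rw [← b.sum_coord_apply_eq_one y]
    exact Finset.single_le_sum (f := fun i => b.coord i y) (fun j _ => hy j) (Finset.mem_univ i)
  refine ⟨Fin (d + 1), inferInstance, fun i => -(‖q i‖⁻¹ • q i), fun i => b.coord i 0 * ‖q i‖⁻¹,
    fun i => ‖q i‖⁻¹, Finset.univ.centroid ℝ b, ?_, ?_, ?_, ?_, ?_, ?_, ?_⟩
  · intro i
    rw [norm_neg, norm_smul, norm_inv, norm_norm, inv_mul_cancel₀ (hq0 i).ne']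
  · rw [hcar]
    ext y
    refine forall_congr' fun i => ?_
    rw [hin, mul_le_mul_iff_left₀ (inv_pos.2 (hq0 i))]
    simp
  · intro F hF
    simp only [Cell.facets, Finset.mem_image, Finset.mem_univ, true_and] at hF
    obtain ⟨i, rfl⟩ := hF
    refine ⟨i, ?_⟩
    ext y
    rw [mem_sep_iff, hin, mul_left_inj' (inv_pos.2 (hq0 i)).ne']
    have h0 : b.coord i 0 - b.coord i y = b.coord i 0 ↔ b.coord i y = 0 :=
      ⟨fun h => by linarith, fun h => by linarith⟩
    rw [h0]
    constructor
    · intro hy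
      refine ⟨convexHull_mono (image_subset_range _ _) hy, ?_⟩
      have hconv : Convex ℝ {y | b.coord i y = 0} := by
        have : {y | b.coord i y = 0} = (b.coord i) ⁻¹' {0} := rfl
        rw [this]
        exact (convex_singleton 0).affine_preimage _
      refine convexHull_min ?_ hconv hy
      rintro _ ⟨j, hj, rfl⟩
      exact b.coord_apply_ne (fun h => hj h.symm)
    · rintro ⟨hy, hyi⟩
      rw [hcar] at hy
      rw [← b.linear_combination_coord_eq_self y, ← Finset.add_sum_erase _ _ (Finset.mem_univ i),
        hyi, zero_smul, zero_add]
      refine (convex_convexHull ℝ _).sum_mem (fun j _ => hy j) ?_ ?_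
      · have := b.sum_coord_apply_eq_one y
        rw [← Finset.add_sum_erase _ _ (Finset.mem_univ i), hyi, zero_add] at this
        exact this
      · intro j hj
        exact subset_convexHull ℝ _ ⟨j, Finset.ne_of_mem_erase hj, rfl⟩
  · intro i; exact inv_pos.2 (hq0 i)
  · intro i y hy
    rw [hin]
    have := hle1 y hy i
    have h2 := inv_pos.2 (hq0 i)
    nlinarith
  · intro i
    rw [hin, b.coord_apply_centroid (Finset.mem_univ i)]
    simp
    apply le_of_eq
    ring
  · exact (finite_range v).isCompact_convexHull ℝ

theorem Cell.exists_halfSpaces (K : Cell d) (hd : 1 ≤ d) :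
    ∃ (ι : Type) (_ : Fintype ι) (u : ι → E d) (c w : ι → ℝ) (z : E d),
      K.HasHalfSpaces u c w z := by
  cases K with
  | simplex v hv => exact Cell.exists_halfSpaces_simplex v hv hd
  | box a b hab => exact Cell.exists_halfSpaces_box a b hab hd

end

/-! ### Geometry of the elements: null boundaries, inscribed balls, facets as bases of cones -/

section

variable {d G Nh n : ℕ} {Ωs : Fin n → Set (E d)}

variable {K : Cell d}

theorem Cell.isCompact_carrier (K : Cell d) : IsCompact K.carrier := by
  rcases Nat.eq_zero_or_pos d with h | h
  · subst h
    exact (Set.subsingleton_of_subsingleton (s := K.carrier)).finite.isCompact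
  · obtain ⟨ι, _, u, c, w, z, hs⟩ := K.exists_halfSpaces h
    exact hs.compact

theorem Cell.convex_carrier (K : Cell d) : Convex ℝ K.carrier := by
  cases K with
  | simplex v hv => exact convex_convexHull ℝ _
  | box a b hab =>
    intro x hx y hy s t hs ht hst i
    have h1 := hx i
    have h2 := hy i
    simp only [PiLp.add_apply, PiLp.smul_apply, smul_eq_mul]
    have e1 : s = 1 - t := by linarith
    subst e1
    constructor <;> nlinarith [mul_le_mul_of_nonneg_left h1.1 hs, mul_le_mul_of_nonneg_left h1.2 hs,
      mul_le_mul_of_nonneg_left h2.1 ht, mul_le_mul_of_nonneg_left h2.2 ht]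

theorem Cell.measurableSet_carrier (K : Cell d) : MeasurableSet K.carrier :=
  K.isCompact_carrier.measurableSet

theorem Cell.volume_frontier (K : Cell d) : volume (frontier K.carrier) = 0 :=
  K.convex_carrier.addHaar_frontier volume

theorem Cell.interior_ae_eq (K : Cell d) : interior K.carrier =ᵐ[volume] K.carrier := by
  refine interior_subset.eventuallyLE.antisymm ?_
  rw [ae_le_set]
  refine measure_mono_null ?_ K.volume_frontier
  rw [K.isCompact_carrier.isClosed.frontier_eq]

theorem Cell.restrict_interior (K : Cell d) :
    (volume : Measure (E d)).restrict (interior K.carrier) = volume.restrict K.carrier :=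
  Measure.restrict_congr_set K.interior_ae_eq

theorem Cell.facet_subset {F : Set (E d)} (hF : F ∈ K.facets) : F ⊆ K.carrier := by
  cases K with
  | simplex v hv =>
    simp only [Cell.facets, Finset.mem_image, Finset.mem_univ, true_and] at hF
    obtain ⟨i, rfl⟩ := hF
    exact convexHull_mono (image_subset_range _ _)
  | box a b hab =>
    simp only [Cell.facets, Finset.mem_union, Finset.mem_image, Finset.mem_univ, true_and] at hF
    rcases hF with ⟨i, rfl⟩ | ⟨i, rfl⟩ <;> exact sep_subset _ _

theorem Cell.HasHalfSpaces.closedBall_subset {ι : Type} [Finite ι] {u : ι → E d} {c w : ι → ℝ}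
    {z : E d} (h : K.HasHalfSpaces u c w z) {ρ : ℝ} (hρ : ∀ j, ρ < w j / (d + 1)) :
    Metric.closedBall z ρ ⊆ interior K.carrier := by
  have hopen : IsOpen {y : E d | ∀ j, inner ℝ y (u j) < c j} := by
    rw [ofPred_forall]
    exact isOpen_iInter_of_finite fun j => isOpen_lt (by fun_prop) continuous_const
  refine Subset.trans ?_ (interior_maximal (t := {y : E d | ∀ j, inner ℝ y (u j) < c j}) ?_ hopen)
  · intro y hy j
    rw [mem_closedBall_iff_norm] at hy
    have h1 : inner ℝ (y - z) (u j) ≤ ‖y - z‖ * ‖u j‖ := real_inner_le_norm _ _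
    rw [h.unit j, mul_one, inner_sub_left] at h1
    have h2 := h.deep j
    have h3 := hρ j
    linarith
  · rw [h.carrier_eq]
    exact fun y hy j => (hy j).le

theorem Cell.interior_nonempty (K : Cell d) : (interior K.carrier).Nonempty := by
  rcases Nat.eq_zero_or_pos d with h | h
  · subst h
    have hne : K.carrier.Nonempty := by
      cases K with
      | simplex v hv => exact ⟨v 0, subset_convexHull ℝ _ ⟨0, rfl⟩⟩
      | box a b hab => exact ⟨0, fun i => i.elim0⟩
    have : K.carrier = univ := Subsingleton.eq_univ_of_nonempty hne
    rw [this, interior_univ]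
    exact univ_nonempty
  · obtain ⟨ι, _, u, c, w, z, hs⟩ := K.exists_halfSpaces h
    have hball : z ∈ Metric.closedBall z 0 := by simp
    exact ⟨z, hs.closedBall_subset (fun j => div_pos (hs.width_pos j) (by positivity)) hball⟩

theorem Cell.closure_interior (K : Cell d) : closure (interior K.carrier) = K.carrier := by
  rw [K.convex_carrier.closure_interior_eq_closure_of_nonempty_interior K.interior_nonempty,
    K.isCompact_carrier.isClosed.closure_eq]

theorem Cell.subset_closedBall (K : Cell d) {z : E d} (hz : z ∈ K.carrier) :
    K.carrier ⊆ Metric.closedBall z K.h := fun _ hy =>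
  Metric.dist_le_diam_of_mem K.isCompact_carrier.isBounded hy hz

theorem exists_unit (hd : 1 ≤ d) : ∃ u : E d, ‖u‖ = 1 :=
  ⟨EuclideanSpace.single ⟨0, hd⟩ 1, by simp⟩

theorem dimH_plane_le {u : E d} (hu : ‖u‖ = 1) (c : ℝ) :
    dimH {y | inner ℝ y u = c} ≤ ((d - 1 : ℕ) : ℝ≥0∞) := by
  have huu : inner ℝ (c • u) u = c := by
    rw [inner_smul_left, real_inner_self_eq_norm_sq, hu]; simp
  rw [← huu, ← range_onPlane, ← image_univ, (isometry_onPlane _ u).dimH_image,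
    Real.dimH_univ_eq_finrank, finrank_perp hu]

/-- Every line in direction `u` through a small ball of the interior must leave the compact set, so
it meets the boundary. The orthogonal projection of the boundary therefore covers a ball of the
hyperplane, and a 1-Lipschitz map does not raise the Hausdorff dimension. -/
theorem le_dimH_frontier {S : Set (E d)} (hS : IsCompact S) (hne : (interior S).Nonempty)
    (hd : 1 ≤ d) : ((d - 1 : ℕ) : ℝ≥0∞) ≤ dimH (frontier S) := by
  obtain ⟨u, hu⟩ := exists_unit hd
  obtain ⟨a, ha⟩ := hne
  obtain ⟨ε, hε, hball⟩ := Metric.isOpen_iff.1 isOpen_interior a ha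
  let pr : E d → Perp u := fun y => (Perp u).orthogonalProjectionOnto (y - a)
  have hpr : LipschitzWith 1 pr := by
    refine LipschitzWith.of_dist_le_mul fun x y => ?_
    have h1 := (Perp u).lipschitzWith_orthogonalProjectionOnto.dist_le_mul (x - a) (y - a)
    rwa [dist_sub_right] at h1
  refine le_trans ?_ (hpr.dimH_image_le (frontier S))
  have hsub : Metric.ball (0 : Perp u) ε ⊆ pr '' frontier S := by
    intro p hp
    let f : ℝ → E d := fun t => a + ((p : E d) + t • u)
    have hf : Continuous f := by fun_prop
    have h0 : (0 : ℝ) ∈ f ⁻¹' S := by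
      refine (interior_subset (s := S)) (hball ?_)
      rw [mem_ball_iff_norm]
      simpa [f] using hp
    obtain ⟨R, hR⟩ := hS.isBounded.subset_closedBall a
    have h1 : f ⁻¹' S ≠ univ := by
      intro hun
      have h2 : |R| + 1 ∈ f ⁻¹' S := hun ▸ mem_univ _
      have h3 := hR h2
      rw [mem_closedBall_iff_norm, add_sub_cancel_left] at h3
      have h4 : inner ℝ ((p : E d) + (|R| + 1) • u) u ≤ ‖(p : E d) + (|R| + 1) • u‖ * ‖u‖ :=
        real_inner_le_norm _ _
      rw [inner_add_left, inner_perp, inner_smul_left, real_inner_self_eq_norm_sq, hu] at h4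
      simp only [conj_trivial] at h4
      linarith [le_abs_self R]
    obtain ⟨t, ht⟩ := nonempty_frontier_iff.2 ⟨⟨0, h0⟩, h1⟩
    refine ⟨f t, hf.frontier_preimage_subset _ ht, ?_⟩
    simp only [pr, f, add_sub_cancel_left, map_add]
    rw [Submodule.orthogonalProjectionOnto_mem_subspace_eq_self]
    have : (Perp u).orthogonalProjectionOnto (t • u) = 0 := by
      rw [Submodule.orthogonalProjectionOnto_eq_zero_iff, Submodule.orthogonal_orthogonal]
      exact Submodule.smul_mem _ _ (Submodule.mem_span_singleton_self u)
    rw [this, add_zero]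
  refine le_trans (le_of_eq ?_) (dimH_mono hsub)
  rw [Real.dimH_of_mem_nhds (Metric.ball_mem_nhds 0 hε), finrank_perp hu]

/-- The upper bound holds because finitely many hyperplanes cover the boundary. The equality makes
each element one of its own neighbours, hence fields supported in it admissible local tests. -/
theorem Cell.dimH_frontier (K : Cell d) (hd : 1 ≤ d) :
    dimH (frontier K.carrier) = ((d - 1 : ℕ) : ℝ≥0∞) := by
  refine le_antisymm ?_ (le_dimH_frontier K.isCompact_carrier K.interior_nonempty hd)
  obtain ⟨ι, _, u, c, w, z, hs⟩ := K.exists_halfSpaces hd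
  have hsub : frontier K.carrier ⊆ ⋃ j, {y | inner ℝ y (u j) = c j} := by
    intro y hy
    rw [K.isCompact_carrier.isClosed.frontier_eq] at hy
    by_contra hcon
    simp only [mem_iUnion, mem_ofPred_eq, not_exists] at hcon
    have hopen : IsOpen {y : E d | ∀ j, inner ℝ y (u j) < c j} := by
      rw [ofPred_forall]
      exact isOpen_iInter_of_finite fun j => isOpen_lt (by fun_prop) continuous_const
    refine hy.2 (interior_maximal (t := {y : E d | ∀ j, inner ℝ y (u j) < c j}) ?_ hopen ?_)
    · rw [hs.carrier_eq]
      exact fun y hy j => (hy j).le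
    · have h1 := hy.1
      rw [hs.carrier_eq] at h1
      exact fun j => lt_of_le_of_ne (h1 j) (hcon j)
  refine (dimH_mono hsub).trans ?_
  rw [dimH_iUnion]
  exact iSup_le fun j => dimH_plane_le (hs.unit j) _

/-- `a` is the centre of a ball of radius `ρ` in the interior of the element. -/
structure Cell.IsRegular (K : Cell d) (a : E d) (ρ : ℝ) : Prop where
  h_pos : 0 < K.h
  pos : 0 < ρ
  ball : Metric.closedBall a ρ ⊆ interior K.carrier

/-- An element of width `w` across a facet has volume at most `w * h ^ (d - 1) * ballVol d`, while
its volume is at least `κ * h ^ d`. So all these widths are at least `κ / ballVol d * h`, and the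
deep point of the half-space description is the centre of a ball of comparable radius. -/
theorem Cell.exists_isRegular (hd : 1 ≤ d) {κ : ℝ} (hκ : 0 < κ) :
    ∃ c : ℝ, 0 < c ∧ ∀ K : Cell d, κ ≤ K.kappa → ∃ a, K.IsRegular a (c * K.h) := by
  -- The factor `d + 1` is the depth of the chosen point relative to the width; the factor 2 gives
  -- the strict inequality needed to put a closed ball in the interior.
  refine ⟨κ / ballVol d / (2 * (d + 1)), by have := ballVol_pos (d := d); positivity, ?_⟩
  intro K hK
  have hB := ballVol_pos (d := d)
  have hh : 0 < K.h := by
    -- For a zero diameter the quotient defining `kappa` is a division by zero, hence 0, which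
    -- contradicts `κ ≤ K.kappa`.
    refine lt_of_le_of_ne Metric.diam_nonneg fun h0 => ?_
    rw [Cell.kappa, ← h0, zero_pow (by omega), div_zero] at hK
    linarith
  obtain ⟨ι, _, u, c, w, z, hs⟩ := K.exists_halfSpaces hd
  have hz : z ∈ K.carrier := by
    rw [hs.carrier_eq]
    intro j
    have h1 := hs.deep j
    have h2 : 0 < w j / (d + 1) := div_pos (hs.width_pos j) (by positivity)
    linarith
  have hw : ∀ j, κ / ballVol d * K.h ≤ w j := by
    intro j
    have h1 := volume_le_of_slab (hs.unit j) K.measurableSet_carrier hh.le (K.subset_closedBall hz)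
      (α := c j - w j) (w := w j) (fun y hy => ⟨hs.width j y hy, by
        rw [hs.carrier_eq] at hy
        have := hy j
        linarith⟩)
    have h2 := ENNReal.toReal_le_of_le_ofReal
      (by have := (hs.width_pos j).le; positivity) h1
    rw [Cell.kappa, le_div_iff₀ (by positivity)] at hK
    have h3 := hK.trans h2
    have h4 : K.h ^ d = K.h ^ (d - 1) * K.h := by rw [← pow_succ, Nat.sub_add_cancel hd]
    rw [h4] at h3
    rw [div_mul_eq_mul_div, div_le_iff₀ hB]
    have h5 : 0 < K.h ^ (d - 1) := by positivity
    nlinarith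
  refine ⟨z, hh, by positivity, hs.closedBall_subset fun j => ?_⟩
  have hd1 : (0 : ℝ) < d + 1 := by positivity
  rw [lt_div_iff₀ hd1]
  refine lt_of_lt_of_le ?_ (hw j)
  have h1 : 0 < κ / ballVol d * K.h := by positivity
  rw [show κ / ballVol d / (2 * (d + 1)) * K.h * (d + 1) = κ / ballVol d * K.h / 2 by field_simp]
  linarith

/-- A facet as the base of a cone whose apex is the centre of a ball in the element. -/
theorem Cell.IsRegular.exists_isBase {a : E d} {ρ : ℝ} (h : K.IsRegular a ρ) (hd : 1 ≤ d)
    {F : Set (E d)} (hF : F ∈ K.facets) (hne : F.Nonempty) :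
    ∃ (u : E d) (H : ℝ), IsBase a u H F ∧ ρ ≤ H ∧ H ≤ K.hperp F ∧
      (∀ y ∈ K.carrier, inner ℝ y u ≤ inner ℝ a u + H) ∧
      F = {y ∈ K.carrier | inner ℝ y u = inner ℝ a u + H} := by
  obtain ⟨ι, _, u, c, w, z, hs⟩ := K.exists_halfSpaces hd
  obtain ⟨j, hj⟩ := hs.facet F hF
  have hup : ∀ y ∈ K.carrier, inner ℝ y (u j) ≤ c j := by
    intro y hy
    rw [hs.carrier_eq] at hy
    exact hy j
  have hcar : Metric.closedBall a ρ ⊆ K.carrier := h.ball.trans interior_subset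
  have hρH : ρ ≤ c j - inner ℝ a (u j) := by
    have h1 := hup (a + ρ • u j) (hcar (by
      rw [mem_closedBall_iff_norm, add_sub_cancel_left, norm_smul, hs.unit j,
        Real.norm_of_nonneg h.pos.le, mul_one]))
    rw [inner_add_left, inner_smul_left, real_inner_self_eq_norm_sq, hs.unit j] at h1
    simp only [conj_trivial] at h1
    linarith
  have haK : a ∈ K.carrier := hcar (Metric.mem_closedBall_self h.pos.le)
  have hc : inner ℝ a (u j) + (c j - inner ℝ a (u j)) = c j := by ring
  have hFc : IsCompact F := by
    rw [hj]
    exact K.isCompact_carrier.inter_right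
      (isClosed_eq (f := fun y : E d => (inner ℝ y (u j) : ℝ)) (by fun_prop) continuous_const)
  refine ⟨u j, c j - inner ℝ a (u j), ⟨hs.unit j, lt_of_lt_of_le h.pos hρH, hFc, ?_⟩, hρH, ?_, ?_, ?_⟩
  · rw [hc, hj]; exact fun y hy => hy.2
  -- The apex competes in the supremum defining `hperp`, and its distance to the affine span of `F`
  -- is at least its distance to the facet hyperplane. Boundedness is needed because the real `sSup`
  -- of an unbounded set is 0.
  · have hbdd : BddAbove ((fun x => Metric.infDist x (affineSpan ℝ F : Set (E d))) '' K.carrier) :=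
      K.isCompact_carrier.bddAbove_image (Metric.continuous_infDist_pt _).continuousOn
    refine le_trans ?_ (le_csSup hbdd ⟨a, haK, rfl⟩)
    have hne' : (affineSpan ℝ F : Set (E d)).Nonempty := (affineSpan_nonempty ℝ).2 hne
    refine (Metric.le_infDist hne').2 fun y hy => ?_
    have hy' : inner ℝ y (u j) = c j := by
      have hle : affineSpan ℝ F ≤ AffineSubspace.mk' hne.some (Perp (u j)) := by
        rw [affineSpan_le]
        intro x hx
        rw [SetLike.mem_coe, AffineSubspace.mem_mk', Submodule.mem_orthogonal_singleton_iff_inner_left,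
          vsub_eq_sub, inner_sub_left]
        have h1 := hne.some_mem
        rw [hj] at hx
        have h2 : inner ℝ hne.some (u j) = c j := (hj ▸ h1 : hne.some ∈ {y ∈ K.carrier | inner ℝ y (u j) = c j}).2
        rw [hx.2, h2, sub_self]
      have h1 := hle hy
      rw [AffineSubspace.mem_mk', Submodule.mem_orthogonal_singleton_iff_inner_left,
          vsub_eq_sub, inner_sub_left] at h1
      have h2 : inner ℝ hne.some (u j) = c j :=
        ((subset_of_eq hj) hne.some_mem).2
      linarith
    have h1 : inner ℝ (y - a) (u j) ≤ ‖y - a‖ * ‖u j‖ := real_inner_le_norm _ _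
    rw [hs.unit j, mul_one, inner_sub_left, hy'] at h1
    rw [dist_comm, dist_eq_norm]
    exact h1
  · rw [hc]; exact hup
  · rw [hc]; exact hj

end

section

variable {d G Nh n : ℕ} {Ωs : Fin n → Set (E d)}

/-! ### Lipschitz domains and facets on the boundary -/

theorem IsOpen.notMem_of_mem_frontier {U : Set (E d)} (hU : IsOpen U) {x : E d}
    (hx : x ∈ frontier U) : x ∉ U := by
  rw [hU.frontier_eq] at hx
  exact hx.2

/-- This excludes slits: a point just below the local graph has a neighbourhood that misses `U`, so
it cannot lie in the closure. The elements are only known to fill the closure of a subdomain; this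
places their interiors in the subdomain itself. -/
theorem HasLipschitzBoundary.interior_closure_subset {U : Set (E d)} (hU : IsOpen U)
    (hL : HasLipschitzBoundary U) : interior (closure U) ⊆ U := by
  intro x hx
  by_contra hxU
  have hxf : x ∈ frontier U := by
    rw [hU.frontier_eq]
    exact ⟨interior_subset hx, hxU⟩
  obtain ⟨r, hr, u, hu, L, γ, hγ, hinv, hepi⟩ := hL x hxf
  have h1 : inner ℝ x u ≤ γ x := by
    by_contra h
    exact hxU ((hepi x (Metric.mem_ball_self hr)).2 (not_le.1 h))
  obtain ⟨ε, hε, hball⟩ := Metric.isOpen_iff.1 (isOpen_interior.inter Metric.isOpen_ball) x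
    ⟨hx, Metric.mem_ball_self hr⟩
  set y : E d := x + (-(ε / 2)) • u with hy
  have hyb : y ∈ Metric.ball x ε := by
    rw [mem_ball_iff_norm, hy, add_sub_cancel_left, norm_smul, hu, Real.norm_eq_abs, abs_neg,
      abs_of_pos (by positivity)]
    linarith
  have hyu : inner ℝ y u = inner ℝ x u - ε / 2 := by
    rw [hy, inner_add_left, inner_smul_left, real_inner_self_eq_norm_sq, hu]
    simp
    ring
  have hV : IsOpen ({z : E d | inner ℝ z u < γ z} ∩ Metric.ball x r) :=
    (isOpen_lt (by fun_prop) hγ.continuous).inter Metric.isOpen_ball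
  have hyV : y ∈ {z : E d | inner ℝ z u < γ z} ∩ Metric.ball x r := by
    refine ⟨?_, (hball hyb).2⟩
    rw [mem_ofPred_eq, hyu, hy, hinv]
    linarith
  obtain ⟨z, ⟨hz1, hz2⟩, hzU⟩ := mem_closure_iff.1 (interior_subset (hball hyb).1) _ hV hyV
  exact lt_asymm ((hepi z hz2).1 hzU) hz1

/-- Points strictly above the graph belong to the open set, and points strictly below have a
neighbourhood outside it; only the graph remains. -/
theorem eq_of_mem_frontier_epigraph {U : Set (E d)} (hU : IsOpen U) {x u : E d} {r : ℝ}
    {γ : E d → ℝ} (hγ : Continuous γ)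
    (hepi : ∀ y ∈ Metric.ball x r, (y ∈ U ↔ γ y < inner ℝ y u)) {y : E d}
    (hy : y ∈ Metric.ball x r) (hyf : y ∈ frontier U) : γ y = inner ℝ y u := by
  have hyU := IsOpen.notMem_of_mem_frontier hU hyf
  refine le_antisymm ?_ (not_lt.1 fun h => hyU ((hepi y hy).2 h))
  by_contra h
  have hV : IsOpen ({z : E d | inner ℝ z u < γ z} ∩ Metric.ball x r) :=
    (isOpen_lt (by fun_prop) hγ).inter Metric.isOpen_ball
  obtain ⟨z, ⟨hz1, hz2⟩, hzU⟩ := mem_closure_iff.1 (frontier_subset_closure hyf) _ hV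
    ⟨not_le.1 h, hy⟩
  exact lt_asymm ((hepi z hz2).1 hzU) hz1

/-- A Lipschitz domain that contains a half ball, and whose boundary contains the flat part of the
boundary of that half ball, lies on one side of it near its centre. -/
theorem HasLipschitzBoundary.one_sided {U : Set (E d)} (hU : IsOpen U)
    (hL : HasLipschitzBoundary U) {x n : E d} (hn : ‖n‖ = 1) {r : ℝ} (hr : 0 < r)
    (hflat : ∀ y ∈ Metric.ball x r, inner ℝ y n = inner ℝ x n → y ∈ frontier U)
    (hhalf : ∀ y ∈ Metric.ball x r, inner ℝ y n < inner ℝ x n → y ∈ U) :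
    ∃ r' : ℝ, 0 < r' ∧ ∀ y ∈ Metric.ball x r', y ∈ U → inner ℝ y n < inner ℝ x n := by
  have hxf := hflat x (Metric.mem_ball_self hr) rfl
  obtain ⟨r₀, hr₀, u, hu, L, γ, hγ, hinv, hepi⟩ := hL x hxf
  have hγc := hγ.continuous
  set R := min r r₀ with hR
  have hRpos : 0 < R := lt_min hr hr₀
  have hxγ := eq_of_mem_frontier_epigraph hU hγc hepi (Metric.mem_ball_self hr₀) hxf
  have hb : ∀ s : ℝ, |s| < R → x + s • u ∈ Metric.ball x r ∧ x + s • u ∈ Metric.ball x r₀ := by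
    intro s hs
    have : x + s • u ∈ Metric.ball x R := by
      rw [mem_ball_iff_norm, add_sub_cancel_left, norm_smul, hu, Real.norm_eq_abs, mul_one]
      exact hs
    exact ⟨Metric.ball_subset_ball (min_le_left _ _) this,
      Metric.ball_subset_ball (min_le_right _ _) this⟩
  have huu : (inner ℝ u u : ℝ) = 1 := by rw [real_inner_self_eq_norm_sq, hu]; norm_num
  have hsu : ∀ (y : E d) (s : ℝ), inner ℝ (y + s • u) u = inner ℝ y u + s := by
    intro y s
    rw [inner_add_left, inner_smul_left, huu]; simp
  have hsn : ∀ (y : E d) (s : ℝ), inner ℝ (y + s • u) n = inner ℝ y n + s * inner ℝ u n := by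
    intro y s
    rw [inner_add_left, inner_smul_left]; simp
  -- The graph direction points into the half ball. If `u` were tangent to the flat part, two
  -- boundary points would lie on one vertical line. If it had a positive component along `n`,
  -- moving down from `x` would lead into `U`, although those points are below the graph.
  have ht : inner ℝ u n < 0 := by
    rcases lt_trichotomy (inner ℝ u n : ℝ) 0 with h | h | h
    · exact h
    · exfalso
      obtain ⟨h1, h2⟩ := hb (R / 2) (by rw [abs_of_pos (by positivity)]; linarith)
      have h3 := hflat _ h1 (by rw [hsn, h]; simp)
      have h4 := eq_of_mem_frontier_epigraph hU hγc hepi h2 h3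
      rw [hinv, hsu, hxγ] at h4
      linarith
    · exfalso
      obtain ⟨h1, h2⟩ := hb (-(R / 2)) (by rw [abs_neg, abs_of_pos (by positivity)]; linarith)
      have h3 := hhalf _ h1 (by rw [hsn]; nlinarith)
      have h4 := (hepi _ h2).1 h3
      rw [hinv, hsu, hxγ] at h4
      linarith
  set t := -(inner ℝ u n : ℝ) with htd
  have htpos : 0 < t := by rw [htd]; linarith
  -- A point of `U` on the wrong side is moved up along `u` until it reaches the flat part, which
  -- lies on the graph; then it was on or below the graph, a contradiction. The displacement is at
  -- most `‖y - x‖ / t`, so this radius keeps the moved point within `R` of `x`.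
  refine ⟨R / (1 + 1 / t), by positivity, fun y hy hyU => ?_⟩
  by_contra hcon
  rw [not_lt] at hcon
  set s := (inner ℝ y n - inner ℝ x n) / t with hs
  have hs0 : 0 ≤ s := div_nonneg (by linarith) htpos.le
  have hys : inner ℝ y n - inner ℝ x n ≤ ‖y - x‖ := by
    have := real_inner_le_norm (y - x) n
    rwa [hn, mul_one, inner_sub_left] at this
  rw [mem_ball_iff_norm, lt_div_iff₀ (by positivity)] at hy
  have hdist : ‖y + s • u - x‖ < R := by
    have h1 : ‖y + s • u - x‖ ≤ ‖y - x‖ + ‖s • u‖ := by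
      rw [show y + s • u - x = (y - x) + s • u by abel]; exact norm_add_le _ _
    rw [norm_smul, hu, mul_one, Real.norm_of_nonneg hs0] at h1
    have h2 : s ≤ ‖y - x‖ * (1 / t) := by
      rw [hs, div_eq_mul_one_div]
      exact mul_le_mul_of_nonneg_right hys (by positivity)
    linarith
  have hm : y + s • u ∈ Metric.ball x r := by
    rw [mem_ball_iff_norm]; exact hdist.trans_le (min_le_left _ _)
  have hm₀ : y + s • u ∈ Metric.ball x r₀ := by
    rw [mem_ball_iff_norm]; exact hdist.trans_le (min_le_right _ _)
  have hyb : y ∈ Metric.ball x r₀ := by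
    rw [mem_ball_iff_norm]
    have h1 : 0 ≤ ‖y - x‖ * (1 / t) := by positivity
    have h2 : R ≤ r₀ := min_le_right _ _
    linarith
  have h3 := hflat _ hm (by
    rw [hsn, hs]
    have : inner ℝ u n = -t := by rw [htd]; ring
    rw [this]
    field_simp
    ring)
  have h4 := eq_of_mem_frontier_epigraph hU hγc hepi hm₀ h3
  have h5 := (hepi y hyb).1 hyU
  rw [hinv, hsu] at h4
  linarith

/-- `x` is in the interior of `F` relative to the hyperplane with normal `u` through `x`. -/
def IsRelInterior (F : Set (E d)) (u x : E d) : Prop :=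
  ∃ r : ℝ, 0 < r ∧ ∀ y ∈ Metric.ball x r, inner ℝ y u = inner ℝ x u → y ∈ F

variable {a u : E d} {H : ℝ} {F : Set (E d)}

/-- The boundary of a convex set is Lebesgue-null; this is applied inside the hyperplane. -/
theorem IsBase.ae_isRelInterior (h : IsBase a u H F) (hF : Convex ℝ F) :
    ∀ᵐ x ∂((surf d).restrict F), IsRelInterior F u x := by
  set p := a + H • u with hp
  set A : Set (Perp u) := onPlane p u ⁻¹' F with hA
  have hconv : Convex ℝ A := by
    intro v hv w hw s t hs ht hst
    have := hF hv hw hs ht hst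
    rw [hA, mem_preimage]
    convert this using 1
    simp only [onPlane, Submodule.coe_add, Submodule.coe_smul, smul_add]
    rw [show s • p + s • (v : E d) + (t • p + t • (w : E d)) =
      (s + t) • p + (s • (v : E d) + t • (w : E d)) by rw [add_smul]; abel, hst, one_smul]
  have hnull : surf d (onPlane p u '' frontier A) = 0 := by
    rw [surf_image_onPlane p h.unit]
    exact hconv.addHaar_frontier volume
  rw [ae_restrict_iff' h.compact.measurableSet]
  filter_upwards [compl_mem_ae_iff.2 hnull] with x hx hxF
  have hxp : x ∈ range (onPlane p u) := by
    rw [range_onPlane]; exact h.subset' hxF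
  obtain ⟨w, rfl⟩ := hxp
  have hwA : w ∈ A := hxF
  have hwi : w ∈ interior A := by
    by_contra hwi
    exact hx ⟨w, ⟨subset_closure hwA, hwi⟩, rfl⟩
  obtain ⟨r, hr, hball⟩ := Metric.isOpen_iff.1 isOpen_interior w hwi
  refine ⟨r, hr, fun y hy hyu => ?_⟩
  have hyp : y ∈ range (onPlane p u) := by
    rw [range_onPlane, mem_ofPred_eq, hyu]
    simp [onPlane, inner_add_left, inner_perp]
  obtain ⟨w', rfl⟩ := hyp
  refine interior_subset (s := A) (hball ?_)
  rw [Metric.mem_ball] at hy ⊢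
  rwa [(isometry_onPlane p u).dist_eq] at hy

/-- The radial projection is continuous at `x` and fixes it, so nearby points project into `F`. If
such a point is below the hyperplane, it lies strictly between a point of `F` and the interior point
`a`. -/
theorem IsBase.half_ball_subset (h : IsBase a u H F) {S : Set (E d)} (hS : Convex ℝ S)
    (ha : a ∈ interior S) (hFS : F ⊆ S) {x : E d} (hxF : x ∈ F) (hx : IsRelInterior F u x) :
    ∃ r : ℝ, 0 < r ∧ ∀ y ∈ Metric.ball x r, inner ℝ y u < inner ℝ x u → y ∈ interior S := by
  obtain ⟨r, hr, hrel⟩ := hx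
  have hH := h.pos
  have hxu := h.subset hxF
  rw [mem_ofPred_eq] at hxu
  have hxa : inner ℝ (x - a) u = H := by rw [inner_sub_left, hxu]; ring
  have hcont : ContinuousAt (fun y : E d => (inner ℝ (y - a) u : ℝ)) x := by fun_prop
  have hcp : ContinuousAt (conePt a u H) x := by
    unfold conePt
    have : ContinuousAt (fun y : E d => H / (inner ℝ (y - a) u : ℝ)) x :=
      continuousAt_const.div hcont (by rw [hxa]; exact hH.ne')
    exact continuousAt_const.add (this.smul (by fun_prop))
  have hcx : conePt a u H x = x := by
    rw [conePt, hxa, div_self hH.ne', one_smul]; abel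
  have h1 : ∀ᶠ y in 𝓝 x, conePt a u H y ∈ Metric.ball x r := by
    have := hcp.eventually (Metric.ball_mem_nhds (conePt a u H x) hr)
    rwa [hcx] at this
  have h2 : ∀ᶠ y in 𝓝 x, 0 < (inner ℝ (y - a) u : ℝ) :=
    hcont.eventually (lt_mem_nhds (show (0 : ℝ) < inner ℝ (x - a) u by rw [hxa]; exact hH))
  obtain ⟨r', hr', hball⟩ := Metric.eventually_nhds_iff_ball.1 (h1.and h2)
  refine ⟨r', hr', fun y hy hyu => ?_⟩
  obtain ⟨hy1, hy2⟩ := hball y hy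
  have hyF : conePt a u H y ∈ F := by
    refine hrel _ hy1 ?_
    rw [conePt, inner_add_left, inner_smul_left, hxu]
    simp only [conj_trivial]
    field_simp
  set t := (inner ℝ (y - a) u : ℝ) / H with ht
  have ht1 : t < 1 := by
    rw [ht, div_lt_one hH, inner_sub_left]
    linarith
  have ht0 : 0 < t := div_pos hy2 hH
  have hy' : y = conePt a u H y + (1 - t) • (a - conePt a u H y) := by
    rw [conePt, sub_add_cancel_left, smul_neg, smul_smul, add_assoc, ← sub_eq_add_neg, ← sub_smul,
      show H / inner ℝ (y - a) u - (1 - t) * (H / inner ℝ (y - a) u) = 1 by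
        rw [ht]; field_simp; ring, one_smul]
    abel
  rw [hy']
  exact hS.add_smul_sub_mem_interior (hFS hyF) ha ⟨by linarith, by linarith⟩

theorem IsPartition.interior_el_subset {Ω : Set (E d)} (hP : IsPartition Ω Ωs) (T : DDMesh Ωs)
    (K : Fin T.size) : interior (T.el K) ⊆ Ωs (T.sub K) := by
  refine Subset.trans (interior_mono ?_)
    (HasLipschitzBoundary.interior_closure_subset (hP.domain _).isOpen (hP.domain _).lipschitz)
  rw [← T.cover (T.sub K)]
  exact subset_biUnion_of_mem (u := fun K => (T.cell K).carrier) (show K ∈ {K' | T.sub K' = T.sub K} from rfl)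

theorem DDMesh.el_subset_closure (T : DDMesh Ωs) (K : Fin T.size) :
    T.el K ⊆ closure (Ωs (T.sub K)) := by
  rw [← T.cover (T.sub K)]
  exact subset_biUnion_of_mem (u := fun K => (T.cell K).carrier) (show K ∈ {K' | T.sub K' = T.sub K} from rfl)

theorem IsPartition.frontier_of_subset {Ω : Set (E d)} (hΩ : IsOpen Ω) (hP : IsPartition Ω Ωs)
    {T : DDMesh Ωs} {K : Fin T.size} (hFK : F ⊆ T.el K) (hFΩ : F ⊆ frontier Ω) :
    F ⊆ frontier (Ωs (T.sub K)) := by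
  intro x hx
  rw [(hP.domain _).isOpen.frontier_eq]
  exact ⟨T.el_subset_closure K (hFK hx), fun h =>
    IsOpen.notMem_of_mem_frontier hΩ (hFΩ hx) (hP.subset _ h)⟩

/-- Almost every point of a boundary facet `F` of the element `K` is away from the other
subdomains, the other elements and the other facets of `K`. -/
theorem IsBase.ae_isolated (h : IsBase a u H F) {Ω : Set (E d)} (hΩ : IsLipschitzDomain Ω)
    (hP : IsPartition Ω Ωs) {T : DDMesh Ωs} {K : Fin T.size} (ha : a ∈ interior (T.el K))
    (hF : F = {y ∈ T.el K | inner ℝ y u = inner ℝ a u + H}) (hFΩ : F ⊆ frontier Ω) :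
    ∀ᵐ x ∂((surf d).restrict F), (∀ j, j ≠ T.sub K → x ∉ closure (Ωs j)) ∧
      ∀ K', ∀ F' ∈ (T.cell K').facets, x ∈ F' → K' = K ∧ F' = F := by
  have hd := pos_dim_of_unit h.unit
  have hFK : F ⊆ T.el K := by rw [hF]; exact sep_subset _ _
  have hKc : Convex ℝ (T.el K) := (T.cell K).convex_carrier
  have hFc : Convex ℝ F := by
    rw [hF]
    intro v hv w hw s t hs ht hst
    refine ⟨hKc hv.1 hw.1 hs ht hst, ?_⟩
    rw [inner_add_left, inner_smul_left, inner_smul_left, hv.2, hw.2, conj_trivial,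
      conj_trivial, ← add_mul, hst, one_mul]
  filter_upwards [h.ae_isRelInterior hFc, ae_restrict_mem h.compact.measurableSet] with x hx hxF
  obtain ⟨r₁, hr₁, hhalf⟩ := h.half_ball_subset hKc ha hFK hxF hx
  obtain ⟨r₂, hr₂, hflat⟩ := id hx
  have hKi := hP.interior_el_subset T K
  obtain ⟨r, hr, hside⟩ := hΩ.lipschitz.one_sided hΩ.isOpen (x := x) h.unit (lt_min hr₁ hr₂)
    (fun y hy hyu => hFΩ (hflat y (Metric.ball_subset_ball (min_le_right _ _) hy) hyu))
    (fun y hy hyu => hP.subset _ (hKi (hhalf y (Metric.ball_subset_ball (min_le_left _ _) hy) hyu)))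
  -- Near `x` all of Ω is inside `K`, since Ω stays on the side of `F` where the half ball is in
  -- `K`. The other subdomains and the interiors of the other elements are disjoint from the
  -- interior of `K`, so `x` is not in their closures.
  have hnear : ∀ y ∈ Metric.ball x (min r r₁), y ∈ Ω → y ∈ interior (T.el K) := fun y hy hyΩ =>
    hhalf y (Metric.ball_subset_ball (min_le_right _ _) hy)
      (hside y (Metric.ball_subset_ball (min_le_left _ _) hy) hyΩ)
  have hrr : 0 < min r r₁ := lt_min hr hr₁
  refine ⟨fun j hj hxj => ?_, fun K' F' hF' hxF' => ?_⟩
  · obtain ⟨y, hy, hyj⟩ := mem_closure_iff.1 hxj _ Metric.isOpen_ball (Metric.mem_ball_self hrr)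
    exact Set.disjoint_left.1 (hP.disjoint j _ hj) hyj (hKi (hnear y hy (hP.subset _ hyj)))
  · have hKK : K' = K := by
      by_contra hne
      have hxK' : x ∈ closure (interior (T.cell K').carrier) := by
        rw [Cell.closure_interior]
        exact Cell.facet_subset hF' hxF'
      obtain ⟨y, hy, hyj⟩ := mem_closure_iff.1 hxK' _ Metric.isOpen_ball (Metric.mem_ball_self hrr)
      exact Set.disjoint_left.1 (T.interior_disjoint K' K hne) hyj
        (hnear y hy (hP.subset _ (hP.interior_el_subset T K' hyj)))
    subst hKK
    refine ⟨rfl, ?_⟩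
    obtain ⟨ι, _, n, c, w, z, hs⟩ := (T.cell K').exists_halfSpaces hd
    obtain ⟨j, hj⟩ := hs.facet F' hF'
    have hxn : inner ℝ x (n j) = c j := by
      rw [hj] at hxF'
      exact hxF'.2
    -- For `p` tangent to `F`, both `x + s • p` and `x - s • p` stay in the element for small `s`.
    -- The half-space inequality that is an equality at `x` then forces `n j` to be orthogonal to
    -- `p`, so the two facet hyperplanes coincide.
    have hperp : n j ∈ (Perp u)ᗮ := by
      rw [Submodule.mem_orthogonal]
      intro p hp
      by_cases hp0 : p = 0
      · simp [hp0]
      have hpn : 0 < ‖p‖ := norm_pos_iff.2 hp0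
      have hpu : inner ℝ p u = 0 := inner_perp u ⟨p, hp⟩
      have key : ∀ s : ℝ, |s| * ‖p‖ < r₂ → s * inner ℝ p (n j) ≤ 0 := by
        intro s hs'
        have h1 := hflat (x + s • p) (by
          rw [mem_ball_iff_norm, add_sub_cancel_left, norm_smul]; exact hs') (by
          rw [inner_add_left, inner_smul_left, hpu]; simp)
        have h2 := hFK h1
        rw [DDMesh.el, hs.carrier_eq] at h2
        have h3 := h2 j
        rw [inner_add_left, inner_smul_left, hxn] at h3
        simp only [conj_trivial] at h3
        linarith
      have e : |r₂ / (2 * ‖p‖)| * ‖p‖ < r₂ := by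
        rw [abs_of_pos (by positivity)]
        field_simp
        linarith
      have h1 := key (r₂ / (2 * ‖p‖)) e
      have h2 := key (-(r₂ / (2 * ‖p‖))) (by rw [abs_neg]; exact e)
      have h3 : 0 < r₂ / (2 * ‖p‖) := by positivity
      nlinarith
    rw [Submodule.orthogonal_orthogonal, Submodule.mem_span_singleton] at hperp
    obtain ⟨t, ht⟩ := hperp
    have ht0 : t ≠ 0 := by
      rintro rfl
      have := hs.unit j
      rw [← ht] at this
      simp at this
    have hxu := h.subset hxF
    rw [mem_ofPred_eq] at hxu
    rw [hj, hF]
    ext y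
    refine and_congr_right fun _ => ?_
    rw [← hxn, ← ht, inner_smul_right, inner_smul_right, ← hxu, mul_right_inj' ht0]

end

section

variable {d G Nh n : ℕ} {Ωs : Fin n → Set (E d)}

/-! ### Inverse inequalities for polynomials -/

theorem pval_add (P Q : MvPolynomial (Fin d) ℝ) (x : E d) :
    pval (P + Q) x = pval P x + pval Q x := by simp [pval]

theorem pval_mul (P Q : MvPolynomial (Fin d) ℝ) (x : E d) :
    pval (P * Q) x = pval P x * pval Q x := by simp [pval]

theorem pval_sum {ι : Type*} (s : Finset ι) (P : ι → MvPolynomial (Fin d) ℝ) (x : E d) :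
    pval (∑ i ∈ s, P i) x = ∑ i ∈ s, pval (P i) x := by simp [pval]

theorem pval_C (c : ℝ) (x : E d) : pval (MvPolynomial.C c) x = c := by simp [pval]

theorem pval_X (i : Fin d) (x : E d) : pval (MvPolynomial.X i) x = x i := by simp [pval]

theorem contDiff_pval (P : MvPolynomial (Fin d) ℝ) : ContDiff ℝ ∞ (pval P) := by
  induction P using MvPolynomial.induction_on with
  | C a =>
    have : pval (MvPolynomial.C a) = fun _ : E d => a := funext (pval_C a)
    rw [this]
    exact contDiff_const
  | add p q hp hq =>
    have : pval (p + q) = fun x => pval p x + pval q x := funext (pval_add p q)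
    rw [this]
    exact hp.add hq
  | mul_X p i hp =>
    have : pval (p * MvPolynomial.X i) = fun x : E d => pval p x * x i := by
      funext x; rw [pval_mul, pval_X]
    rw [this]
    exact hp.mul (by fun_prop)

theorem continuous_pval (P : MvPolynomial (Fin d) ℝ) : Continuous (pval P) :=
  (contDiff_pval P).continuous

/-- The ball contains a product of intervals, and a polynomial that vanishes on a product of
infinite sets is zero. -/
theorem eq_zero_of_pval_eq_zero {P : MvPolynomial (Fin d) ℝ} {r : ℝ} (hr : 0 < r)
    (h : ∀ x ∈ Metric.ball (0 : E d) r, pval P x = 0) : P = 0 := by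
  have hopen : IsOpen ((WithLp.toLp 2 : (Fin d → ℝ) → E d) ⁻¹' Metric.ball (0 : E d) r) :=
    Metric.isOpen_ball.preimage (PiLp.continuous_toLp 2 _)
  obtain ⟨ε, hε, hball⟩ := Metric.isOpen_iff.1 hopen 0 (by simpa using hr)
  refine MvPolynomial.funext_set (fun _ => Metric.ball (0 : ℝ) ε) (fun _ => ?_) fun x hx => ?_
  · rw [Real.ball_eq_Ioo]
    exact Ioo_infinite (by linarith)
  · rw [map_zero]
    have : x ∈ Metric.ball (0 : Fin d → ℝ) ε := by
      rw [ball_pi _ hε]; exact hx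
    exact h _ (hball this)

theorem integral_sum_sq {X ι : Type*} [MeasurableSpace X] [Fintype ι] (μ : Measure X)
    (f : ι → X → ℝ) (hf : ∀ i j, Integrable (fun x => f i x * f j x) μ) (c : ι → ℝ) :
    ∫ x, (∑ i, c i * f i x) ^ 2 ∂μ = ∑ i, ∑ j, c i * c j * ∫ x, f i x * f j x ∂μ := by
  have h1 : ∀ x, (∑ i, c i * f i x) ^ 2 = ∑ i, ∑ j, c i * c j * (f i x * f j x) := by
    intro x
    rw [sq, Finset.sum_mul_sum]
    exact Finset.sum_congr rfl fun i _ => Finset.sum_congr rfl fun j _ => by ring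
  simp_rw [h1]
  rw [integral_finsetSum _ fun i _ => integrable_finsetSum _ fun j _ => (hf i j).const_mul _]
  refine Finset.sum_congr rfl fun i _ => ?_
  rw [integral_finsetSum _ fun j _ => (hf i j).const_mul _]
  exact Finset.sum_congr rfl fun j _ => integral_const_mul _ _

/-- In finite dimension, a quadratic form is bounded by every positive definite one. -/
theorem exists_quadratic_bound {X Y ι : Type*} [MeasurableSpace X] [MeasurableSpace Y] [Fintype ι]
    (μ : Measure X) (ν : Measure Y) (f : ι → X → ℝ) (g : ι → Y → ℝ)
    (hf : ∀ i j, Integrable (fun x => f i x * f j x) μ)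
    (hg : ∀ i j, Integrable (fun x => g i x * g j x) ν)
    (hpos : ∀ c : ι → ℝ, ∫ x, (∑ i, c i * f i x) ^ 2 ∂μ = 0 → c = 0) :
    ∃ C : ℝ, 0 < C ∧ ∀ c : ι → ℝ,
      ∫ x, (∑ i, c i * g i x) ^ 2 ∂ν ≤ C * ∫ x, (∑ i, c i * f i x) ^ 2 ∂μ := by
  set Qf : (ι → ℝ) → ℝ := fun c => ∫ x, (∑ i, c i * f i x) ^ 2 ∂μ with hQf
  set Qg : (ι → ℝ) → ℝ := fun c => ∫ x, (∑ i, c i * g i x) ^ 2 ∂ν with hQg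
  have hfc : Continuous Qf := by
    have : Qf = fun c => ∑ i, ∑ j, c i * c j * ∫ x, f i x * f j x ∂μ :=
      funext fun c => integral_sum_sq μ f hf c
    rw [this]; fun_prop
  have hgc : Continuous Qg := by
    have : Qg = fun c => ∑ i, ∑ j, c i * c j * ∫ x, g i x * g j x ∂ν :=
      funext fun c => integral_sum_sq ν g hg c
    rw [this]; fun_prop
  have hfs : ∀ (t : ℝ) (c : ι → ℝ), Qf (t • c) = t ^ 2 * Qf c := by
    intro t c
    simp only [hQf]
    rw [← integral_const_mul]
    congr 1; ext x
    simp only [Pi.smul_apply, smul_eq_mul, mul_assoc, ← Finset.mul_sum]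
    ring
  have hgs : ∀ (t : ℝ) (c : ι → ℝ), Qg (t • c) = t ^ 2 * Qg c := by
    intro t c
    simp only [hQg]
    rw [← integral_const_mul]
    congr 1; ext x
    simp only [Pi.smul_apply, smul_eq_mul, mul_assoc, ← Finset.mul_sum]
    ring
  have hf0 : ∀ c, 0 ≤ Qf c := fun c => integral_nonneg fun x => sq_nonneg _
  have hzero : Qg 0 = 0 ∧ Qf 0 = 0 := by constructor <;> simp [hQf, hQg]
  -- The sphere is empty exactly when there are no coefficients; otherwise both forms attain their
  -- extrema on it, and homogeneity does the rest.
  rcases (Metric.sphere (0 : ι → ℝ) 1).eq_empty_or_nonempty with hS | hS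
  · refine ⟨1, one_pos, fun c => ?_⟩
    have hc : c = 0 := by
      by_contra hc
      have : ‖c‖⁻¹ • c ∈ Metric.sphere (0 : ι → ℝ) 1 := by
        rw [mem_sphere_zero_iff_norm, norm_smul, norm_inv, norm_norm,
          inv_mul_cancel₀ (norm_ne_zero_iff.2 hc)]
      rw [hS] at this
      exact this
    rw [show ∫ x, (∑ i, c i * g i x) ^ 2 ∂ν = Qg c from rfl, hc, hzero.1]
    have := hf0 0
    rw [hzero.2] at this
    rw [show ∫ x, (∑ i, (0 : ι → ℝ) i * f i x) ^ 2 ∂μ = Qf 0 from rfl, hzero.2]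
    simp
  · obtain ⟨c₁, hc₁, hmin⟩ := (isCompact_sphere (0 : ι → ℝ) 1).exists_isMinOn hS hfc.continuousOn
    obtain ⟨c₂, hc₂, hmax⟩ := (isCompact_sphere (0 : ι → ℝ) 1).exists_isMaxOn hS hgc.continuousOn
    have hm : 0 < Qf c₁ := by
      refine lt_of_le_of_ne (hf0 _) fun h => ?_
      have := hpos c₁ h.symm
      rw [this, mem_sphere_zero_iff_norm, norm_zero] at hc₁
      exact zero_ne_one hc₁
    have hM : 0 ≤ Qg c₂ := integral_nonneg fun x => sq_nonneg _
    -- Maximum over minimum on the unit sphere; the added 1 only keeps the constant positive.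
    refine ⟨(Qg c₂ + 1) / Qf c₁, by positivity, fun c => ?_⟩
    change Qg c ≤ _ * Qf c
    by_cases hc : c = 0
    · rw [hc, hzero.1, hzero.2, mul_zero]
    · have hn : 0 < ‖c‖ := norm_pos_iff.2 hc
      have hcs : ‖c‖⁻¹ • c ∈ Metric.sphere (0 : ι → ℝ) 1 := by
        rw [mem_sphere_zero_iff_norm, norm_smul, norm_inv, norm_norm, inv_mul_cancel₀ hn.ne']
      have e : c = ‖c‖ • (‖c‖⁻¹ • c) := by rw [smul_smul, mul_inv_cancel₀ hn.ne', one_smul]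
      have h1 := hmin hcs
      have h2 := hmax hcs
      simp only [mem_ofPred_eq] at h1 h2
      rw [e, hfs, hgs, mul_left_comm]
      refine mul_le_mul_of_nonneg_left ?_ (sq_nonneg _)
      calc Qg (‖c‖⁻¹ • c) ≤ Qg c₂ := h2
        _ ≤ (Qg c₂ + 1) / Qf c₁ * Qf c₁ := by field_simp; linarith
        _ ≤ _ := mul_le_mul_of_nonneg_left h1 (by positivity)

/-- The reference bump function, supported in the unit ball. -/
def refBump (d : ℕ) : ContDiffBump (0 : E d) := ⟨1 / 2, 1, by norm_num, by norm_num⟩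

/-- The bump function of the ball with centre `a` and radius `ρ`. -/
def bubble (a : E d) (ρ : ℝ) (y : E d) : ℝ := refBump d (ρ⁻¹ • (y - a))

theorem contDiff_bubble (a : E d) (ρ : ℝ) : ContDiff ℝ ∞ (bubble a ρ) :=
  (refBump d).contDiff.comp (by fun_prop)

theorem continuous_bubble (a : E d) (ρ : ℝ) : Continuous (bubble a ρ) :=
  (contDiff_bubble a ρ).continuous

theorem bubble_nonneg (a : E d) (ρ : ℝ) (y : E d) : 0 ≤ bubble a ρ y := (refBump d).nonneg

theorem bubble_le_one (a : E d) (ρ : ℝ) (y : E d) : bubble a ρ y ≤ 1 := (refBump d).le_one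

theorem bubble_eq_zero {a : E d} {ρ : ℝ} (hρ : 0 < ρ) {y : E d}
    (hy : y ∉ Metric.closedBall a ρ) : bubble a ρ y = 0 := by
  refine (refBump d).zero_of_le_dist ?_
  rw [mem_closedBall_iff_norm, not_le] at hy
  rw [dist_zero_right, norm_smul, norm_inv, Real.norm_of_nonneg hρ.le, show (refBump d).rOut = 1 from rfl,
    inv_mul_eq_div, one_le_div hρ]
  exact hy.le

theorem isTest_bubble_mul {a : E d} {ρ : ℝ} (hρ : 0 < ρ) {f : E d → ℝ} (hf : ContDiff ℝ ∞ f) :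
    IsTest fun y => bubble a ρ y * f y := by
  refine ⟨(contDiff_bubble a ρ).mul hf, HasCompactSupport.mul_right ?_⟩
  exact HasCompactSupport.intro (isCompact_closedBall a ρ) fun y hy => bubble_eq_zero hρ hy

theorem bubble_ref (y : E d) : bubble (0 : E d) 1 y = refBump d y := by
  simp [bubble]

/-- The bump is positive on the open unit ball, so the weighted norm is definite on polynomials.
This is the hypothesis that `exists_quadratic_bound` requires. -/
theorem integral_bubble_sq_eq_zero {P : MvPolynomial (Fin d) ℝ}
    (h : ∫ y, bubble (0 : E d) 1 y * pval P y ^ 2 = 0) : P = 0 := by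
  refine eq_zero_of_pval_eq_zero one_pos fun x hx => ?_
  by_contra hne
  have hc : Continuous fun y : E d => bubble (0 : E d) 1 y * pval P y ^ 2 :=
    (continuous_bubble _ _).mul ((continuous_pval P).pow 2)
  have hs : HasCompactSupport fun y : E d => bubble (0 : E d) 1 y * pval P y ^ 2 :=
    (isTest_bubble_mul one_pos ((contDiff_pval P).pow 2)).2
  have hx0 : bubble (0 : E d) 1 x * pval P x ^ 2 ≠ 0 := by
    rw [bubble_ref]
    exact mul_ne_zero ((refBump d).pos_of_mem_ball hx).ne' (pow_ne_zero 2 hne)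
  have := hc.integral_pos_of_hasCompactSupport_nonneg_nonzero (μ := volume) hs
    (fun y => mul_nonneg (bubble_nonneg _ _ _) (sq_nonneg _)) hx0
  linarith

/-- Inverse inequalities in the unit ball. -/
theorem exists_inverse_ref (d N : ℕ) (R : ℝ) :
    ∃ C : ℝ, 0 < C ∧ ∀ P : MvPolynomial (Fin d) ℝ, P.totalDegree ≤ N →
      ∫ y in Metric.closedBall (0 : E d) R, pval P y ^ 2 ≤
        C * ∫ y, bubble (0 : E d) 1 y * pval P y ^ 2 ∧
      ∀ j : Fin d, ∫ y, (fderiv ℝ (fun y => bubble (0 : E d) 1 y * pval P y) y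
          (EuclideanSpace.single j 1)) ^ 2 ≤
        C * ∫ y, bubble (0 : E d) 1 y * pval P y ^ 2 := by
  let V := MvPolynomial.restrictTotalDegree (Fin d) ℝ N
  let b := Module.finBasis ℝ V
  set ι := Fin (Module.finrank ℝ V)
  let B : ι → MvPolynomial (Fin d) ℝ := fun i => (b i : MvPolynomial (Fin d) ℝ)
  have hBind : ∀ c : ι → ℝ, ∑ i, MvPolynomial.C (c i) * B i = 0 → c = 0 := by
    intro c hc
    have h1 : ∑ i, c i • b i = 0 := by
      apply Subtype.ext
      refine Eq.trans ?_ hc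
      simp [B, MvPolynomial.C_mul']
    funext i
    exact Fintype.linearIndependent_iff.1 b.linearIndependent c h1 i
  have hBspan : ∀ P : MvPolynomial (Fin d) ℝ, P.totalDegree ≤ N → ∃ c : ι → ℝ,
      P = ∑ i, MvPolynomial.C (c i) * B i := by
    intro P hP
    have hPV : P ∈ V := (MvPolynomial.mem_restrictTotalDegree _ _ _).2 hP
    refine ⟨b.repr ⟨P, hPV⟩, ?_⟩
    have := congrArg (Subtype.val) (b.sum_repr ⟨P, hPV⟩)
    refine Eq.trans this.symm ?_
    simp only [AddSubmonoidClass.coe_finsetSum, Submodule.coe_smul, B, MvPolynomial.C_mul']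
  have hval : ∀ (c : ι → ℝ) (y : E d), pval (∑ i, MvPolynomial.C (c i) * B i) y =
      ∑ i, c i * pval (B i) y := by
    intro c y
    rw [pval_sum]
    exact Finset.sum_congr rfl fun i _ => by rw [pval_mul, pval_C]
  -- The weight is written as the square of its root, so that the weighted energy becomes a plain
  -- sum of squares in the coefficients.
  let f : ι → E d → ℝ := fun i y => Real.sqrt (bubble (0 : E d) 1 y) * pval (B i) y
  have hff : ∀ (c : ι → ℝ) (y : E d), (∑ i, c i * f i y) ^ 2 =
      bubble (0 : E d) 1 y * (∑ i, c i * pval (B i) y) ^ 2 := by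
    intro c y
    have : ∑ i, c i * f i y = Real.sqrt (bubble (0 : E d) 1 y) * ∑ i, c i * pval (B i) y := by
      rw [Finset.mul_sum]
      exact Finset.sum_congr rfl fun i _ => by simp only [f]; ring
    rw [this, mul_pow, Real.sq_sqrt (bubble_nonneg _ _ _)]
  have hfint : ∀ i j, Integrable (fun y => f i y * f j y) volume := by
    intro i j
    have h1 : (fun y => f i y * f j y) = fun y => bubble (0 : E d) 1 y * (pval (B i) y * pval (B j) y) := by
      funext y
      simp only [f]
      rw [mul_mul_mul_comm, Real.mul_self_sqrt (bubble_nonneg _ _ _)]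
    rw [h1]
    have := isTest_bubble_mul (a := (0 : E d)) one_pos ((contDiff_pval (B i)).mul (contDiff_pval (B j)))
    exact this.1.continuous.integrable_of_hasCompactSupport this.2
  have hpos : ∀ c : ι → ℝ, ∫ y, (∑ i, c i * f i y) ^ 2 = 0 → c = 0 := by
    intro c hc
    refine hBind c (integral_bubble_sq_eq_zero ?_)
    rw [← hc]
    congr 1; funext y
    rw [hff, hval]
  obtain ⟨C₀, hC₀, h₀⟩ := exists_quadratic_bound volume
    (volume.restrict (Metric.closedBall (0 : E d) R)) f (fun i => pval (B i)) hfint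
    (fun i j => ((continuous_pval _).mul (continuous_pval _)).continuousOn.integrableOn_compact
      (isCompact_closedBall _ _)) hpos
  have htest : ∀ i, IsTest fun y : E d => bubble (0 : E d) 1 y * pval (B i) y := fun i =>
    isTest_bubble_mul one_pos (contDiff_pval (B i))
  have hder : ∀ j : Fin d, ∃ C : ℝ, 0 < C ∧ ∀ c : ι → ℝ,
      ∫ y, (∑ i, c i * fderiv ℝ (fun y => bubble (0 : E d) 1 y * pval (B i) y) y
          (EuclideanSpace.single j 1)) ^ 2 ≤ C * ∫ y, (∑ i, c i * f i y) ^ 2 := by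
    intro j
    refine exists_quadratic_bound volume volume f (fun i y =>
      fderiv ℝ (fun y => bubble (0 : E d) 1 y * pval (B i) y) y (EuclideanSpace.single j 1)) hfint
      (fun i k => ?_) hpos
    have hc : ∀ i, Continuous fun y => fderiv ℝ (fun y => bubble (0 : E d) 1 y * pval (B i) y) y
        (EuclideanSpace.single j 1) := fun i =>
      ((htest i).1.continuous_fderiv (by simp)).clm_apply continuous_const
    exact ((hc i).mul (hc k)).integrable_of_hasCompactSupport
      (HasCompactSupport.mul_right ((htest i).2.fderiv_apply (𝕜 := ℝ) _))
  choose Cj hCj hj using hder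
  refine ⟨C₀ + ∑ j, Cj j, add_pos_of_pos_of_nonneg hC₀ (Finset.sum_nonneg fun j _ => (hCj j).le),
    fun P hP => ?_⟩
  obtain ⟨c, rfl⟩ := hBspan P hP
  have hA : ∫ y, (∑ i, c i * f i y) ^ 2 =
      ∫ y, bubble (0 : E d) 1 y * pval (∑ i, MvPolynomial.C (c i) * B i) y ^ 2 := by
    congr 1; funext y
    rw [hff, hval]
  have hA0 : 0 ≤ ∫ y, bubble (0 : E d) 1 y * pval (∑ i, MvPolynomial.C (c i) * B i) y ^ 2 :=
    integral_nonneg fun y => mul_nonneg (bubble_nonneg _ _ _) (sq_nonneg _)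
  refine ⟨?_, fun j => ?_⟩
  · have := h₀ c
    rw [hA] at this
    simp_rw [← hval] at this
    refine this.trans (mul_le_mul_of_nonneg_right ?_ hA0)
    exact le_add_of_nonneg_right (Finset.sum_nonneg fun j _ => (hCj j).le)
  · have := hj j c
    rw [hA] at this
    have hd : ∀ y, fderiv ℝ (fun y => bubble (0 : E d) 1 y *
        pval (∑ i, MvPolynomial.C (c i) * B i) y) y (EuclideanSpace.single j 1) =
        ∑ i, c i * fderiv ℝ (fun y => bubble (0 : E d) 1 y * pval (B i) y) y
          (EuclideanSpace.single j 1) := by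
      intro y
      have e : (fun y => bubble (0 : E d) 1 y * pval (∑ i, MvPolynomial.C (c i) * B i) y) =
          fun y => ∑ i, c i * (bubble (0 : E d) 1 y * pval (B i) y) := by
        funext y
        rw [hval, Finset.mul_sum]
        exact Finset.sum_congr rfl fun i _ => by ring
      have hdiff : ∀ i, DifferentiableAt ℝ (fun y => bubble (0 : E d) 1 y * pval (B i) y) y :=
        fun i => (htest i).1.differentiable (by simp) y
      rw [e, fderiv_fun_sum fun i _ => (hdiff i).const_mul (c i)]
      simp [fderiv_const_mul (hdiff _)]
    simp_rw [hd]
    refine this.trans (mul_le_mul_of_nonneg_right ?_ hA0)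
    have h2 := Finset.single_le_sum (f := Cj) (fun j _ => (hCj j).le) (Finset.mem_univ j)
    linarith

end

/-! ### Inverse inequalities on balls of arbitrary size, and degrees of the discrete fields -/

section

variable {d G Nh n : ℕ} {Ωs : Fin n → Set (E d)}

/-- The polynomial `y ↦ P (a + ρ y)`. -/
def affinePoly (a : E d) (ρ : ℝ) (P : MvPolynomial (Fin d) ℝ) : MvPolynomial (Fin d) ℝ :=
  MvPolynomial.bind₁ (fun i => MvPolynomial.C (a i) + MvPolynomial.C ρ * MvPolynomial.X i) P

theorem pval_affinePoly (a : E d) (ρ : ℝ) (P : MvPolynomial (Fin d) ℝ) (y : E d) :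
    pval (affinePoly a ρ P) y = pval P (a + ρ • y) := by
  simp only [pval, affinePoly]
  rw [← MvPolynomial.aeval_eq_eval, ← MvPolynomial.aeval_eq_eval, MvPolynomial.aeval_bind₁]
  congr 2
  funext i
  simp

theorem totalDegree_affinePoly_le (a : E d) (ρ : ℝ) (P : MvPolynomial (Fin d) ℝ) :
    (affinePoly a ρ P).totalDegree ≤ P.totalDegree := by
  have h1 : ∀ i : Fin d,
      (MvPolynomial.C (a i) + MvPolynomial.C ρ * MvPolynomial.X i).totalDegree ≤ 1 := by
    intro i
    refine (MvPolynomial.totalDegree_add _ _).trans (max_le (by simp) ?_)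
    refine (MvPolynomial.totalDegree_mul _ _).trans (by simp)
  rw [affinePoly, MvPolynomial.bind₁, MvPolynomial.aeval_def, MvPolynomial.eval₂_eq]
  refine MvPolynomial.totalDegree_finsetSum_le fun s hs => ?_
  refine (MvPolynomial.totalDegree_mul _ _).trans ?_
  rw [MvPolynomial.algebraMap_eq, MvPolynomial.totalDegree_C, zero_add]
  refine (MvPolynomial.totalDegree_finsetProd _ _).trans ?_
  refine le_trans ?_ (MvPolynomial.le_totalDegree hs)
  rw [Finsupp.sum]
  refine Finset.sum_le_sum fun i _ => (MvPolynomial.totalDegree_pow _ _).trans ?_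
  calc s i * _ ≤ s i * 1 := Nat.mul_le_mul_left _ (h1 i)
    _ = s i := mul_one _

theorem integral_comp_affine (a : E d) {ρ : ℝ} (hρ : 0 < ρ) (f : E d → ℝ) :
    ∫ y, f (a + ρ • y) = (ρ ^ d)⁻¹ * ∫ y, f y := by
  rw [Measure.integral_comp_smul volume (fun y => f (a + y)), integral_add_left_eq_self,
    finrank_euclideanSpace_fin, abs_of_pos (by positivity), smul_eq_mul]

theorem bubble_affine (a : E d) {ρ : ℝ} (hρ : 0 < ρ) (y : E d) :
    bubble a ρ (a + ρ • y) = bubble 0 1 y := by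
  rw [bubble_ref, bubble, add_sub_cancel_left, smul_smul, inv_mul_cancel₀ hρ.ne', one_smul]

theorem fderiv_comp_affine (a : E d) (ρ : ℝ) {f : E d → ℝ} (hf : Differentiable ℝ f) (y z : E d) :
    fderiv ℝ (fun y => f (a + ρ • y)) y z = ρ * fderiv ℝ f (a + ρ • y) z := by
  have h1 : HasFDerivAt (fun y : E d => a + ρ • y) (ρ • ContinuousLinearMap.id ℝ (E d)) y :=
    ((hasFDerivAt_id y).const_smul ρ).const_add a
  have h2 := (hf (a + ρ • y)).hasFDerivAt.comp y h1
  have h3 : fderiv ℝ (fun y => f (a + ρ • y)) y = _ := h2.fderiv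
  rw [h3]
  simp

/-- Inverse inequalities for polynomials on a ball. -/
theorem exists_inverse (d N : ℕ) (R : ℝ) :
    ∃ C : ℝ, 0 < C ∧ ∀ (a : E d) (ρ h : ℝ), 0 < ρ → h ≤ R * ρ →
      ∀ P : MvPolynomial (Fin d) ℝ, P.totalDegree ≤ N →
      ∫ y in Metric.closedBall a h, pval P y ^ 2 ≤ C * ∫ y, bubble a ρ y * pval P y ^ 2 ∧
      ∀ j : Fin d, ρ ^ 2 * ∫ y, (fderiv ℝ (fun y => bubble a ρ y * pval P y) y
          (EuclideanSpace.single j 1)) ^ 2 ≤ C * ∫ y, bubble a ρ y * pval P y ^ 2 := by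
  -- The map `y ↦ a + ρ • y` carries the unit ball to the support of the bump, and `h ≤ R * ρ`
  -- places the ball of radius `h` in the image of the ball of radius `R`. All integrals acquire the
  -- factor `ρ⁻ᵈ`, and each derivative a factor `ρ`, whence `ρ ^ 2`.
  obtain ⟨C, hC, hmain⟩ := exists_inverse_ref d N R
  refine ⟨C, hC, fun a ρ h hρ hh P hP => ?_⟩
  obtain ⟨h1, h2⟩ := hmain (affinePoly a ρ P) ((totalDegree_affinePoly_le a ρ P).trans hP)
  have hρd : 0 < (ρ ^ d)⁻¹ := by positivity
  have e0 : ∫ y, bubble (0 : E d) 1 y * pval (affinePoly a ρ P) y ^ 2 =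
      (ρ ^ d)⁻¹ * ∫ y, bubble a ρ y * pval P y ^ 2 := by
    rw [← integral_comp_affine a hρ]
    simp_rw [bubble_affine a hρ, pval_affinePoly]
  have e1 : (ρ ^ d)⁻¹ * ∫ y in Metric.closedBall a h, pval P y ^ 2 ≤
      ∫ y in Metric.closedBall (0 : E d) R, pval (affinePoly a ρ P) y ^ 2 := by
    rw [← integral_indicator measurableSet_closedBall, ← integral_comp_affine a hρ,
      ← integral_indicator measurableSet_closedBall]
    have hle : ∀ y : E d, (Metric.closedBall a h).indicator (fun y => pval P y ^ 2) (a + ρ • y) ≤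
        (Metric.closedBall (0 : E d) R).indicator (fun y => pval (affinePoly a ρ P) y ^ 2) y := by
      intro y
      by_cases hy : a + ρ • y ∈ Metric.closedBall a h
      · have hy' : y ∈ Metric.closedBall (0 : E d) R := by
          rw [mem_closedBall_iff_norm, add_sub_cancel_left, norm_smul, Real.norm_of_nonneg hρ.le] at hy
          rw [mem_closedBall_zero_iff]
          nlinarith
        rw [indicator_of_mem hy, indicator_of_mem hy', pval_affinePoly]
      · rw [indicator_of_notMem hy]
        exact indicator_nonneg (fun _ _ => sq_nonneg _) _
    refine integral_mono_of_nonneg (ae_of_all _ fun y => indicator_nonneg (fun _ _ => sq_nonneg _) _)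
      ?_ (ae_of_all _ hle)
    rw [integrable_indicator_iff measurableSet_closedBall]
    exact ((continuous_pval _).pow 2).continuousOn.integrableOn_compact (isCompact_closedBall _ _)
  have e2 : ∀ j : Fin d, ∫ y, (fderiv ℝ (fun y => bubble (0 : E d) 1 y * pval (affinePoly a ρ P) y) y
      (EuclideanSpace.single j 1)) ^ 2 = (ρ ^ d)⁻¹ * (ρ ^ 2 *
        ∫ y, (fderiv ℝ (fun y => bubble a ρ y * pval P y) y (EuclideanSpace.single j 1)) ^ 2) := by
    intro j
    rw [← integral_const_mul, ← integral_comp_affine a hρ]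
    congr 1
    funext y
    have hd : Differentiable ℝ fun y => bubble a ρ y * pval P y :=
      ((contDiff_bubble a ρ).mul (contDiff_pval P)).differentiable (by simp)
    have := fderiv_comp_affine a ρ hd y (EuclideanSpace.single j 1)
    simp_rw [bubble_affine a hρ, ← pval_affinePoly] at this
    rw [this]
    ring
  rw [e0] at h1 h2
  refine ⟨?_, fun j => ?_⟩
  · have := e1.trans h1
    rw [mul_left_comm] at this
    exact le_of_mul_le_mul_left this hρd
  · have := h2 j
    rw [e2, mul_left_comm C] at this
    exact le_of_mul_le_mul_left this hρd

theorem totalDegree_le_of_degreeOf_le {P : MvPolynomial (Fin d) ℝ} {m : ℕ}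
    (h : ∀ i, P.degreeOf i ≤ m) : P.totalDegree ≤ d * m := by
  classical
  refine (MvPolynomial.totalDegree_le_degrees_card P).trans ?_
  rw [← Multiset.toFinset_sum_count_eq]
  calc ∑ i ∈ P.degrees.toFinset, P.degrees.count i ≤ ∑ i : Fin d, P.degrees.count i :=
        Finset.sum_le_sum_of_subset (Finset.subset_univ _)
    _ ≤ ∑ _i : Fin d, m := Finset.sum_le_sum fun i _ => by
        rw [← MvPolynomial.degreeOf_def]; exact h i
    _ = d * m := by simp

/-- On boxes the degree is at most `k + 1` in each of the `d` variables; the resulting crude bound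
also covers the degree `k + 1` of the simplices. -/
theorem Cell.IsRTNPoly.totalDegree_le {k : ℕ} {Q : Fin d → MvPolynomial (Fin d) ℝ} {K : Cell d}
    (hQ : K.IsRTNPoly k Q) (i : Fin d) : (Q i).totalDegree ≤ d * (k + 1) := by
  have hd : 1 ≤ d := Nat.one_le_iff_ne_zero.2 fun h => by subst h; exact i.elim0
  cases K with
  | simplex v hv =>
    obtain ⟨a, b, ha, hb, hab⟩ := hQ
    have h1 : (Q i).totalDegree ≤ k + 1 := by
      rw [hab i]
      refine (MvPolynomial.totalDegree_add _ _).trans (max_le ((ha i).trans (by omega)) ?_)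
      refine (MvPolynomial.totalDegree_mul _ _).trans ?_
      rw [MvPolynomial.totalDegree_X]
      omega
    exact h1.trans (Nat.le_mul_of_pos_left _ hd)
  | box a b hab =>
    refine totalDegree_le_of_degreeOf_le fun j => (hQ i j).trans ?_
    split_ifs <;> omega

end

section

variable {d G Nh n : ℕ} {Ωs : Fin n → Set (E d)}

/-! ### Square-integrable functions -/

section L2

variable {X V : Type*} [MeasurableSpace X] {μ : Measure X} [NormedAddCommGroup V]
  [InnerProductSpace ℝ V] {f g : X → V}

theorem eLpNorm_inner_le (hf : AEStronglyMeasurable f μ) (hg : AEStronglyMeasurable g μ) :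
    eLpNorm (fun x => (inner ℝ (f x) (g x) : ℝ)) 1 μ ≤ eLpNorm f 2 μ * eLpNorm g 2 μ := by
  have := eLpNorm_le_eLpNorm_mul_eLpNorm_of_nnnorm (p := 2) (q := 2) (r := 1) hf hg
    (fun x y => (inner ℝ x y : ℝ)) 1
    (ae_of_all _ fun _ => by rw [one_mul]; exact nnnorm_inner_le_nnnorm _ _)
  simpa using this

theorem _root_.MeasureTheory.MemLp.integrable_inner_two (hf : MemLp f 2 μ) (hg : MemLp g 2 μ) :
    Integrable (fun x => (inner ℝ (f x) (g x) : ℝ)) μ := by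
  rw [← memLp_one_iff_integrable]
  exact ⟨hf.1.inner hg.1,
    (eLpNorm_inner_le hf.1 hg.1).trans_lt (ENNReal.mul_lt_top hf.2 hg.2)⟩

theorem _root_.MeasureTheory.MemLp.integrable_mul_two {f g : X → ℝ} (hf : MemLp f 2 μ)
    (hg : MemLp g 2 μ) : Integrable (fun x => f x * g x) μ :=
  (hf.integrable_inner_two hg).congr (ae_of_all _ fun x => by simp [mul_comm])

theorem _root_.MeasureTheory.MemLp.integrable_norm_sq (hf : MemLp f 2 μ) :
    Integrable (fun x => ‖f x‖ ^ 2) μ :=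
  (hf.integrable_inner_two hf).congr (ae_of_all _ fun x => real_inner_self_eq_norm_sq (f x))

/-- By the Cauchy-Schwarz inequality, L² convergence of one factor gives L¹ convergence of the
products. -/
theorem tendsto_integral_inner (hf : MemLp f 2 μ) {w : ℕ → X → V} (hw : ∀ j, MemLp (w j) 2 μ)
    (hg : MemLp g 2 μ) (h : Tendsto (fun j => eLpNorm (fun x => w j x - g x) 2 μ) atTop (𝓝 0)) :
    Tendsto (fun j => ∫ x, (inner ℝ (f x) (w j x) : ℝ) ∂μ) atTop
      (𝓝 (∫ x, (inner ℝ (f x) (g x) : ℝ) ∂μ)) := by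
  refine tendsto_integral_of_L1' _ (hf.1.inner hg.1)
    (Eventually.of_forall fun j => hf.integrable_inner_two (hw j)) ?_
  have h0 : Tendsto (fun j => eLpNorm f 2 μ * eLpNorm (fun x => w j x - g x) 2 μ) atTop (𝓝 0) := by
    have := ENNReal.Tendsto.const_mul (a := eLpNorm f 2 μ) h (Or.inr hf.2.ne)
    rwa [mul_zero] at this
  refine tendsto_of_tendsto_of_tendsto_of_le_of_le tendsto_const_nhds h0 (fun _ => zero_le)
    fun j => ?_
  refine le_trans (le_of_eq ?_) (eLpNorm_inner_le hf.1 ((hw j).1.sub hg.1))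
  congr 1
  funext x
  simp [inner_sub_right]

theorem tendsto_integral_mul {f g : X → ℝ} (hf : MemLp f 2 μ) {w : ℕ → X → ℝ}
    (hw : ∀ j, MemLp (w j) 2 μ) (hg : MemLp g 2 μ)
    (h : Tendsto (fun j => eLpNorm (fun x => w j x - g x) 2 μ) atTop (𝓝 0)) :
    Tendsto (fun j => ∫ x, f x * w j x ∂μ) atTop (𝓝 (∫ x, f x * g x ∂μ)) := by
  have := tendsto_integral_inner hf hw hg h
  simpa [mul_comm] using this

/-- The Cauchy-Schwarz inequality for finite sums of integrals. -/
theorem sq_integral_sum_inner_le {ι : Type*} [Fintype ι] {f g : ι → X → V}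
    (hf : ∀ i, MemLp (f i) 2 μ) (hg : ∀ i, MemLp (g i) 2 μ) :
    (∫ x, ∑ i, (inner ℝ (f i x) (g i x) : ℝ) ∂μ) ^ 2 ≤
      (∫ x, ∑ i, ‖f i x‖ ^ 2 ∂μ) * ∫ x, ∑ i, ‖g i x‖ ^ 2 ∂μ := by
  have hi : Integrable (fun x => ∑ i, (inner ℝ (f i x) (g i x) : ℝ)) μ :=
    integrable_finsetSum _ fun i _ => (hf i).integrable_inner_two (hg i)
  have hff : Integrable (fun x => ∑ i, ‖f i x‖ ^ 2) μ :=
    integrable_finsetSum _ fun i _ => (hf i).integrable_norm_sq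
  have hgg : Integrable (fun x => ∑ i, ‖g i x‖ ^ 2) μ :=
    integrable_finsetSum _ fun i _ => (hg i).integrable_norm_sq
  -- The integral of the squared norm of `f - t • g` is a nonnegative quadratic polynomial in `t`,
  -- so its discriminant is not positive.
  have key : ∀ t : ℝ, 0 ≤ (∫ x, ∑ i, ‖g i x‖ ^ 2 ∂μ) * (t * t) +
      (-(2 * ∫ x, ∑ i, (inner ℝ (f i x) (g i x) : ℝ) ∂μ)) * t + ∫ x, ∑ i, ‖f i x‖ ^ 2 ∂μ := by
    intro t
    have h0 : 0 ≤ ∫ x, ∑ i, ‖f i x - t • g i x‖ ^ 2 ∂μ :=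
      integral_nonneg fun x => Finset.sum_nonneg fun i _ => sq_nonneg _
    have e : ∀ x, ∑ i, ‖f i x - t • g i x‖ ^ 2 = (∑ i, ‖g i x‖ ^ 2) * (t * t) +
        (-(2 * ∑ i, (inner ℝ (f i x) (g i x) : ℝ))) * t + ∑ i, ‖f i x‖ ^ 2 := by
      intro x
      rw [Finset.sum_mul, Finset.mul_sum, ← Finset.sum_neg_distrib, Finset.sum_mul,
        ← Finset.sum_add_distrib, ← Finset.sum_add_distrib]
      refine Finset.sum_congr rfl fun i _ => ?_
      rw [norm_sub_sq_real, inner_smul_right, norm_smul, mul_pow, Real.norm_eq_abs, sq_abs]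
      ring
    simp_rw [e] at h0
    have i1 : Integrable (fun x => (∑ i, ‖g i x‖ ^ 2) * (t * t)) μ := hgg.mul_const _
    have i2 : Integrable (fun x => -(2 * ∑ i, (inner ℝ (f i x) (g i x) : ℝ)) * t) μ :=
      (hi.const_mul 2).neg.mul_const t
    have i12 : Integrable (fun x => (∑ i, ‖g i x‖ ^ 2) * (t * t) +
        -(2 * ∑ i, (inner ℝ (f i x) (g i x) : ℝ)) * t) μ := i1.add i2
    rw [integral_add i12 hff, integral_add i1 i2, integral_mul_const,
      integral_mul_const, integral_neg, integral_const_mul] at h0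
    exact h0
  have := discrim_le_zero key
  rw [discrim] at this
  nlinarith

end L2

/-! ### Fields supported in an element -/

/-- A field supported in `S` that satisfies Green's formula on the whole space, with a normal trace
supported in `F`. -/
structure IsLocalField (S F : Set (E d)) (q : VField d) : Prop where
  memLp_val : MemLp q.val 2 volume
  memLp_div : MemLp q.div 2 volume
  memLp_tr : MemLp q.tr 2 ((surf d).restrict F)
  val_zero : ∀ y ∉ S, q.val y = 0
  div_zero : ∀ y ∉ S, q.div y = 0
  tr_zero : ∀ y ∉ F, q.tr y = 0
  measurable_base : MeasurableSet F
  surf_lt_top : surf d F < ⊤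
  green : ∀ v : E d → ℝ, IsTest v →
    ∫ y, (inner ℝ (q.val y) (∇ v y) + q.div y * v y) = ∫ y in F, q.tr y * v y ∂(surf d)

variable {Ω : Set (E d)} {T : DDMesh Ωs} {K : Fin T.size} {F : Set (E d)} {q : VField d}

theorem IsLocalField.memLp_tr_surf {S : Set (E d)} (h : IsLocalField S F q) (A : Set (E d)) :
    MemLp q.tr 2 ((surf d).restrict A) := by
  have h1 := (memLp_indicator_iff_restrict h.measurable_base).2 h.memLp_tr
  have h2 : F.indicator q.tr = q.tr := by
    rw [indicator_eq_self]
    intro y hy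
    by_contra hF
    exact hy (h.tr_zero y hF)
  rw [h2] at h1
  exact h1.restrict A

/-- Only the interior of an element is known to lie in the open set `U`; the boundary, which may
stick out, is null. -/
theorem setIntegral_of_zero_off_cell {C : Cell d} {U : Set (E d)} (hU : interior C.carrier ⊆ U)
    {f : E d → ℝ} (hf : ∀ y ∉ C.carrier, f y = 0) : ∫ y in U, f y = ∫ y, f y := by
  refine setIntegral_eq_integral_of_ae_compl_eq_zero ?_
  filter_upwards [compl_mem_ae_iff.2 C.volume_frontier] with y hy hyU
  refine hf y fun hyC => hy ?_
  rw [C.isCompact_carrier.isClosed.frontier_eq]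
  exact ⟨hyC, fun h => hyU (hU h)⟩

theorem setIntegral_cell_of_zero_off {C : Cell d} {U : Set (E d)} (hU : interior C.carrier ⊆ U)
    {f : E d → ℝ} (hf : ∀ y ∉ C.carrier, f y = 0) :
    ∫ y in U, f y = ∫ y in C.carrier, f y := by
  rw [setIntegral_of_zero_off_cell hU hf, setIntegral_of_zero_off_cell interior_subset hf]

theorem setIntegral_of_zero_off_base {A : Set (E d)} (hA : MeasurableSet A) (hFA : F ⊆ A)
    {f : E d → ℝ} (hf : ∀ y ∉ F, f y = 0) :
    ∫ y in A, f y ∂(surf d) = ∫ y in F, f y ∂(surf d) :=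
  setIntegral_eq_of_subset_of_forall_sdiff_eq_zero hA hFA fun y hy => hf y hy.2

theorem IsLocalField.green_on {C : Cell d} {U : Set (E d)} (h : IsLocalField C.carrier F q)
    (hU : interior C.carrier ⊆ U) {v : E d → ℝ} (hv : IsTest v) :
    ∫ y in U, (inner ℝ (q.val y) (∇ v y) + q.div y * v y) =
      ∫ y in F, q.tr y * v y ∂(surf d) := by
  rw [← h.green v hv]
  refine setIntegral_of_zero_off_cell hU fun y hy => ?_
  rw [h.val_zero y hy, h.div_zero y hy]
  simp

/-- Makes a local field admissible in the exact formulation. A test function supported in the open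
set Ω vanishes on `F ⊆ ∂Ω`, which removes the boundary term from Green's formula. -/
theorem IsLocalField.inQ {C : Cell d} (h : IsLocalField C.carrier F q) (hΩ : IsOpen Ω)
    (hC : interior C.carrier ⊆ Ω) (hF : F ⊆ frontier Ω) : InQ Ω q := by
  refine ⟨⟨h.memLp_val.restrict _, h.memLp_div.restrict _, fun v hv hvΩ => ?_⟩,
    h.memLp_tr_surf _, fun v hv _ => ?_⟩
  · rw [h.green_on hC hv]
    refine setIntegral_eq_zero_of_forall_eq_zero fun y hy => ?_
    have : v y = 0 := image_eq_zero_of_notMem_tsupport fun hyt =>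
      IsOpen.notMem_of_mem_frontier hΩ (hF hy) (hvΩ hyt)
    rw [this, mul_zero]
  · rw [h.green_on hC hv, setIntegral_of_zero_off_base
      (isClosed_frontier.measurableSet.inter isClosed_frontier.measurableSet)
      (subset_inter hF hF) fun y hy => by rw [h.tr_zero y hy, zero_mul]]

/-- In the subdomain of `K` the argument is that of `inQ`. In any other subdomain the field is zero
almost everywhere, so its trace on that part of ∂Ω has to vanish too; this holds because almost no
point of `F` is in the closure of the other subdomain. -/
theorem IsLocalField.inPQ (h : IsLocalField (T.el K) F q) (hΩ : IsOpen Ω)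
    (hP : IsPartition Ω Ωs) (hFK : F ⊆ T.el K) (hF : F ⊆ frontier Ω)
    (hae : ∀ᵐ x ∂((surf d).restrict F), ∀ j, j ≠ T.sub K → x ∉ closure (Ωs j)) :
    InPQ Ω Ωs q := by
  have hKi := hP.interior_el_subset T K
  intro i
  by_cases hi : i = T.sub K
  · subst hi
    have hFi := IsPartition.frontier_of_subset hΩ hP hFK hF
    refine ⟨⟨h.memLp_val.restrict _, h.memLp_div.restrict _, fun v hv hvΩ => ?_⟩,
      h.memLp_tr_surf _, fun v hv _ => ?_⟩
    · rw [IsLocalField.green_on h hKi hv]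
      refine setIntegral_eq_zero_of_forall_eq_zero fun y hy => ?_
      have : v y = 0 := image_eq_zero_of_notMem_tsupport fun hyt =>
        IsOpen.notMem_of_mem_frontier (hP.domain _).isOpen (hFi hy) (hvΩ hyt)
      rw [this, mul_zero]
    · rw [IsLocalField.green_on h hKi hv, setIntegral_of_zero_off_base
        (isClosed_frontier.measurableSet.inter isClosed_frontier.measurableSet)
        (subset_inter hF hFi) fun y hy => by rw [h.tr_zero y hy, zero_mul]]
  · have hzero : ∀ v : E d → ℝ,
        ∫ y in Ωs i, (inner ℝ (q.val y) (∇ v y) + q.div y * v y) = 0 := by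
      intro v
      refine setIntegral_eq_zero_of_ae_eq_zero ?_
      filter_upwards [compl_mem_ae_iff.2 (T.cell K).volume_frontier] with y hy hyi
      have hyK : y ∉ T.el K := by
        intro hyK
        rw [mem_compl_iff, (T.cell K).isCompact_carrier.isClosed.frontier_eq] at hy
        refine hy ⟨hyK, fun hyi' => ?_⟩
        exact Set.disjoint_left.1 (hP.disjoint i _ hi) hyi (hKi hyi')
      rw [h.val_zero y hyK, h.div_zero y hyK]
      simp
    refine ⟨⟨h.memLp_val.restrict _, h.memLp_div.restrict _, fun v _ _ => hzero v⟩,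
      h.memLp_tr_surf _, fun v hv _ => ?_⟩
    rw [hzero v]
    symm
    refine setIntegral_eq_zero_of_ae_eq_zero ?_
    rw [ae_restrict_iff' h.measurable_base] at hae
    filter_upwards [hae] with y hy hyA
    have : q.tr y = 0 := h.tr_zero y fun hyF => hy hyF i hi (frontier_subset_closure hyA.2)
    rw [this, zero_mul]

theorem DDMesh.mem_nbr_self (T : DDMesh Ωs) (K : Fin T.size) (hd : 1 ≤ d) : K ∈ T.nbr K :=
  ⟨by rw [inter_self]; exact (T.cell K).dimH_frontier hd, rfl⟩

theorem inLocal_of_isLocalField (hd : 1 ≤ d) {q : Idx G Nh → VField d}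
    (h : ∀ a, IsLocalField (T.el K) F (q a)) (hΩ : IsOpen Ω)
    (hP : IsPartition Ω Ωs) (hFK : F ⊆ T.el K) (hF : F ⊆ frontier Ω)
    (hae : ∀ᵐ x ∂((surf d).restrict F), ∀ j, j ≠ T.sub K → x ∉ closure (Ωs j)) :
    T.InLocal Ω K q (fun _ _ => 0) := by
  refine ⟨fun a => (h a).inPQ hΩ hP hFK hF hae, fun a => MemLp.zero', fun a => ?_, fun a => ?_⟩
  · refine ae_of_all _ fun x hx => (h a).val_zero x fun hxK => hx ?_
    exact mem_biUnion (T.mem_nbr_self K hd) hxK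
  · exact ae_of_all _ fun x _ => rfl

/-- Green's formula for a local field and a function of `H¹`. -/
theorem IsLocalField.green_trace {C : Cell d} (h : IsLocalField C.carrier F q)
    (hC : interior C.carrier ⊆ Ω) (hF : F ⊆ frontier Ω)
    {φ : E d → ℝ} {g : E d → E d} {t : E d → ℝ} (hφ : IsH1 Ω φ g) (ht : IsTrace Ω φ g t) :
    ∫ y in Ω, (inner ℝ (q.val y) (g y) + q.div y * φ y) = ∫ y in F, q.tr y * t y ∂(surf d) := by
  obtain ⟨htL, v, hv, h1, h2, h3⟩ := ht
  have hfin : IsFiniteMeasure ((surf d).restrict F) :=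
    ⟨by rw [Measure.restrict_apply_univ]; exact h.surf_lt_top⟩
  have hle : (surf d).restrict F ≤ (surf d).restrict (frontier Ω) := Measure.restrict_mono_set _ hF
  have hval := h.memLp_val.restrict Ω
  have hdiv := h.memLp_div.restrict Ω
  have hvL : ∀ j, MemLp (v j) 2 (volume.restrict Ω) := fun j => ((hv j).memLp volume 2).restrict Ω
  have hgL : ∀ j, MemLp (∇ (v j)) 2 (volume.restrict Ω) :=
    fun j => ((hv j).memLp_gradient volume 2).restrict Ω
  have hvF : ∀ j, MemLp (v j) 2 ((surf d).restrict F) := by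
    intro j
    obtain ⟨C, hC⟩ := (hv j).exists_bound
    exact MemLp.of_bound (hv j).1.continuous.aestronglyMeasurable C
      (ae_of_all _ fun x => (hC x).1)
  -- Green's formula holds for the smooth approximations of `φ`, and each of its three terms passes
  -- to the limit by one of the convergences in `IsTrace`.
  have l1 := tendsto_integral_inner hval hgL hφ.2.1 h2
  have l2 := tendsto_integral_mul hdiv hvL hφ.1 h1
  have l3 := tendsto_integral_mul h.memLp_tr hvF (htL.mono_measure hle)
    (tendsto_of_tendsto_of_tendsto_of_le_of_le tendsto_const_nhds h3 (fun _ => zero_le)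
      fun j => eLpNorm_mono_measure _ hle)
  have l12 := l1.add l2
  have e : ∀ j, (∫ x in Ω, (inner ℝ (q.val x) (∇ (v j) x) : ℝ)) + ∫ x in Ω, q.div x * v j x =
      ∫ y in F, q.tr y * v j y ∂(surf d) := by
    intro j
    rw [← h.green_on hC (hv j), integral_add (hval.integrable_inner_two (hgL j))
      (hdiv.integrable_mul_two (hvL j))]
  simp_rw [e] at l12
  rw [integral_add (hval.integrable_inner_two hφ.2.1) (hdiv.integrable_mul_two hφ.1)]
  exact tendsto_nhds_unique l12 l3

end

section

variable {d G Nh n : ℕ} {Ωs : Fin n → Set (E d)}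

/-! ### Bubble fields and cone fields are local fields -/

/-- The vector field with polynomial components `Q`. -/
def polyField (Q : Fin d → MvPolynomial (Fin d) ℝ) (y : E d) : E d :=
  WithLp.toLp 2 fun j => pval (Q j) y

theorem continuous_polyField (Q : Fin d → MvPolynomial (Fin d) ℝ) : Continuous (polyField Q) :=
  (PiLp.continuous_toLp 2 _).comp (continuous_pi fun j => continuous_pval (Q j))

theorem norm_sq_polyField (Q : Fin d → MvPolynomial (Fin d) ℝ) (y : E d) :
    ‖polyField Q y‖ ^ 2 = ∑ j, pval (Q j) y ^ 2 := by
  rw [EuclideanSpace.norm_sq_eq]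
  simp [polyField]

/-- A polynomial field multiplied by a bump function. -/
def bubbleField (a : E d) (ρ : ℝ) (Q : Fin d → MvPolynomial (Fin d) ℝ) : VField d where
  val y := bubble a ρ y • polyField Q y
  div y := ∑ j, fderiv ℝ (fun y => bubble a ρ y * pval (Q j) y) y (EuclideanSpace.single j 1)
  tr _ := 0

theorem inner_eq_sum_gradient (v : E d → ℝ) (x z : E d) :
    inner ℝ z (∇ v x) = ∑ j, z j * fderiv ℝ v x (EuclideanSpace.single j 1) := by
  rw [PiLp.inner_apply]
  refine Finset.sum_congr rfl fun j _ => ?_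
  rw [← inner_gradient_eq, EuclideanSpace.inner_single_left]
  simp [mul_comm]

/-- The bump vanishes outside a ball contained in `S`, so componentwise integration by parts leaves
no boundary term and the base is empty. -/
theorem isLocalField_bubbleField {S : Set (E d)} {a : E d} {ρ : ℝ} (hρ : 0 < ρ)
    (hS : Metric.closedBall a ρ ⊆ S) (Q : Fin d → MvPolynomial (Fin d) ℝ) :
    IsLocalField S ∅ (bubbleField a ρ Q) := by
  have htest : ∀ j, IsTest fun y => bubble a ρ y * pval (Q j) y := fun j =>
    isTest_bubble_mul hρ (contDiff_pval (Q j))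
  have hcd : ∀ j, Continuous fun y => fderiv ℝ (fun y => bubble a ρ y * pval (Q j) y) y
      (EuclideanSpace.single j 1) := fun j =>
    ((htest j).1.continuous_fderiv (by simp)).clm_apply continuous_const
  have hsd : ∀ j, HasCompactSupport fun y => fderiv ℝ (fun y => bubble a ρ y * pval (Q j) y) y
      (EuclideanSpace.single j 1) := fun j => (htest j).2.fderiv_apply (𝕜 := ℝ) _
  have hvc : Continuous (bubbleField a ρ Q).val :=
    (continuous_bubble a ρ).smul (continuous_polyField Q)
  have hdiv : (bubbleField a ρ Q).div = fun y => ∑ j : Fin d,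
      fderiv ℝ (fun y => bubble a ρ y * pval (Q j) y) y (EuclideanSpace.single j 1) := rfl
  have hvz : ∀ y ∉ Metric.closedBall a ρ, (bubbleField a ρ Q).val y = 0 := by
    intro y hy
    simp only [bubbleField]
    rw [bubble_eq_zero hρ hy, zero_smul]
  have hdz : ∀ j, ∀ y ∉ Metric.closedBall a ρ,
      fderiv ℝ (fun y => bubble a ρ y * pval (Q j) y) y = 0 := by
    intro j y hy
    have : (fun y => bubble a ρ y * pval (Q j) y) =ᶠ[𝓝 y] fun _ => 0 := by
      filter_upwards [Metric.isClosed_closedBall.isOpen_compl.mem_nhds hy] with z hz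
      rw [bubble_eq_zero hρ hz, zero_mul]
    rw [this.fderiv_eq]
    simp
  refine ⟨?_, ?_, MemLp.zero', fun y hy => hvz y fun h => hy (hS h), fun y hy => ?_, fun _ _ => rfl,
    MeasurableSet.empty, by simp, fun v hv => ?_⟩
  · exact hvc.memLp_of_hasCompactSupport
      (HasCompactSupport.intro (isCompact_closedBall a ρ) hvz)
  · rw [hdiv]
    refine memLp_finsetSum (f := fun j y => fderiv ℝ (fun y => bubble a ρ y * pval (Q j) y) y
      (EuclideanSpace.single j 1)) _ fun j _ => ?_
    exact (hcd j).memLp_of_hasCompactSupport (hsd j)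
  · rw [hdiv]
    refine Finset.sum_eq_zero fun j _ => ?_
    rw [hdz j y fun h => hy (hS h)]
    rfl
  · have hcv : ∀ j : Fin d, Continuous fun y => fderiv ℝ v y (EuclideanSpace.single j 1) := fun j =>
      (hv.1.continuous_fderiv (by simp)).clm_apply continuous_const
    have i1 : ∀ j, Integrable fun y => bubble a ρ y * pval (Q j) y *
        fderiv ℝ v y (EuclideanSpace.single j 1) := fun j =>
      ((htest j).1.continuous.mul (hcv j)).integrable_of_hasCompactSupport (htest j).2.mul_right
    have i2 : ∀ j, Integrable fun y => fderiv ℝ (fun y => bubble a ρ y * pval (Q j) y) y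
        (EuclideanSpace.single j 1) * v y := fun j =>
      ((hcd j).mul hv.1.continuous).integrable_of_hasCompactSupport (hsd j).mul_right
    have i3 : ∀ j, Integrable fun y => bubble a ρ y * pval (Q j) y * v y := fun j =>
      ((htest j).1.continuous.mul hv.1.continuous).integrable_of_hasCompactSupport
        (htest j).2.mul_right
    have e : ∀ y, inner ℝ ((bubbleField a ρ Q).val y) (∇ v y) + (bubbleField a ρ Q).div y * v y =
        ∑ j, (bubble a ρ y * pval (Q j) y * fderiv ℝ v y (EuclideanSpace.single j 1) +
          fderiv ℝ (fun y => bubble a ρ y * pval (Q j) y) y (EuclideanSpace.single j 1) * v y) := by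
      intro y
      rw [inner_eq_sum_gradient, Finset.sum_add_distrib, bubbleField, Finset.sum_mul]
      rfl
    have i12 : ∀ j, Integrable fun y =>
        bubble a ρ y * pval (Q j) y * fderiv ℝ v y (EuclideanSpace.single j 1) +
          fderiv ℝ (fun y => bubble a ρ y * pval (Q j) y) y (EuclideanSpace.single j 1) * v y :=
      fun j => (i1 j).add (i2 j)
    simp_rw [e]
    rw [integral_finsetSum _ fun j _ => i12 j]
    simp only [Measure.restrict_empty, integral_zero_measure]
    refine Finset.sum_eq_zero fun j _ => ?_
    rw [integral_add (i1 j) (i2 j), integral_mul_fderiv_eq_neg_fderiv_mul_of_integrable (i2 j)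
      (i1 j) (i3 j) (fun x _ => (htest j).1.differentiable (by simp) x)
      (fun x _ => hv.1.differentiable (by simp) x), neg_add_cancel]

/-- The cone field as a local field. -/
def coneVField (a u : E d) (H : ℝ) (g : E d → ℝ) : VField d :=
  ⟨coneField a u H g, coneDiv a u H g, g⟩

variable {a u : E d} {H : ℝ} {F : Set (E d)} {g : E d → ℝ} {C : Cell d}

/-- The field vanishes outside the element, and inside it the distance to the apex is at most the
diameter. -/
theorem IsBase.norm_coneField_le (h : IsBase a u H F) (hgF : ∀ y ∉ F, g y = 0)
    (ha : a ∈ C.carrier) (hFC : F ⊆ C.carrier) (y : E d) :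
    ‖coneField a u H g y‖ ≤ C.h / H * ‖coneExt a u H g y‖ := by
  by_cases hy : y ∈ C.carrier
  · have h1 := C.subset_closedBall ha hy
    rw [mem_closedBall_iff_norm] at h1
    rw [coneField, norm_smul, norm_div, Real.norm_of_nonneg h.pos.le, div_mul_eq_mul_div,
      div_mul_eq_mul_div, mul_comm C.h]
    exact div_le_div_of_nonneg_right (mul_le_mul_of_nonneg_left h1 (norm_nonneg _)) h.pos.le
  · have := h.coneExt_eq_zero hgF C.convex_carrier ha hFC hy
    simp [coneField, this]

theorem IsBase.isLocalField_coneVField (h : IsBase a u H F) (hg : Measurable g)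
    (hgF : ∀ y ∉ F, g y = 0) (hg2 : MemLp g 2 ((surf d).restrict F))
    (ha : a ∈ C.carrier) (hFC : F ⊆ C.carrier) :
    IsLocalField C.carrier F (coneVField a u H g) := by
  have hL := h.memLp_coneExt hg hgF hg2
  have hz : ∀ y ∉ C.carrier, coneExt a u H g y = 0 := fun y hy =>
    h.coneExt_eq_zero hgF C.convex_carrier ha hFC hy
  refine ⟨?_, ?_, hg2, fun y hy => ?_, fun y hy => ?_, hgF, h.compact.measurableSet, h.surf_lt_top,
    fun v hv => h.green hg hgF hg2 hv⟩
  · refine hL.of_le_mul ?_ (ae_of_all _ fun y => h.norm_coneField_le hgF ha hFC y)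
    exact (((measurable_coneExt a u H hg).div_const H).smul
      (measurable_id.sub_const a)).aestronglyMeasurable
  · have e : (coneVField a u H g).div = fun y => (d / H : ℝ) * coneExt a u H g y := by
      funext y
      simp only [coneVField, coneDiv]
      ring
    rw [e]
    exact hL.const_mul _
  · simp [coneVField, coneField, hz y hy]
  · simp [coneVField, coneDiv, hz y hy]

theorem IsBase.integral_norm_coneField_sq_le (h : IsBase a u H F) (hg : Measurable g)
    (hgF : ∀ y ∉ F, g y = 0) (hg2 : MemLp g 2 ((surf d).restrict F))
    (ha : a ∈ C.carrier) (hFC : F ⊆ C.carrier) :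
    ∫ y, ‖(coneVField a u H g).val y‖ ^ 2 ≤
      (C.h / H) ^ 2 * (H / d * ∫ y in F, g y ^ 2 ∂(surf d)) := by
  rw [← h.integral_coneExt_sq hg hgF, ← integral_const_mul]
  have hL := h.memLp_coneExt hg hgF hg2
  refine integral_mono_of_nonneg (ae_of_all _ fun y => sq_nonneg _)
    (((memLp_two_iff_integrable_sq hL.1).1 hL).const_mul _) (ae_of_all _ fun y => ?_)
  have h1 := h.norm_coneField_le hgF ha hFC y
  have h2 := pow_le_pow_left₀ (norm_nonneg _) h1 2
  rw [mul_pow, Real.norm_eq_abs, sq_abs] at h2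
  exact h2

theorem IsBase.integral_coneDiv_sq (h : IsBase a u H F) (hg : Measurable g)
    (hgF : ∀ y ∉ F, g y = 0) :
    ∫ y, (coneVField a u H g).div y ^ 2 =
      (d / H) ^ 2 * (H / d * ∫ y in F, g y ^ 2 ∂(surf d)) := by
  rw [← h.integral_coneExt_sq hg hgF, ← integral_const_mul]
  congr 1
  funext y
  simp only [coneVField, coneDiv]
  ring

end

section

variable {d G Nh n : ℕ} {Ωs : Fin n → Set (E d)}

/-! ### The continuous and the reconstructed solution -/

variable {Ω : Set (E d)} {T : DDMesh Ωs} {K : Fin T.size} {F : Set (E d)}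

/-- The error equation is tested with these data: an exact solution `(p, φ)` and an approximation
`(ph, φt)`, piecewise polynomial, where `φt` is in `H¹`. -/
structure IsApproximation (Ω : Set (E d)) (T : DDMesh Ωs) (k mo me mφ : ℕ) (X : CrossSections d G)
    (Sf : Idx G Nh → E d → ℝ) (p : Idx G Nh → VField d) (φ : Idx G Nh → E d → ℝ)
    (ph : Idx G Nh → VField d) (tn : Idx G Nh → Fin n → E d → ℝ) (φt : Idx G Nh → E d → ℝ)
    (gφt : Idx G Nh → E d → E d) (tφt : Idx G Nh → E d → ℝ) : Prop where
  pos_dim : 1 ≤ d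
  nonempty : Nonempty (Idx G Nh)
  domain : IsLipschitzDomain Ω
  partition : IsPartition Ω Ωs
  pos : PosSPN Ω X Nh
  coef_odd : ∀ a b, T.PiecewisePolyCoef mo (fun x => X.To Nh x a b)
  coef_even : ∀ a b, T.PiecewisePolyCoef me (fun x => X.Te Nh x a b)
  source : ∀ a, T.InLh k (Sf a)
  exact_solution : IsExactSolution Ω X Sf p φ
  discrete : ∀ a, T.InQh Ω k (ph a) (tn a)
  h1 : ∀ a, IsH1 Ω (φt a) (gφt a)
  trace : ∀ a, IsTrace Ω (φt a) (gφt a) (tφt a)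
  poly : ∀ a, T.PiecewisePoly mφ (φt a)

theorem DDMesh.restrict_el (T : DDMesh Ωs) (K : Fin T.size) :
    volume.restrict (interior (T.el K)) = volume.restrict (T.el K) :=
  (T.cell K).restrict_interior

theorem DDMesh.ae_mem_interior (T : DDMesh Ωs) (K : Fin T.size) :
    ∀ᵐ x ∂(volume.restrict (T.el K)), x ∈ interior (T.el K) := by
  rw [← T.restrict_el]
  exact ae_restrict_mem isOpen_interior.measurableSet

theorem DDMesh.el_measurableSet (T : DDMesh Ωs) (K : Fin T.size) : MeasurableSet (T.el K) :=
  (T.cell K).measurableSet_carrier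

theorem IsPartition.restrict_el_le_sub (hP : IsPartition Ω Ωs) (T : DDMesh Ωs) (K : Fin T.size) :
    volume.restrict (T.el K) ≤ volume.restrict (Ωs (T.sub K)) := by
  rw [← T.restrict_el]
  exact Measure.restrict_mono_set _ (hP.interior_el_subset T K)

theorem IsPartition.interior_el_subset_domain (hP : IsPartition Ω Ωs) (T : DDMesh Ωs)
    (K : Fin T.size) : interior (T.el K) ⊆ Ω :=
  (hP.interior_el_subset T K).trans (hP.subset _)

theorem IsPartition.restrict_el_le (hP : IsPartition Ω Ωs) (T : DDMesh Ωs) (K : Fin T.size) :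
    volume.restrict (T.el K) ≤ volume.restrict Ω :=
  (hP.restrict_el_le_sub T K).trans (Measure.restrict_mono_set _ (hP.subset _))

theorem DDMesh.memLp_of_ae_eq_pval {f : E d → ℝ} {P : MvPolynomial (Fin d) ℝ}
    (h : ∀ᵐ x ∂(volume.restrict (T.el K)), f x = pval P x) :
    MemLp f ⊤ (volume.restrict (T.el K)) := by
  have hc := (T.cell K).isCompact_carrier
  obtain ⟨C, hC⟩ := hc.exists_bound_of_continuousOn (continuous_pval P).continuousOn
  refine (MemLp.ae_eq (show pval P =ᵐ[_] f from by filter_upwards [h] with x hx using hx.symm) ?_)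
  refine memLp_top_of_bound (continuous_pval P).aestronglyMeasurable C ?_
  filter_upwards [ae_restrict_mem (T.el_measurableSet K)] with x hx using hC x hx

theorem DDMesh.isFiniteMeasure_restrict_el (T : DDMesh Ωs) (K : Fin T.size) :
    IsFiniteMeasure (volume.restrict (T.el K)) :=
  ⟨by rw [Measure.restrict_apply_univ]; exact (T.cell K).isCompact_carrier.measure_lt_top⟩

theorem DDMesh.PiecewisePolyCoef.ae_eq {m : ℕ} {A : E d → ℝ} (h : T.PiecewisePolyCoef m A)
    (K : Fin T.size) : ∃ P : MvPolynomial (Fin d) ℝ, P.totalDegree ≤ m ∧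
      ∀ᵐ x ∂(volume.restrict (T.el K)), A x = pval P x := by
  obtain ⟨P, hP, hA⟩ := h K
  refine ⟨P, hP, ?_⟩
  filter_upwards [T.ae_mem_interior K] with x hx using hA x hx

theorem DDMesh.PiecewisePolyCoef.memLp_smul {V : Type*} [NormedAddCommGroup V] [NormedSpace ℝ V]
    {m : ℕ} {A : E d → ℝ} (h : T.PiecewisePolyCoef m A)
    {f : E d → V} (hf : MemLp f 2 (volume.restrict (T.el K))) :
    MemLp (fun x => A x • f x) 2 (volume.restrict (T.el K)) := by
  obtain ⟨P, -, hA⟩ := h.ae_eq K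
  exact hf.smul (T.memLp_of_ae_eq_pval hA)

theorem DDMesh.memLp_two_of_ae_eq_pval {f : E d → ℝ} {P : MvPolynomial (Fin d) ℝ}
    (h : ∀ᵐ x ∂(volume.restrict (T.el K)), f x = pval P x) :
    MemLp f 2 (volume.restrict (T.el K)) :=
  have := T.isFiniteMeasure_restrict_el K
  (T.memLp_of_ae_eq_pval h).mono_exponent le_top

theorem _root_.MeasureTheory.MemLp.mulVec {X ι ι' : Type*} [MeasurableSpace X] {μ : Measure X}
    [Fintype ι] (A : Matrix ι' ι ℝ) {f : ι → X → ℝ} (hf : ∀ b, MemLp (f b) 2 μ) (a : ι') :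
    MemLp (fun x => (A *ᵥ fun b => f b x) a) 2 μ := by
  simp only [Matrix.mulVec, dotProduct]
  exact memLp_finsetSum _ fun b _ => (hf b).const_mul _

theorem integrable_dotProduct {X ι : Type*} [MeasurableSpace X] {μ : Measure X} [Fintype ι]
    {f g : X → ι → ℝ} (hf : ∀ a, MemLp (fun x => f x a) 2 μ)
    (hg : ∀ a, MemLp (fun x => g x a) 2 μ) :
    Integrable (fun x => f x ⬝ᵥ g x) μ := by
  simp only [dotProduct]
  exact integrable_finsetSum _ fun a _ => (hf a).integrable_mul_two (hg a)

theorem integral_sum_sum_mul {X ι : Type*} [MeasurableSpace X] {μ : Measure X} [Fintype ι]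
    (A : ι → ι → ℝ) {f : ι → ι → X → ℝ} (hf : ∀ a b, Integrable (f a b) μ) :
    ∫ x, ∑ a, ∑ b, A a b * f a b x ∂μ = ∑ a, ∑ b, A a b * ∫ x, f a b x ∂μ := by
  rw [integral_finsetSum _ fun a _ => integrable_finsetSum _ fun b _ => (hf a b).const_mul _]
  refine Finset.sum_congr rfl fun a _ => ?_
  rw [integral_finsetSum _ fun b _ => (hf a b).const_mul _]
  exact Finset.sum_congr rfl fun b _ => integral_const_mul _ _

/-! ### The forms, tested with local fields -/

variable {X : CrossSections d G} {q : Idx G Nh → VField d}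

/-- Differences of integrals are split only after this localisation: the coefficients are
polynomials on the element, which makes each piece integrable there. -/
theorem formO_eq_of_isLocalField (hC : interior (T.el K) ⊆ Ω)
    (hq : ∀ a, IsLocalField (T.el K) F (q a)) (u : Idx G Nh → VField d) :
    formO Ω X u q = ∫ x in T.el K, ∑ a,
      inner ℝ (∑ b, X.To Nh x a b • (u b).val x) ((q a).val x) := by
  rw [formO, setIntegral_cell_of_zero_off (C := T.cell K) hC]
  · simp_rw [sum_inner, inner_smul_left]
    rfl
  · intro y hy
    simp [fun a => (hq a).val_zero y hy]

theorem formB_eq_of_isLocalField (hC : interior (T.el K) ⊆ Ω)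
    (hq : ∀ a, IsLocalField (T.el K) F (q a)) (φ : Idx G Nh → E d → ℝ) :
    formB Ω φ q = ∫ x in T.el K, (matH G Nh *ᵥ fun b => φ b x) ⬝ᵥ fun a => (q a).div x := by
  rw [formB, setIntegral_cell_of_zero_off (C := T.cell K) hC]
  · simp_rw [Matrix.dotProduct_mulVec, Matrix.vecMul_transpose]
    rfl
  · intro y hy
    have : (fun a => (q a).div y) = 0 := funext fun a => (hq a).div_zero y hy
    simp [this]

theorem formR_eq_of_isLocalField (hF : F ⊆ frontier Ω)
    (hq : ∀ a, IsLocalField (T.el K) F (q a)) (u : Idx G Nh → VField d) :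
    formR Ω u q = ∫ x in F, (matGammaT G Nh *ᵥ fun a => (u a).tr x) ⬝ᵥ
      (fun a => (q a).tr x) ∂(surf d) := by
  rw [formR, setIntegral_of_zero_off_base isClosed_frontier.measurableSet hF]
  intro y hy
  have : (fun a => (q a).tr y) = 0 := funext fun a => (hq a).tr_zero y hy
  simp [this]

theorem formB_zero_left (Ω : Set (E d)) (q : Idx G Nh → VField d) :
    formB Ω (fun _ _ => 0) q = 0 := by
  have : (fun _ : Idx G Nh => (0 : ℝ)) = 0 := rfl
  simp [formB, this]

theorem formE_zero_right (Ω : Set (E d)) (φ : Idx G Nh → E d → ℝ) :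
    formE Ω X φ (fun _ _ => 0) = 0 := by
  have : (fun _ : Idx G Nh => (0 : ℝ)) = 0 := rfl
  simp [formE, this]

theorem formL_zero_right (Ω : Set (E d)) (f : Idx G Nh → E d → ℝ) :
    formL Ω f (fun _ _ => 0) = 0 := by
  have : (fun _ : Idx G Nh => (0 : ℝ)) = 0 := rfl
  simp [formL, this]

namespace IsApproximation

variable {k mo me mφ : ℕ} {Sf : Idx G Nh → E d → ℝ} {p : Idx G Nh → VField d}
  {φ : Idx G Nh → E d → ℝ} {ph : Idx G Nh → VField d} {tn : Idx G Nh → Fin n → E d → ℝ}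
  {φt : Idx G Nh → E d → ℝ} {gφt : Idx G Nh → E d → E d} {tφt : Idx G Nh → E d → ℝ}

variable (h : IsApproximation Ω T k mo me mφ X Sf p φ ph tn φt gφt tφt)

include h

theorem memLp_p (K : Fin T.size) (a) : MemLp (p a).val 2 (volume.restrict (T.el K)) :=
  (h.exact_solution.1 a).1.1.mono_measure (h.partition.restrict_el_le T K)

theorem memLp_div_p (K : Fin T.size) (a) : MemLp (p a).div 2 (volume.restrict (T.el K)) :=
  (h.exact_solution.1 a).1.2.1.mono_measure (h.partition.restrict_el_le T K)

theorem memLp_ph (K : Fin T.size) (a) : MemLp (ph a).val 2 (volume.restrict (T.el K)) :=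
  ((h.discrete a) (T.sub K)).1.1.1.mono_measure (h.partition.restrict_el_le_sub T K)

theorem memLp_div_ph (K : Fin T.size) (a) : MemLp (ph a).div 2 (volume.restrict (T.el K)) :=
  ((h.discrete a) (T.sub K)).1.1.2.1.mono_measure (h.partition.restrict_el_le_sub T K)

theorem memLp_φ (K : Fin T.size) (a) : MemLp (φ a) 2 (volume.restrict (T.el K)) :=
  (h.exact_solution.2.1 a).mono_measure (h.partition.restrict_el_le T K)

theorem memLp_φt (K : Fin T.size) (a) : MemLp (φt a) 2 (volume.restrict (T.el K)) :=
  (h.h1 a).1.mono_measure (h.partition.restrict_el_le T K)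

theorem memLp_gφt (K : Fin T.size) (a) : MemLp (gφt a) 2 (volume.restrict (T.el K)) :=
  (h.h1 a).2.1.mono_measure (h.partition.restrict_el_le T K)

theorem memLp_tr_p (hF : F ⊆ frontier Ω) (a) : MemLp (p a).tr 2 ((surf d).restrict F) := by
  refine (h.exact_solution.1 a).2.1.mono_measure (Measure.restrict_mono_set _ ?_)
  rwa [inter_self]

theorem memLp_tφt (hF : F ⊆ frontier Ω) (a) : MemLp (tφt a) 2 ((surf d).restrict F) :=
  (h.trace a).1.mono_measure (Measure.restrict_mono_set _ hF)

theorem memLp_tr_ph (hFK : F ⊆ T.el K) (hF : F ⊆ frontier Ω) (a) :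
    MemLp (ph a).tr 2 ((surf d).restrict F) := by
  have hFi := IsPartition.frontier_of_subset h.domain.isOpen h.partition hFK hF
  obtain ⟨⟨-, ⟨ht, -⟩, -⟩, hae⟩ := h.discrete a (T.sub K)
  have h1 : MemLp (tn a (T.sub K)) 2 ((surf d).restrict F) :=
    ht.mono_measure (Measure.restrict_mono_set _ (subset_inter hFi hFi))
  refine h1.ae_eq ?_
  filter_upwards [ae_restrict_of_ae_restrict_of_subset (subset_inter hF hFi) hae] with x hx
    using hx.symm

theorem memLp_flux {u : Idx G Nh → E d → E d}
    (hu : ∀ b, MemLp (u b) 2 (volume.restrict (T.el K))) (a) :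
    MemLp (fun x => ∑ b, X.To Nh x a b • u b x) 2 (volume.restrict (T.el K)) :=
  memLp_finsetSum _ fun b _ => (h.coef_odd a b).memLp_smul (hu b)

theorem memLp_defect (K : Fin T.size) (a) :
    MemLp (fun x => ∑ b, (X.To Nh x a b • (ph b).val x + matH G Nh a b • gφt b x)) 2
      (volume.restrict (T.el K)) :=
  memLp_finsetSum _ fun b _ => ((h.coef_odd a b).memLp_smul (h.memLp_ph K b)).add
    ((h.memLp_gφt K b).const_smul (matH G Nh a b))

/-- The error equation, tested with a local field. -/
theorem formD_field (hFK : F ⊆ T.el K) (hF : F ⊆ frontier Ω)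
    (hq : ∀ a, IsLocalField (T.el K) F (q a)) :
    formD Ω X (fun a => p a - ph a) (fun a x => φ a x - φt a x) q (fun _ _ => 0) =
      -(∫ x in T.el K, ∑ a, inner ℝ
        (∑ b, (X.To Nh x a b • (ph b).val x + matH G Nh a b • gφt b x)) ((q a).val x)) +
      ∫ x in F, ((matH G Nh *ᵥ fun b => tφt b x) - matGammaT G Nh *ᵥ fun b => (ph b).tr x) ⬝ᵥ
        (fun a => (q a).tr x) ∂(surf d) := by
  have hC := h.partition.interior_el_subset_domain T K
  have hqv : ∀ a, MemLp (q a).val 2 (volume.restrict (T.el K)) := fun a =>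
    (hq a).memLp_val.restrict _
  have hqd : ∀ a, MemLp (q a).div 2 (volume.restrict (T.el K)) := fun a =>
    (hq a).memLp_div.restrict _
  have hqt : ∀ a, MemLp (q a).tr 2 ((surf d).restrict F) := fun a => (hq a).memLp_tr
  have hex := h.exact_solution.2.2 q (fun _ _ => 0)
    (fun a => IsLocalField.inQ (hq a) h.domain.isOpen hC hF) (fun _ => MemLp.zero')
  -- With a zero scalar test the source disappears, and the equation says that d(ζ, (q, 0)) = 0.
  -- What remains of the error is minus the form at the approximation.
  rw [formC, formB_zero_left, formE_zero_right, formL_zero_right] at hex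
  rw [formD, formB_zero_left, formE_zero_right]
  have iO : ∀ u : Idx G Nh → VField d,
      (∀ b, MemLp (u b).val 2 (volume.restrict (T.el K))) →
      Integrable (fun x => ∑ a, (inner ℝ (∑ b, X.To Nh x a b • (u b).val x) ((q a).val x) : ℝ))
        (volume.restrict (T.el K)) := fun u hu =>
    integrable_finsetSum _ fun a _ => (h.memLp_flux hu a).integrable_inner_two (hqv a)
  have iH : Integrable (fun x => ∑ a,
      (inner ℝ (∑ b, matH G Nh a b • gφt b x) ((q a).val x) : ℝ)) (volume.restrict (T.el K)) :=
    integrable_finsetSum _ fun a _ => (memLp_finsetSum _ fun b _ =>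
      (h.memLp_gφt K b).const_smul (matH G Nh a b)).integrable_inner_two (hqv a)
  have iB : ∀ χ : Idx G Nh → E d → ℝ, (∀ b, MemLp (χ b) 2 (volume.restrict (T.el K))) →
      Integrable (fun x => (matH G Nh *ᵥ fun b => χ b x) ⬝ᵥ fun a => (q a).div x)
        (volume.restrict (T.el K)) := fun χ hχ =>
    integrable_dotProduct (fun a => MemLp.mulVec _ hχ a) hqd
  have eO : formO Ω X (fun a => p a - ph a) q = formO Ω X p q - formO Ω X ph q := by
    rw [formO_eq_of_isLocalField hC hq, formO_eq_of_isLocalField hC hq,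
      formO_eq_of_isLocalField hC hq, ← integral_sub (iO p (h.memLp_p K)) (iO ph (h.memLp_ph K))]
    congr 1
    funext x
    rw [← Finset.sum_sub_distrib]
    refine Finset.sum_congr rfl fun a _ => ?_
    rw [← inner_sub_left, ← Finset.sum_sub_distrib]
    simp_rw [← smul_sub]
    rfl
  have eR : formR Ω (fun a => p a - ph a) q = formR Ω p q - formR Ω ph q := by
    rw [formR_eq_of_isLocalField hF hq, formR_eq_of_isLocalField hF hq,
      formR_eq_of_isLocalField hF hq, ← integral_sub]
    · congr 1
      funext x
      rw [← sub_dotProduct, ← Matrix.mulVec_sub]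
      rfl
    · exact integrable_dotProduct (fun a => MemLp.mulVec _ (h.memLp_tr_p hF) a) hqt
    · exact integrable_dotProduct (fun a => MemLp.mulVec _ (h.memLp_tr_ph hFK hF) a) hqt
  have eB : formB Ω (fun a x => φ a x - φt a x) q = formB Ω φ q - formB Ω φt q := by
    rw [formB_eq_of_isLocalField hC hq, formB_eq_of_isLocalField hC hq,
      formB_eq_of_isLocalField hC hq, ← integral_sub]
    · congr 1
      funext x
      rw [← sub_dotProduct, ← Matrix.mulVec_sub]
      rfl
    · exact iB φ (h.memLp_φ K)
    · exact iB φt (h.memLp_φt K)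
  -- Integration by parts of the reconstruction, entry by entry of `matH`: the pairing with the
  -- divergence becomes a gradient term in `K` and a trace term on `F`.
  have hgreen : formB Ω φt q +
      (∫ x in T.el K, ∑ a, (inner ℝ (∑ b, matH G Nh a b • gφt b x) ((q a).val x) : ℝ)) =
      ∫ x in F, (matH G Nh *ᵥ fun b => tφt b x) ⬝ᵥ (fun a => (q a).tr x) ∂(surf d) := by
    have hg : ∀ a b, ∫ x in T.el K, ((inner ℝ ((q a).val x) (gφt b x) : ℝ) + (q a).div x * φt b x) =
        ∫ x in F, (q a).tr x * tφt b x ∂(surf d) := by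
      intro a b
      rw [← IsLocalField.green_trace (hq a) hC hF (h.h1 b) (h.trace b)]
      refine (setIntegral_cell_of_zero_off (C := T.cell K) hC fun y hy => ?_).symm
      rw [(hq a).val_zero y hy, (hq a).div_zero y hy]
      simp
    have i1 : ∀ a b, Integrable (fun x => (inner ℝ ((q a).val x) (gφt b x) : ℝ) +
        (q a).div x * φt b x) (volume.restrict (T.el K)) := fun a b =>
      ((hqv a).integrable_inner_two (h.memLp_gφt K b)).add
        ((hqd a).integrable_mul_two (h.memLp_φt K b))
    rw [formB_eq_of_isLocalField hC hq, ← integral_add (iB φt (h.memLp_φt K)) iH]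
    have e1 : ∀ x, ((matH G Nh *ᵥ fun b => φt b x) ⬝ᵥ fun a => (q a).div x) +
        ∑ a, (inner ℝ (∑ b, matH G Nh a b • gφt b x) ((q a).val x) : ℝ) =
        ∑ a, ∑ b, matH G Nh a b *
          ((inner ℝ ((q a).val x) (gφt b x) : ℝ) + (q a).div x * φt b x) := by
      intro x
      simp only [Matrix.mulVec, dotProduct]
      rw [← Finset.sum_add_distrib]
      refine Finset.sum_congr rfl fun a _ => ?_
      rw [sum_inner, Finset.sum_mul, ← Finset.sum_add_distrib]
      refine Finset.sum_congr rfl fun b _ => ?_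
      rw [real_inner_smul_left, real_inner_comm]
      ring
    have e2 : ∀ x, ((matH G Nh *ᵥ fun b => tφt b x) ⬝ᵥ fun a => (q a).tr x) =
        ∑ a, ∑ b, matH G Nh a b * ((q a).tr x * tφt b x) := by
      intro x
      simp only [Matrix.mulVec, dotProduct]
      refine Finset.sum_congr rfl fun a _ => ?_
      rw [Finset.sum_mul]
      exact Finset.sum_congr rfl fun b _ => by ring
    simp_rw [e1, e2]
    refine (integral_sum_sum_mul (matH G Nh) i1).trans
      (.trans ?_ (integral_sum_sum_mul (matH G Nh) fun a b =>
        (hqt a).integrable_mul_two (h.memLp_tφt hF b)).symm)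
    simp_rw [hg]
  have e3 : (∫ x in T.el K, ∑ a, (inner ℝ
        (∑ b, (X.To Nh x a b • (ph b).val x + matH G Nh a b • gφt b x)) ((q a).val x) : ℝ)) =
      formO Ω X ph q +
      ∫ x in T.el K, ∑ a, (inner ℝ (∑ b, matH G Nh a b • gφt b x) ((q a).val x) : ℝ) := by
    rw [formO_eq_of_isLocalField hC hq, ← integral_add (iO ph (h.memLp_ph K)) iH]
    congr 1
    funext x
    rw [← Finset.sum_add_distrib]
    refine Finset.sum_congr rfl fun a _ => ?_
    rw [← inner_add_left, Finset.sum_add_distrib]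
  have e4 : (∫ x in F, ((matH G Nh *ᵥ fun b => tφt b x) -
        matGammaT G Nh *ᵥ fun b => (ph b).tr x) ⬝ᵥ (fun a => (q a).tr x) ∂(surf d)) =
      (∫ x in F, (matH G Nh *ᵥ fun b => tφt b x) ⬝ᵥ (fun a => (q a).tr x) ∂(surf d)) -
        formR Ω ph q := by
    rw [formR_eq_of_isLocalField hF hq, ← integral_sub]
    · simp_rw [sub_dotProduct]
    · exact integrable_dotProduct (fun a => MemLp.mulVec _ (h.memLp_tφt hF) a) hqt
    · exact integrable_dotProduct (fun a => MemLp.mulVec _ (h.memLp_tr_ph hFK hF) a) hqt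
  rw [e3, e4, eO, eR, eB, ← hgreen]
  linarith

end IsApproximation

end

section

variable {d G Nh n : ℕ} {Ωs : Fin n → Set (E d)}

variable {Ω : Set (E d)} {T : DDMesh Ωs} {K : Fin T.size} {F : Set (E d)} {X : CrossSections d G}
  {q : Idx G Nh → VField d} {ψ : Idx G Nh → E d → ℝ}

/-! ### Homogeneity of the local norm -/

/-- The zero field. -/
def VField.zero : VField d := ⟨fun _ => 0, fun _ => 0, fun _ => 0⟩

/-- Multiplication of a field by a scalar. -/
def VField.smul (c : ℝ) (q : VField d) : VField d :=
  ⟨fun x => c • q.val x, fun x => c * q.div x, fun x => c * q.tr x⟩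

theorem integral_green_smul (c : ℝ) (μ : Measure (E d)) (q : VField d) (v : E d → ℝ) :
    ∫ x, (inner ℝ ((q.smul c).val x) (∇ v x) + (q.smul c).div x * v x) ∂μ =
      c * ∫ x, (inner ℝ (q.val x) (∇ v x) + q.div x * v x) ∂μ := by
  rw [← integral_const_mul]
  congr 1
  funext x
  simp only [VField.smul, real_inner_smul_left]
  ring

theorem InPQ.smul {q : VField d} (h : InPQ Ω Ωs q) (c : ℝ) : InPQ Ω Ωs (q.smul c) := by
  intro i
  obtain ⟨⟨h1, h2, h3⟩, h4, h5⟩ := h i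
  refine ⟨⟨h1.const_smul c, h2.const_mul c, fun v hv hs => ?_⟩, h4.const_mul c, fun v hv hs => ?_⟩
  · rw [integral_green_smul, h3 v hv hs, mul_zero]
  · rw [integral_green_smul, h5 v hv hs, ← integral_const_mul]
    simp only [VField.smul, mul_assoc]

theorem InPQ.zero : InPQ Ω Ωs (VField.zero : VField d) := fun _ =>
  ⟨⟨MemLp.zero', MemLp.zero', fun v _ _ => by simp [VField.zero]⟩, MemLp.zero',
    fun v _ _ => by simp [VField.zero]⟩

theorem DDMesh.InLocal.smul (h : T.InLocal Ω K q ψ) (c : ℝ) :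
    T.InLocal Ω K (fun a => (q a).smul c) (fun a x => c * ψ a x) := by
  refine ⟨fun a => (h.1 a).smul c, fun a => (h.2.1 a).const_mul c, fun a => ?_, fun a => ?_⟩
  · filter_upwards [h.2.2.1 a] with x hx hxK
    simp [VField.smul, hx hxK]
  · filter_upwards [h.2.2.2 a] with x hx hxK
    simp [hx hxK]

theorem formD_smul (p : Idx G Nh → VField d) (φ : Idx G Nh → E d → ℝ) (c : ℝ) :
    formD Ω X p φ (fun a => (q a).smul c) (fun a x => c * ψ a x) = c * formD Ω X p φ q ψ := by
  have e1 : formO Ω X p (fun a => (q a).smul c) = c * formO Ω X p q := by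
    rw [formO, formO, ← integral_const_mul]
    congr 1
    funext x
    simp only [VField.smul, real_inner_smul_right, Finset.mul_sum]
    exact Finset.sum_congr rfl fun a _ => Finset.sum_congr rfl fun b _ => by ring
  have e2 : formE Ω X φ (fun a x => c * ψ a x) = c * formE Ω X φ ψ := by
    rw [formE, formE, ← integral_const_mul]
    congr 1
    funext x
    exact dotProduct_smul c _ (fun a => ψ a x)
  have e3 : formR Ω p (fun a => (q a).smul c) = c * formR Ω p q := by
    rw [formR, formR, ← integral_const_mul]
    congr 1
    funext x
    exact dotProduct_smul c _ (fun a => (q a).tr x)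
  have e4 : formB Ω (fun a x => c * ψ a x) p = c * formB Ω ψ p := by
    rw [formB, formB, ← integral_const_mul]
    congr 1
    funext x
    exact smul_dotProduct c (fun a => ψ a x) _
  have e5 : formB Ω φ (fun a => (q a).smul c) = c * formB Ω φ q := by
    rw [formB, formB, ← integral_const_mul]
    congr 1
    funext x
    have : (fun a => ((q a).smul c).div x) = c • fun a => (q a).div x := rfl
    rw [this, Matrix.mulVec_smul, dotProduct_smul, smul_eq_mul]
  rw [formD, formD, e1, e2, e3, e4, e5]
  ring

theorem DDMesh.normS_smul (T : DDMesh Ωs) (q : Idx G Nh → VField d) (ψ : Idx G Nh → E d → ℝ)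
    {c : ℝ} (hc : 0 ≤ c) :
    T.normS Ω X (fun a => (q a).smul c) (fun a x => c * ψ a x) = c * T.normS Ω X q ψ := by
  have e1 : (∫ x in Ω, ∑ a, X.To Nh x a a * ‖((q a).smul c).val x‖ ^ 2) =
      c ^ 2 * ∫ x in Ω, ∑ a, X.To Nh x a a * ‖(q a).val x‖ ^ 2 := by
    rw [← integral_const_mul]
    congr 1
    funext x
    simp only [VField.smul, norm_smul, Real.norm_eq_abs, mul_pow, sq_abs, Finset.mul_sum]
    exact Finset.sum_congr rfl fun a _ => by ring
  have e2 : (∫ x in Ω, ∑ a, X.Te Nh x a a * (c * ψ a x) ^ 2) =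
      c ^ 2 * ∫ x in Ω, ∑ a, X.Te Nh x a a * ψ a x ^ 2 := by
    rw [← integral_const_mul]
    congr 1
    funext x
    simp only [Finset.mul_sum]
    exact Finset.sum_congr rfl fun a _ => by ring
  have e3 : ∀ K, (∫ x in T.el K, ∑ a, ((q a).smul c).div x ^ 2) =
      c ^ 2 * ∫ x in T.el K, ∑ a, (q a).div x ^ 2 := by
    intro K
    rw [← integral_const_mul]
    congr 1
    funext x
    simp only [VField.smul, mul_pow, Finset.mul_sum]
  have e4 : ∀ F : Set (E d), (∫ x in F, (fun a => ((q a).smul c).tr x) ⬝ᵥ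
        (matGammaT G Nh *ᵥ fun a => ((q a).smul c).tr x) ∂(surf d)) =
      c ^ 2 * ∫ x in F, (fun a => (q a).tr x) ⬝ᵥ
        (matGammaT G Nh *ᵥ fun a => (q a).tr x) ∂(surf d) := by
    intro F
    rw [← integral_const_mul]
    congr 1
    funext x
    have : (fun a => ((q a).smul c).tr x) = c • fun a => (q a).tr x := rfl
    rw [this, Matrix.mulVec_smul, dotProduct_smul, smul_dotProduct, smul_eq_mul, smul_eq_mul]
    ring
  rw [DDMesh.normS, DDMesh.normS]
  simp only [e1, e2, e3, e4]
  conv_rhs => rw [← Real.sqrt_sq hc, ← Real.sqrt_mul (sq_nonneg c)]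
  congr 1
  simp only [mul_add, Finset.mul_sum]
  congr 1
  · congr 1
    exact Finset.sum_congr rfl fun K _ => by ring
  · exact Finset.sum_congr rfl fun K _ => Finset.sum_congr rfl fun F _ => by ring

/-- The local norm bounds the form `d`, tested with local pairs. -/
theorem DDMesh.InLocal.formD_le {p : Idx G Nh → VField d} {φ : Idx G Nh → E d → ℝ}
    (h : T.InLocal Ω K q ψ) {M : ℝ} (hM : T.normS Ω X q ψ ≤ M)
    (hL : T.localNorm Ω X K p φ ≠ ⊤) :
    formD Ω X p φ q ψ ≤ M * (T.localNorm Ω X K p φ).toReal := by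
  -- The pair is normalised by a positive `N ≥ M`, because `M` itself may be zero; afterwards `N`
  -- tends to `M`, with an excess `ε / (l + 1)` that costs at most `ε`.
  have key : ∀ N : ℝ, 0 < N → M ≤ N →
      formD Ω X p φ q ψ ≤ N * (T.localNorm Ω X K p φ).toReal := by
    intro N hN hMN
    have h1 : T.normS Ω X (fun a => (q a).smul N⁻¹) (fun a x => N⁻¹ * ψ a x) ≤ 1 := by
      rw [T.normS_smul q ψ (inv_nonneg.2 hN.le), inv_mul_le_iff₀ hN, mul_one]
      exact hM.trans hMN
    have h2 : ENNReal.ofReal (N⁻¹ * formD Ω X p φ q ψ) ≤ T.localNorm Ω X K p φ := by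
      rw [← formD_smul]
      exact le_iSup_of_le _ (le_iSup_of_le _ (le_iSup_of_le (h.smul N⁻¹) (le_iSup_of_le h1 le_rfl)))
    have h3 := (ENNReal.ofReal_le_iff_le_toReal hL).1 h2
    rwa [inv_mul_le_iff₀ hN] at h3
  have hM0 : 0 ≤ M := (Real.sqrt_nonneg _).trans hM
  refine le_of_forall_pos_le_add fun ε hε => ?_
  set l := (T.localNorm Ω X K p φ).toReal with hl
  have hl0 : 0 ≤ l := ENNReal.toReal_nonneg
  have h1 := key (M + ε / (l + 1)) (by positivity) (by linarith [show 0 < ε / (l + 1) by positivity])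
  have h2 : ε / (l + 1) * l ≤ ε := by
    rw [div_mul_eq_mul_div, div_le_iff₀ (by positivity)]
    nlinarith
  linarith [add_mul M (ε / (l + 1)) l]

/-! ### Bounds of the diagonal coefficients -/

section Diagonal

variable {A : E d → Matrix (Idx G Nh) (Idx G Nh) ℝ} {m : ℕ} {lo hi : ℝ}

/-- Suprema and infima over an element need the bounds at every point. The entry is a polynomial in
the open interior, so the set where a bound fails is open and null, hence empty. -/
theorem diag_mem_Icc (hP : IsPartition Ω Ωs) (hA : ∀ a, T.PiecewisePolyCoef m (fun x => A x a a))
    (hae : ∀ a, ∀ᵐ x ∂(volume.restrict Ω), lo ≤ A x a a ∧ A x a a ≤ hi) (a) {x : E d}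
    (hx : x ∈ interior (T.el K)) : lo ≤ A x a a ∧ A x a a ≤ hi := by
  obtain ⟨P, -, hAP⟩ := hA a K
  have h1 : ∀ᵐ y ∂volume, y ∈ interior (T.el K) → lo ≤ pval P y ∧ pval P y ≤ hi := by
    rw [← ae_restrict_iff' isOpen_interior.measurableSet]
    filter_upwards [ae_restrict_of_ae_restrict_of_subset
      (hP.interior_el_subset_domain T K) (hae a),
      ae_restrict_mem isOpen_interior.measurableSet] with y hy hyK
    rwa [← hAP y hyK]
  have hopen : IsOpen (interior (T.el K) ∩ pval P ⁻¹' (Icc lo hi)ᶜ) :=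
    isOpen_interior.inter (isClosed_Icc.isOpen_compl.preimage (continuous_pval P))
  have hnull : volume (interior (T.el K) ∩ pval P ⁻¹' (Icc lo hi)ᶜ) = 0 := by
    refine measure_mono_null (fun y hy => ?_) (ae_iff.1 h1)
    exact fun hc => hy.2 (hc hy.1)
  have hempty := (hopen.measure_eq_zero_iff volume).1 hnull
  rw [show A x a a = pval P x from hAP x hx]
  by_contra hc
  exact (hempty ▸ (⟨hx, hc⟩ : x ∈ interior (T.el K) ∩ pval P ⁻¹' (Icc lo hi)ᶜ) : x ∈ (∅ : Set _))

/-- Real suprema and infima are meaningful only for nonempty bounded sets; the nonempty interior and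
the bounds `lo`, `hi` guarantee this. -/
theorem diagMin_diagMax_spec [Nonempty (Idx G Nh)] (hlo : 0 < lo)
    (h : ∀ a, ∀ x ∈ interior (T.el K), lo ≤ A x a a ∧ A x a a ≤ hi) :
    0 < T.diagMin A K ∧ ∀ a, ∀ x ∈ interior (T.el K),
      T.diagMin A K ≤ A x a a ∧ A x a a ≤ T.diagMax A K := by
  obtain ⟨z, hz⟩ := (T.cell K).interior_nonempty
  have hb : ∀ a, BddBelow ((fun x => A x a a) '' interior (T.el K)) := fun a =>
    ⟨lo, by rintro _ ⟨x, hx, rfl⟩; exact (h a x hx).1⟩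
  have ha : ∀ a, BddAbove ((fun x => A x a a) '' interior (T.el K)) := fun a =>
    ⟨hi, by rintro _ ⟨x, hx, rfl⟩; exact (h a x hx).2⟩
  refine ⟨hlo.trans_le (le_ciInf fun a => le_csInf ⟨_, z, hz, rfl⟩ ?_), fun a x hx => ⟨?_, ?_⟩⟩
  · rintro _ ⟨x, hx, rfl⟩
    exact (h a x hx).1
  · exact (ciInf_le (Set.finite_range _).bddBelow a).trans (csInf_le (hb a) ⟨x, hx, rfl⟩)
  · exact (le_csSup (ha a) ⟨x, hx, rfl⟩).trans
      (le_ciSup (f := fun a => sSup ((fun x => A x a a) '' interior (T.el K)))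
        (Set.finite_range _).bddAbove a)

end Diagonal

/-! ### The mesh-dependent norm of local fields -/

theorem IsLocalField.integral_el_div_sq_eq_zero (hq : ∀ a, IsLocalField (T.el K) F (q a))
    {K' : Fin T.size} (hK : K' ≠ K) : ∫ x in T.el K', ∑ a, (q a).div x ^ 2 = 0 := by
  rw [← T.restrict_el]
  refine setIntegral_eq_zero_of_ae_eq_zero ?_
  filter_upwards [compl_mem_ae_iff.2 (T.cell K).volume_frontier] with x hx hxK'
  refine Finset.sum_eq_zero fun a _ => ?_
  rw [(hq a).div_zero x fun hxK => hx ?_, sq, mul_zero]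
  rw [(T.cell K).isCompact_carrier.isClosed.frontier_eq]
  exact ⟨hxK, fun hxi => Set.disjoint_left.1 (T.interior_disjoint K' K hK) hxK' hxi⟩

theorem DDMesh.mem_bdryFacets :
    F ∈ T.bdryFacets Ω K ↔ F ∈ (T.cell K).facets ∧ F ⊆ frontier Ω := by
  simp [DDMesh.bdryFacets]

/-- The boundary part of the square of the norm `‖·‖_S`. -/
def DDMesh.bdrySum (T : DDMesh Ωs) (Ω : Set (E d)) (X : CrossSections d G)
    (q : Idx G Nh → VField d) : ℝ :=
  ∑ K, ∑ F ∈ T.bdryFacets Ω K, T.diagMax (X.To Nh) K * (T.cell K).hperp F *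
    ∫ x in F, (fun a => (q a).tr x) ⬝ᵥ (matGammaT G Nh *ᵥ fun a => (q a).tr x) ∂(surf d)

theorem DDMesh.bdrySum_eq_zero (T : DDMesh Ωs) (Ω : Set (E d)) (X : CrossSections d G)
    (hq : ∀ a x, (q a).tr x = 0) : T.bdrySum Ω X q = 0 := by
  refine Finset.sum_eq_zero fun K _ => Finset.sum_eq_zero fun F _ => ?_
  have : ∀ x, (fun a => (q a).tr x) = 0 := fun x => funext fun a => hq a x
  simp [this]

/-- The trace on `F` could be seen by other boundary facets overlapping `F`. Almost every point of
`F` lies on no other facet, so a single term survives. -/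
theorem IsLocalField.bdrySum_eq (hq : ∀ a, IsLocalField (T.el K) F (q a))
    (hF : F ∈ T.bdryFacets Ω K)
    (hae : ∀ᵐ x ∂((surf d).restrict F), ∀ K', ∀ F' ∈ (T.cell K').facets,
      x ∈ F' → K' = K ∧ F' = F) :
    T.bdrySum Ω X q = T.diagMax (X.To Nh) K * (T.cell K).hperp F *
      ∫ x in F, (fun a => (q a).tr x) ⬝ᵥ (matGammaT G Nh *ᵥ fun a => (q a).tr x) ∂(surf d) := by
  have hz : ∀ K', ∀ F' ∈ T.bdryFacets Ω K', ¬ (K' = K ∧ F' = F) →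
      ∫ x in F', (fun a => (q a).tr x) ⬝ᵥ (matGammaT G Nh *ᵥ fun a => (q a).tr x) ∂(surf d) = 0 := by
    intro K' F' hF' hnot
    refine setIntegral_eq_zero_of_ae_eq_zero ?_
    by_cases hι : Nonempty (Idx G Nh)
    · obtain ⟨a₀⟩ := hι
      rw [ae_restrict_iff' (hq a₀).measurable_base] at hae
      filter_upwards [hae] with x hx hxF'
      have : (fun a => (q a).tr x) = 0 := funext fun a => (hq a).tr_zero x fun hxF =>
        hnot (hx hxF K' F' (DDMesh.mem_bdryFacets.1 hF').1 hxF')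
      simp [this]
    · rw [not_nonempty_iff] at hι
      exact ae_of_all _ fun x _ => by simp [dotProduct]
  rw [DDMesh.bdrySum, Finset.sum_eq_single K, Finset.sum_eq_single F]
  · intro F' hF' h
    rw [hz K F' hF' fun hc => h hc.2, mul_zero]
  · exact fun h => absurd hF h
  · intro K' _ h
    exact Finset.sum_eq_zero fun F' hF' => by rw [hz K' F' hF' fun hc => h hc.1, mul_zero]
  · exact fun h => absurd (Finset.mem_univ K) h

/-- The scalar part vanishes and only `K` contributes to the divergence sum, since distinct elements
overlap in null sets. The weight of the field is replaced by its maximum in `K`. -/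
theorem IsLocalField.normS_le (hP : IsPartition Ω Ωs)
    (hq : ∀ a, IsLocalField (T.el K) F (q a))
    (hmax : ∀ a, ∀ x ∈ interior (T.el K),
      0 ≤ X.To Nh x a a ∧ X.To Nh x a a ≤ T.diagMax (X.To Nh) K) :
    T.normS Ω X q (fun _ _ => 0) ≤ Real.sqrt (T.diagMax (X.To Nh) K *
      ((∫ x in T.el K, ∑ a, ‖(q a).val x‖ ^ 2) +
        (T.cell K).h ^ 2 * ∫ x in T.el K, ∑ a, (q a).div x ^ 2) + T.bdrySum Ω X q) := by
  refine Real.sqrt_le_sqrt ?_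
  have h1 : (∫ x in Ω, ∑ a, X.To Nh x a a * ‖(q a).val x‖ ^ 2) ≤
      T.diagMax (X.To Nh) K * ∫ x in T.el K, ∑ a, ‖(q a).val x‖ ^ 2 := by
    rw [setIntegral_cell_of_zero_off (C := T.cell K) (hP.interior_el_subset_domain T K) fun y hy => by
      simp [fun a => (hq a).val_zero y hy]]
    rw [← integral_const_mul]
    refine integral_mono_of_nonneg ?_ ((integrable_finsetSum _ fun a _ =>
      ((hq a).memLp_val.restrict _).integrable_norm_sq).const_mul _) ?_
    · filter_upwards [T.ae_mem_interior K] with x hx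
      exact Finset.sum_nonneg fun a _ => mul_nonneg (hmax a x hx).1 (sq_nonneg _)
    · filter_upwards [T.ae_mem_interior K] with x hx
      rw [Finset.mul_sum]
      exact Finset.sum_le_sum fun a _ => mul_le_mul_of_nonneg_right (hmax a x hx).2 (sq_nonneg _)
  have h2 : (∫ x in Ω, ∑ a : Idx G Nh, X.Te Nh x a a * (0 : ℝ) ^ 2) = 0 := by simp
  have h3 : (∑ K, T.diagMax (X.To Nh) K * (T.cell K).h ^ 2 * ∫ x in T.el K, ∑ a, (q a).div x ^ 2) =
      T.diagMax (X.To Nh) K * (T.cell K).h ^ 2 * ∫ x in T.el K, ∑ a, (q a).div x ^ 2 := by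
    refine Finset.sum_eq_single K (fun K' _ hK' => ?_) fun h => absurd (Finset.mem_univ K) h
    rw [IsLocalField.integral_el_div_sq_eq_zero hq hK', mul_zero]
  rw [h2, h3, DDMesh.bdrySum]
  linarith

end

section

variable {d G Nh n : ℕ} {Ωs : Fin n → Set (E d)}

variable {Ω : Set (E d)} {T : DDMesh Ωs} {K : Fin T.size} {F : Set (E d)} {X : CrossSections d G}
  {ψ : Idx G Nh → E d → ℝ}

/-! ### The residual estimator -/

theorem formL_eq_of_zero_off (hC : interior (T.el K) ⊆ Ω) (hψ : ∀ a, ∀ x ∉ T.el K, ψ a x = 0)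
    (f : Idx G Nh → E d → ℝ) :
    formL Ω f ψ = ∫ x in T.el K, (fun a => f a x) ⬝ᵥ fun a => ψ a x := by
  rw [formL, setIntegral_cell_of_zero_off (C := T.cell K) hC]
  · rfl
  · intro y hy
    have : (fun a => ψ a y) = 0 := funext fun a => hψ a y hy
    simp [this]

theorem formE_eq_of_zero_off (hC : interior (T.el K) ⊆ Ω) (hψ : ∀ a, ∀ x ∉ T.el K, ψ a x = 0)
    (φ : Idx G Nh → E d → ℝ) :
    formE Ω X φ ψ = ∫ x in T.el K, (X.Te Nh x *ᵥ fun a => φ a x) ⬝ᵥ fun a => ψ a x :=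
  formL_eq_of_zero_off hC hψ fun a x => (X.Te Nh x *ᵥ fun b => φ b x) a

theorem formB_eq_of_zero_off (hC : interior (T.el K) ⊆ Ω) (hψ : ∀ a, ∀ x ∉ T.el K, ψ a x = 0)
    (p : Idx G Nh → VField d) :
    formB Ω ψ p = ∫ x in T.el K, ((matH G Nh)ᵀ *ᵥ fun a => (p a).div x) ⬝ᵥ fun a => ψ a x := by
  rw [← formL_eq_of_zero_off hC hψ fun a x => ((matH G Nh)ᵀ *ᵥ fun b => (p b).div x) a]
  simp_rw [formB, formL, dotProduct_comm (fun a => ψ a _)]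

namespace IsApproximation

variable {k mo me mφ : ℕ} {Sf : Idx G Nh → E d → ℝ} {p : Idx G Nh → VField d}
  {φ : Idx G Nh → E d → ℝ} {ph : Idx G Nh → VField d} {tn : Idx G Nh → Fin n → E d → ℝ}
  {φt : Idx G Nh → E d → ℝ} {gφt : Idx G Nh → E d → E d} {tφt : Idx G Nh → E d → ℝ}

variable (h : IsApproximation Ω T k mo me mφ X Sf p φ ph tn φt gφt tφt)

include h

theorem diag_odd (K : Fin T.size) : 0 < T.diagMin (X.To Nh) K ∧ ∀ a, ∀ x ∈ interior (T.el K),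
    T.diagMin (X.To Nh) K ≤ X.To Nh x a a ∧ X.To Nh x a a ≤ T.diagMax (X.To Nh) K := by
  have := h.nonempty
  obtain ⟨lo, hi, hlo, -, hb⟩ := h.pos.removal 1 (by norm_num)
  refine diagMin_diagMax_spec hlo fun a x hx =>
    diag_mem_Icc h.partition (fun a => h.coef_odd a a) (fun a => ?_) a hx (lo := lo) (hi := hi)
  filter_upwards [hb a.1 a.2] with x hx
  simpa [CrossSections.To, CrossSections.matT] using hx

theorem diag_even (K : Fin T.size) : 0 < T.diagMin (X.Te Nh) K ∧ ∀ a, ∀ x ∈ interior (T.el K),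
    T.diagMin (X.Te Nh) K ≤ X.Te Nh x a a ∧ X.Te Nh x a a ≤ T.diagMax (X.Te Nh) K := by
  have := h.nonempty
  obtain ⟨lo, hi, hlo, -, hb⟩ := h.pos.removal 0 (by norm_num)
  refine diagMin_diagMax_spec hlo fun a x hx =>
    diag_mem_Icc h.partition (fun a => h.coef_even a a) (fun a => ?_) a hx (lo := lo) (hi := hi)
  filter_upwards [hb a.1 a.2] with x hx
  simpa [CrossSections.Te, CrossSections.matT] using hx

theorem diag_odd_le (K : Fin T.size) : T.diagMin (X.To Nh) K ≤ T.diagMax (X.To Nh) K := by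
  obtain ⟨a⟩ := h.nonempty
  obtain ⟨z, hz⟩ := (T.cell K).interior_nonempty
  exact ((h.diag_odd K).2 a z hz).1.trans ((h.diag_odd K).2 a z hz).2

theorem diag_even_le (K : Fin T.size) : T.diagMin (X.Te Nh) K ≤ T.diagMax (X.Te Nh) K := by
  obtain ⟨a⟩ := h.nonempty
  obtain ⟨z, hz⟩ := (T.cell K).interior_nonempty
  exact ((h.diag_even K).2 a z hz).1.trans ((h.diag_even K).2 a z hz).2

theorem memLp_evenMulVec {u : Idx G Nh → E d → ℝ}
    (hu : ∀ b, MemLp (u b) 2 (volume.restrict (T.el K))) (a) :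
    MemLp (fun x => (X.Te Nh x *ᵥ fun b => u b x) a) 2 (volume.restrict (T.el K)) :=
  memLp_finsetSum _ fun b _ => (h.coef_even a b).memLp_smul (hu b)

theorem memLp_source (K : Fin T.size) (a) : MemLp (Sf a) 2 (volume.restrict (T.el K)) := by
  obtain ⟨P, -, hP⟩ := h.source a K
  exact T.memLp_two_of_ae_eq_pval hP

theorem memLp_residual (K : Fin T.size) (a) :
    MemLp (fun x => Sf a x - ((matH G Nh)ᵀ *ᵥ fun b => (ph b).div x) a -
      (X.Te Nh x *ᵥ fun b => φt b x) a) 2 (volume.restrict (T.el K)) :=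
  ((h.memLp_source K a).sub (MemLp.mulVec _ (h.memLp_div_ph K) a)).sub
    (h.memLp_evenMulVec (h.memLp_φt K) a)

/-- The error equation, tested with scalar functions supported in an element. -/
theorem formD_scalar (hψ : ∀ a, MemLp (ψ a) 2 volume) (hψ0 : ∀ a, ∀ x ∉ T.el K, ψ a x = 0) :
    formD Ω X (fun a => p a - ph a) (fun a x => φ a x - φt a x) (fun _ => VField.zero) ψ =
      ∫ x in T.el K, ∑ a, (Sf a x - ((matH G Nh)ᵀ *ᵥ fun b => (ph b).div x) a -
        (X.Te Nh x *ᵥ fun b => φt b x) a) * ψ a x := by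
  have hC := h.partition.interior_el_subset_domain T K
  have hψK : ∀ a, MemLp (ψ a) 2 (volume.restrict (T.el K)) := fun a => (hψ a).restrict _
  have hO : ∀ u : Idx G Nh → VField d, formO Ω X u (fun _ => VField.zero) = 0 := fun u => by
    simp [formO, VField.zero]
  have hz : (fun _ : Idx G Nh => (0 : ℝ)) = 0 := rfl
  have hR : ∀ u : Idx G Nh → VField d, formR Ω u (fun _ => VField.zero) = 0 := fun u => by
    simp [formR, VField.zero, hz]
  have hB : ∀ χ : Idx G Nh → E d → ℝ, formB Ω χ (fun _ => VField.zero) = 0 := fun χ => by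
    simp [formB, VField.zero, hz]
  have h0 : InQ Ω (VField.zero : VField d) :=
    ⟨⟨MemLp.zero', MemLp.zero', fun v _ _ => by simp [VField.zero]⟩, MemLp.zero',
      fun v _ _ => by simp [VField.zero]⟩
  have hex := h.exact_solution.2.2 (fun _ => VField.zero) ψ (fun _ => h0)
    (fun a => (hψ a).restrict _)
  rw [formC, hO, hB, hR] at hex
  rw [formD, hO, hB, hR]
  have iL : ∀ u : Idx G Nh → E d → ℝ, (∀ b, MemLp (u b) 2 (volume.restrict (T.el K))) →
      Integrable (fun x => (fun a => u a x) ⬝ᵥ fun a => ψ a x) (volume.restrict (T.el K)) :=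
    fun u hu => integrable_dotProduct hu hψK
  have iE : ∀ u : Idx G Nh → E d → ℝ, (∀ b, MemLp (u b) 2 (volume.restrict (T.el K))) →
      Integrable (fun x => (X.Te Nh x *ᵥ fun a => u a x) ⬝ᵥ fun a => ψ a x)
        (volume.restrict (T.el K)) :=
    fun u hu => integrable_dotProduct (fun a => h.memLp_evenMulVec hu a) hψK
  have iB : ∀ u : Idx G Nh → VField d, (∀ b, MemLp (u b).div 2 (volume.restrict (T.el K))) →
      Integrable (fun x => ((matH G Nh)ᵀ *ᵥ fun a => (u a).div x) ⬝ᵥ fun a => ψ a x)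
        (volume.restrict (T.el K)) :=
    fun u hu => integrable_dotProduct (fun a => MemLp.mulVec _ hu a) hψK
  have eE : formE Ω X (fun a x => φ a x - φt a x) ψ = formE Ω X φ ψ - formE Ω X φt ψ := by
    rw [formE_eq_of_zero_off hC hψ0, formE_eq_of_zero_off hC hψ0, formE_eq_of_zero_off hC hψ0,
      ← integral_sub (iE φ (h.memLp_φ K)) (iE φt (h.memLp_φt K))]
    congr 1
    funext x
    rw [← sub_dotProduct, ← Matrix.mulVec_sub]
    rfl
  have eB : formB Ω ψ (fun a => p a - ph a) = formB Ω ψ p - formB Ω ψ ph := by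
    rw [formB_eq_of_zero_off hC hψ0, formB_eq_of_zero_off hC hψ0, formB_eq_of_zero_off hC hψ0,
      ← integral_sub (iB p (h.memLp_div_p K)) (iB ph (h.memLp_div_ph K))]
    congr 1
    funext x
    rw [← sub_dotProduct, ← Matrix.mulVec_sub]
    rfl
  have eF : (∫ x in T.el K, ∑ a, (Sf a x - ((matH G Nh)ᵀ *ᵥ fun b => (ph b).div x) a -
      (X.Te Nh x *ᵥ fun b => φt b x) a) * ψ a x) =
      formL Ω Sf ψ - formB Ω ψ ph - formE Ω X φt ψ := by
    have i1 := iL Sf (h.memLp_source K)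
    have i2 := iB ph (h.memLp_div_ph K)
    have i12 : Integrable (fun x => ((fun a => Sf a x) ⬝ᵥ fun a => ψ a x) -
        ((matH G Nh)ᵀ *ᵥ fun a => (ph a).div x) ⬝ᵥ fun a => ψ a x)
        (volume.restrict (T.el K)) := i1.sub i2
    rw [formL_eq_of_zero_off hC hψ0, formB_eq_of_zero_off hC hψ0, formE_eq_of_zero_off hC hψ0,
      ← integral_sub i1 i2, ← integral_sub i12 (iE φt (h.memLp_φt K))]
    congr 1
    funext x
    rw [← sub_dotProduct, ← sub_dotProduct]
    rfl
  rw [eF, eE, eB]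
  linarith

/-- The test is the residual divided by the diagonal of `X.Te` and cut off outside `K`. The local
test space contains all square-integrable functions on `K`, so no bump is needed: the pairing and
the squared norm are both the squared estimator. -/
theorem etaR_le (hL : T.localNorm Ω X K (fun a => p a - ph a) (fun a x => φ a x - φt a x) ≠ ⊤) :
    T.etaR X Sf ph φt K ≤
      (T.localNorm Ω X K (fun a => p a - ph a) (fun a x => φ a x - φt a x)).toReal := by
  set l := (T.localNorm Ω X K (fun a => p a - ph a) (fun a x => φ a x - φt a x)).toReal with hl
  obtain ⟨hmin, hdiag⟩ := h.diag_even K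
  have hC := h.partition.interior_el_subset_domain T K
  set r : Idx G Nh → E d → ℝ := fun a x => Sf a x - ((matH G Nh)ᵀ *ᵥ fun b => (ph b).div x) a -
      (X.Te Nh x *ᵥ fun b => φt b x) a with hr
  have hrL : ∀ a, MemLp (r a) 2 (volume.restrict (T.el K)) := h.memLp_residual K
  have hposK : ∀ a, ∀ᵐ x ∂(volume.restrict (T.el K)), 0 < X.Te Nh x a a := by
    intro a
    filter_upwards [T.ae_mem_interior K] with x hx using hmin.trans_le (hdiag a x hx).1
  set ψ : Idx G Nh → E d → ℝ := fun a => (T.el K).indicator fun x => (X.Te Nh x a a)⁻¹ * r a x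
    with hψdef
  have hψ : ∀ a, MemLp (ψ a) 2 volume := by
    intro a
    rw [hψdef, memLp_indicator_iff_restrict (T.el_measurableSet K)]
    obtain ⟨P, -, hP⟩ := (h.coef_even a a).ae_eq K
    have hm : AEStronglyMeasurable (fun x => X.Te Nh x a a) (volume.restrict (T.el K)) :=
      (T.memLp_of_ae_eq_pval hP).1
    refine (hrL a).of_le_mul (c := (T.diagMin (X.Te Nh) K)⁻¹)
      ((hm.aemeasurable.inv.aestronglyMeasurable).mul (hrL a).1) ?_
    filter_upwards [T.ae_mem_interior K] with x hx
    have h1 := (hdiag a x hx).1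
    rw [norm_mul, norm_inv, Real.norm_of_nonneg (hmin.le.trans h1)]
    exact mul_le_mul_of_nonneg_right (inv_anti₀ hmin h1) (norm_nonneg _)
  have hψ0 : ∀ a, ∀ x ∉ T.el K, ψ a x = 0 := fun a x hx => indicator_of_notMem hx _
  have hloc : T.InLocal Ω K (fun _ => VField.zero) ψ :=
    ⟨fun _ => InPQ.zero, fun a => (hψ a).restrict _, fun _ => ae_of_all _ fun _ _ => rfl,
      fun a => ae_of_all _ fun x hx => hψ0 a x hx⟩
  set I := ∫ x in T.el K, ∑ a, (X.Te Nh x a a)⁻¹ * r a x ^ 2 with hI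
  have hform : formD Ω X (fun a => p a - ph a) (fun a x => φ a x - φt a x)
      (fun _ => VField.zero) ψ = I := by
    rw [h.formD_scalar hψ hψ0]
    refine setIntegral_congr_fun (T.el_measurableSet K) fun x hx => ?_
    refine Finset.sum_congr rfl fun a _ => ?_
    simp only [hψdef, indicator_of_mem hx, hr]
    ring
  have hnorm : T.normS Ω X (fun _ => VField.zero) ψ = Real.sqrt I := by
    rw [DDMesh.normS]
    congr 1
    have hz : ∀ v : Idx G Nh → ℝ, (fun _ : Idx G Nh => (0 : ℝ)) ⬝ᵥ v = 0 := zero_dotProduct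
    simp only [VField.zero, norm_zero, ne_eq, OfNat.ofNat_ne_zero, not_false_eq_true, zero_pow,
      mul_zero, Finset.sum_const_zero, integral_zero, hz, zero_add, add_zero]
    rw [setIntegral_cell_of_zero_off (C := T.cell K) hC fun y hy => by simp [fun a => hψ0 a y hy]]
    rw [hI]
    refine integral_congr_ae ?_
    filter_upwards [ae_all_iff.2 hposK, ae_restrict_mem (T.el_measurableSet K)] with x hx hxK
    refine Finset.sum_congr rfl fun a _ => ?_
    have := (hx a).ne'
    have hψx : ψ a x = (X.Te Nh x a a)⁻¹ * r a x := indicator_of_mem (s := T.el K) hxK _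
    rw [hψx]
    field_simp
  have hI0 : 0 ≤ I := by
    refine integral_nonneg_of_ae ?_
    filter_upwards [ae_all_iff.2 hposK] with x hx
    exact Finset.sum_nonneg fun a _ => mul_nonneg (inv_nonneg.2 (hx a).le) (sq_nonneg _)
  have h1 := hloc.formD_le hnorm.le hL
  rw [hform] at h1
  have h2 : T.etaR X Sf ph φt K = Real.sqrt I := rfl
  rw [h2]
  -- The inequality is `I ≤ √I * l`; one factor `√I` cancels unless it is zero, when the claim is
  -- trivial.
  rcases (Real.sqrt_nonneg I).eq_or_lt with h0 | h0
  · rw [← h0]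
    exact ENNReal.toReal_nonneg
  · nth_rw 1 [← Real.mul_self_sqrt hI0] at h1
    exact le_of_mul_le_mul_left h1 h0

end IsApproximation

end

/-! ### Partial derivatives of polynomials -/

section

variable {d G Nh n : ℕ} {Ωs : Fin n → Set (E d)}

open MvPolynomial in
theorem totalDegree_pderiv_le (j : Fin d) (P : MvPolynomial (Fin d) ℝ) :
    (pderiv j P).totalDegree ≤ P.totalDegree := by
  conv_lhs => rw [P.as_sum, map_sum]
  refine (totalDegree_finsetSum_le fun s hs => ?_)
  rw [pderiv_monomial]
  refine (totalDegree_monomial_le _ _).trans (le_trans ?_ (le_totalDegree hs))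
  exact Finsupp.degree_mono tsub_le_self

theorem fderiv_pval (P : MvPolynomial (Fin d) ℝ) (x : E d) (j : Fin d) :
    fderiv ℝ (pval P) x (EuclideanSpace.single j 1) = pval (MvPolynomial.pderiv j P) x := by
  have hd : ∀ Q : MvPolynomial (Fin d) ℝ, DifferentiableAt ℝ (pval Q) x := fun Q =>
    (contDiff_pval Q).differentiable (by simp) x
  induction P using MvPolynomial.induction_on with
  | C c =>
    have : pval (MvPolynomial.C c : MvPolynomial (Fin d) ℝ) = fun _ => c := funext (pval_C c)
    rw [this]
    simp [pval]
  | add P Q hP hQ =>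
    have : pval (P + Q) = pval P + pval Q := funext (pval_add P Q)
    rw [this, fderiv_add (hd P) (hd Q), map_add, pval_add, ← hP, ← hQ]
    rfl
  | mul_X P i hP =>
    have : pval (P * MvPolynomial.X i) = pval P * fun x => x i :=
      funext fun x => by rw [pval_mul, pval_X]; rfl
    have hX : HasFDerivAt (fun x : E d => x i) (EuclideanSpace.proj i : E d →L[ℝ] ℝ) x :=
      (EuclideanSpace.proj i : E d →L[ℝ] ℝ).hasFDerivAt
    rw [this, fderiv_mul (hd P) hX.differentiableAt, hX.fderiv, MvPolynomial.pderiv_mul,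
      pval_add, pval_mul, pval_mul, pval_X, ← hP, MvPolynomial.pderiv_X]
    rcases eq_or_ne i j with rfl | hij
    · simp [pval]
      ring
    · simp [pval, hij]
      ring

/-! ### The flux defect is a polynomial field -/

variable {Ω : Set (E d)} {T : DDMesh Ωs} {K : Fin T.size} {F : Set (E d)} {X : CrossSections d G}

theorem IsTest.memLp_fderiv {v : E d → ℝ} (hv : IsTest v) (j : Fin d) :
    MemLp (fun y => fderiv ℝ v y (EuclideanSpace.single j 1)) 2 volume :=
  ((hv.1.continuous_fderiv (by simp)).clm_apply continuous_const).memLp_of_hasCompactSupport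
    (hv.2.fderiv_apply (𝕜 := ℝ) _)

theorem setIntegral_smul_zero_off {V : Type*} [NormedAddCommGroup V] [NormedSpace ℝ V]
    {U W : Set (E d)} (hU : MeasurableSet W) (hUW : U ⊆ W) {f : E d → V}
    (hf : ∀ y ∉ U, f y = 0) : ∫ y in W, f y = ∫ y in U, f y :=
  setIntegral_eq_of_subset_of_forall_sdiff_eq_zero hU hUW fun y hy => hf y hy.2

/-- The weak gradient of a piecewise polynomial function of `H¹` is the gradient of the
polynomials. -/
theorem IsH1.gradient_eq_pval {φ : E d → ℝ} {g : E d → E d} (hφ : IsH1 Ω φ g) (hΩ : IsOpen Ω)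
    (hKΩ : interior (T.el K) ⊆ Ω) {P : MvPolynomial (Fin d) ℝ}
    (hP : ∀ᵐ x ∂(volume.restrict (T.el K)), φ x = pval P x) (j : Fin d) :
    ∀ᵐ x ∂(volume.restrict (T.el K)), g x j = pval (MvPolynomial.pderiv j P) x := by
  set U := interior (T.el K) with hU
  have hUo : IsOpen U := isOpen_interior
  rw [← T.restrict_el] at hP ⊢
  obtain ⟨h1, h2, h3⟩ := hφ
  have hle : volume.restrict U ≤ volume.restrict Ω := Measure.restrict_mono_set _ hKΩ
  have hfin : IsFiniteMeasure (volume.restrict U) := by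
    rw [hU, T.restrict_el]
    exact T.isFiniteMeasure_restrict_el K
  have hgL : MemLp (fun x => g x j) 2 (volume.restrict U) :=
    (EuclideanSpace.proj j : E d →L[ℝ] ℝ).comp_memLp' (h2.mono_measure hle)
  have hgj : Integrable (fun x => g x j) (volume.restrict U) := hgL.integrable one_le_two
  have hDc := continuous_pval (MvPolynomial.pderiv j P)
  have hD : Integrable (fun x => pval (MvPolynomial.pderiv j P) x) (volume.restrict U) := by
    have hc := hDc.continuousOn.integrableOn_compact (μ := volume) (T.cell K).isCompact_carrier
    exact hc.mono_set interior_subset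
  -- Against test functions supported in the interior, the weak gradient and the classical gradient
  -- of `P` satisfy the same integration by parts identity, as `φ` and `P` agree there. The
  -- fundamental lemma of the calculus of variations identifies them.
  have key : ∀ᵐ x ∂volume, x ∈ U → g x j - pval (MvPolynomial.pderiv j P) x = 0 := by
    refine hUo.ae_eq_zero_of_integral_contDiff_smul_eq_zero
      (IntegrableOn.locallyIntegrableOn (hgj.sub hD)) fun v hv hvc hvU => ?_
    have hvt : IsTest v := ⟨hv, hvc⟩
    have hv0 : ∀ y ∉ U, v y = 0 := fun y hy => image_eq_zero_of_notMem_tsupport fun h => hy (hvU h)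
    have hdv0 : ∀ y ∉ U, fderiv ℝ v y = 0 := fun y hy =>
      fderiv_of_notMem_tsupport (𝕜 := ℝ) fun h => hy (hvU h)
    have hgv0 : ∀ y ∉ U, ∇ v y = 0 := fun y hy => by
      simp only [gradient_eq_toDual_symm, hdv0 y hy, map_zero]
    obtain ⟨C, hC⟩ := hvt.exists_bound
    have hvL := (hvt.memLp volume 2).restrict U
    have hdvL := (hvt.memLp_fderiv j).restrict U
    have e1 : ∫ x in U, (φ x * fderiv ℝ v x (EuclideanSpace.single j 1) + v x * g x j) = 0 := by
      have hi : Integrable (fun x => φ x • ∇ v x + v x • g x) (volume.restrict U) := by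
        refine Integrable.add ?_ ?_
        · rw [← memLp_one_iff_integrable]
          exact ((hvt.memLp_gradient volume 2).restrict U).smul (h1.mono_measure hle)
        · rw [← memLp_one_iff_integrable]
          exact (h2.mono_measure hle).smul hvL
      have h4 := h3 v hvt (hvU.trans hKΩ)
      rw [setIntegral_smul_zero_off hΩ.measurableSet hKΩ fun y hy => by
        rw [hv0 y hy, hgv0 y hy, smul_zero, zero_smul, add_zero]] at h4
      have h5 := integral_inner (𝕜 := ℝ) hi (EuclideanSpace.single j (1 : ℝ))
      rw [h4, inner_zero_right] at h5
      rw [← h5]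
      congr 1
      funext x
      rw [inner_add_right, real_inner_smul_right, real_inner_smul_right, inner_gradient_eq,
        EuclideanSpace.inner_single_left]
      simp
    have e2 : ∫ x in U, (pval P x * fderiv ℝ v x (EuclideanSpace.single j 1) +
        v x * pval (MvPolynomial.pderiv j P) x) = 0 := by
      have hPc := continuous_pval P
      have hdc : Continuous fun y => fderiv ℝ v y (EuclideanSpace.single j 1) :=
        (hv.continuous_fderiv (by simp)).clm_apply continuous_const
      have i1 : Integrable fun y => pval P y * fderiv ℝ v y (EuclideanSpace.single j 1) :=
        (hPc.mul hdc).integrable_of_hasCompactSupport (hvc.fderiv_apply (𝕜 := ℝ) _).mul_left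
      have i2 : Integrable fun y => fderiv ℝ (pval P) y (EuclideanSpace.single j 1) * v y := by
        simp_rw [fderiv_pval]
        exact (hDc.mul hv.continuous).integrable_of_hasCompactSupport hvc.mul_left
      have i3 : Integrable fun y => pval P y * v y :=
        (hPc.mul hv.continuous).integrable_of_hasCompactSupport hvc.mul_left
      have h6 := integral_mul_fderiv_eq_neg_fderiv_mul_of_integrable i2 i1 i3
        (fun x _ => (contDiff_pval P).differentiable (by simp) x)
        (fun x _ => hv.differentiable (by simp) x)
      rw [setIntegral_eq_integral_of_forall_compl_eq_zero fun y hy => by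
        rw [hv0 y hy, hdv0 y hy]; simp]
      have h7 := integral_add i1 i2
      rw [h6, neg_add_cancel] at h7
      rw [← h7]
      congr 1
      funext x
      rw [fderiv_pval, mul_comm (v x)]
    have i1 : Integrable (fun x => φ x * fderiv ℝ v x (EuclideanSpace.single j 1) + v x * g x j)
        (volume.restrict U) :=
      ((h1.mono_measure hle).integrable_mul_two hdvL).add
        (hvL.integrable_mul_two hgL)
    have i2 : Integrable (fun x => pval P x * fderiv ℝ v x (EuclideanSpace.single j 1) +
        v x * pval (MvPolynomial.pderiv j P) x) (volume.restrict U) := by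
      refine Integrable.add ?_ ?_
      · refine ((h1.mono_measure hle).integrable_mul_two hdvL).congr ?_
        filter_upwards [hP] with x hx
        rw [hx]
      · exact ((hv.continuous.mul hDc).integrable_of_hasCompactSupport hvc.mul_right).restrict
    have h8 := integral_sub i1 i2
    rw [e1, e2, sub_zero] at h8
    rw [← setIntegral_eq_integral_of_forall_compl_eq_zero (s := U) fun y hy => by
      rw [hv0 y hy, zero_smul], ← h8]
    refine integral_congr_ae ?_
    filter_upwards [hP] with x hx
    rw [hx, smul_eq_mul]
    ring
  rw [ae_restrict_iff' hUo.measurableSet]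
  filter_upwards [key] with x hx hxU using sub_eq_zero.1 (hx hxU)

namespace IsApproximation

variable {k mo me mφ : ℕ} {Sf : Idx G Nh → E d → ℝ} {p : Idx G Nh → VField d}
  {φ : Idx G Nh → E d → ℝ} {ph : Idx G Nh → VField d} {tn : Idx G Nh → Fin n → E d → ℝ}
  {φt : Idx G Nh → E d → ℝ} {gφt : Idx G Nh → E d → E d} {tφt : Idx G Nh → E d → ℝ}

/-- A coefficient times a Raviart-Thomas-Nédélec field, plus the gradient of the reconstruction; the
degree bound adds the three contributions. The sign is chosen so that the error equation, tested
with the bubble field of `Q`, gives a nonnegative energy. -/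
theorem exists_defect_eq (h : IsApproximation Ω T k mo me mφ X Sf p φ ph tn φt gφt tφt)
    (K : Fin T.size) (a) : ∃ Q : Fin d → MvPolynomial (Fin d) ℝ,
      (∀ j, (Q j).totalDegree ≤ mo + d * (k + 1) + mφ) ∧
      ∀ᵐ x ∂(volume.restrict (T.el K)),
        ∑ b, (X.To Nh x a b • (ph b).val x + matH G Nh a b • gφt b x) = -polyField Q x := by
  choose A hA hAe using fun b => (h.coef_odd a b).ae_eq K
  choose B hB hBe using fun b => (h.discrete b (T.sub K)).1.2.2 K rfl
  choose D hD hDe using fun b => h.poly b K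
  refine ⟨fun j => ∑ b, (-(A b) * B b j +
    MvPolynomial.C (-matH G Nh a b) * MvPolynomial.pderiv j (D b)), fun j => ?_, ?_⟩
  · refine MvPolynomial.totalDegree_finsetSum_le fun b _ => ?_
    refine (MvPolynomial.totalDegree_add _ _).trans (max_le ?_ ?_)
    · refine (MvPolynomial.totalDegree_mul _ _).trans ?_
      rw [MvPolynomial.totalDegree_neg]
      have := (hB b).totalDegree_le j
      have := hA b
      omega
    · refine (MvPolynomial.totalDegree_mul _ _).trans ?_
      rw [MvPolynomial.totalDegree_C, zero_add]
      have := (totalDegree_pderiv_le j (D b)).trans (hD b)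
      omega
  · filter_upwards [ae_all_iff.2 hAe, ae_all_iff.2 hBe, ae_all_iff.2 fun b =>
      ae_all_iff.2 fun j => (h.h1 b).gradient_eq_pval h.domain.isOpen
        (h.partition.interior_el_subset_domain T K) (hDe b) j] with x h1 h2 h3
    ext j
    have e : ∀ b, (X.To Nh x a b • (ph b).val x + matH G Nh a b • gφt b x) j =
        X.To Nh x a b * (ph b).val x j + matH G Nh a b * gφt b x j := fun b => rfl
    have e' : (-polyField (fun j => ∑ b, (-(A b) * B b j +
        MvPolynomial.C (-matH G Nh a b) * MvPolynomial.pderiv j (D b))) x) j =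
        -∑ b, (-(pval (A b) x) * pval (B b j) x +
          -matH G Nh a b * pval (MvPolynomial.pderiv j (D b)) x) := by
      simp [polyField, pval, map_sum]
    rw [e', WithLp.ofLp_sum, Finset.sum_apply, ← Finset.sum_neg_distrib]
    refine Finset.sum_congr rfl fun b _ => ?_
    rw [e, h1 b, h2 b j, h3 b j]
    ring

end IsApproximation

end

section

variable {d G Nh n : ℕ} {Ωs : Fin n → Set (E d)}

variable {Ω : Set (E d)} {T : DDMesh Ωs} {K : Fin T.size} {F : Set (E d)} {X : CrossSections d G}

/-! ### The flux estimator -/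

/-- The absorption step shared by the flux and Robin estimates: a pairing `W` bounded by a test norm
of size `√(B * W)` is bounded by `B` times the squared local norm. -/
theorem le_mul_sq_of_le_sqrt_mul {W B l : ℝ} (hW : 0 ≤ W) (hB : 0 ≤ B) (hl : 0 ≤ l)
    (h : W ≤ Real.sqrt (B * W) * l) : W ≤ B * l ^ 2 := by
  rw [Real.sqrt_mul hB] at h
  have hs := Real.mul_self_sqrt hW
  have h1 : Real.sqrt W ≤ Real.sqrt B * l := by
    rcases (Real.sqrt_nonneg W).eq_or_lt with h0 | h0
    · rw [← h0]
      positivity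
    · refine le_of_mul_le_mul_left ?_ h0
      rw [hs]
      linarith
  calc W = Real.sqrt W ^ 2 := (Real.sq_sqrt hW).symm
    _ ≤ (Real.sqrt B * l) ^ 2 := pow_le_pow_left₀ (Real.sqrt_nonneg _) h1 2
    _ = B * l ^ 2 := by rw [mul_pow, Real.sq_sqrt hB]

/-- The squared `L²` norm of a polynomial field with a bump function as weight. -/
def bubbleEnergy (a : E d) (ρ : ℝ) (Q : Fin d → MvPolynomial (Fin d) ℝ) : ℝ :=
  ∑ j, ∫ y, bubble a ρ y * pval (Q j) y ^ 2

theorem integrable_bubble_mul {a : E d} {ρ : ℝ} (hρ : 0 < ρ) (P : MvPolynomial (Fin d) ℝ) :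
    Integrable fun y => bubble a ρ y * pval P y ^ 2 :=
  have h := isTest_bubble_mul (a := a) hρ ((contDiff_pval P).pow 2)
  h.1.continuous.integrable_of_hasCompactSupport h.2

theorem bubbleEnergy_nonneg (a : E d) (ρ : ℝ) (Q : Fin d → MvPolynomial (Fin d) ℝ) :
    0 ≤ bubbleEnergy a ρ Q :=
  Finset.sum_nonneg fun _ _ => integral_nonneg fun _ =>
    mul_nonneg (bubble_nonneg _ _ _) (sq_nonneg _)

theorem integral_bubble_norm_sq {a : E d} {ρ : ℝ} (hρ : 0 < ρ)
    (Q : Fin d → MvPolynomial (Fin d) ℝ) :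
    ∫ y, bubble a ρ y * ‖polyField Q y‖ ^ 2 = bubbleEnergy a ρ Q := by
  simp_rw [norm_sq_polyField, Finset.mul_sum]
  exact integral_finsetSum _ fun j _ => integrable_bubble_mul hρ (Q j)

/-- The bump takes values in [0, 1], so its square is at most itself. -/
theorem integral_norm_bubbleField_sq_le {a : E d} {ρ : ℝ} (hρ : 0 < ρ)
    (Q : Fin d → MvPolynomial (Fin d) ℝ) :
    ∫ y, ‖(bubbleField a ρ Q).val y‖ ^ 2 ≤ bubbleEnergy a ρ Q := by
  rw [← integral_bubble_norm_sq hρ]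
  refine integral_mono_of_nonneg (ae_of_all _ fun y => sq_nonneg _) ?_ (ae_of_all _ fun y => ?_)
  · simp_rw [norm_sq_polyField, Finset.mul_sum]
    exact integrable_finsetSum _ fun j _ => integrable_bubble_mul hρ (Q j)
  · simp only [bubbleField]
    rw [norm_smul, mul_pow, Real.norm_of_nonneg (bubble_nonneg _ _ _)]
    refine mul_le_mul_of_nonneg_right ?_ (sq_nonneg _)
    rw [sq]
    exact mul_le_of_le_one_left (bubble_nonneg _ _ _) (bubble_le_one _ _ _)

/-- The divergence is a sum of `d` derivatives, and the Cauchy-Schwarz inequality for that sum costs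
the factor `d`. -/
theorem integral_div_bubbleField_sq_le {a : E d} {ρ C : ℝ} (hρ : 0 < ρ)
    {Q : Fin d → MvPolynomial (Fin d) ℝ}
    (hC : ∀ j, ρ ^ 2 * ∫ y, (fderiv ℝ (fun y => bubble a ρ y * pval (Q j) y) y
      (EuclideanSpace.single j 1)) ^ 2 ≤ C * ∫ y, bubble a ρ y * pval (Q j) y ^ 2) :
    ρ ^ 2 * ∫ y, (bubbleField a ρ Q).div y ^ 2 ≤ d * (C * bubbleEnergy a ρ Q) := by
  have hL : ∀ j, Integrable fun y => (fderiv ℝ (fun y => bubble a ρ y * pval (Q j) y) y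
      (EuclideanSpace.single j 1)) ^ 2 := fun j =>
    ((isTest_bubble_mul hρ (contDiff_pval (Q j))).memLp_fderiv j).integrable_sq
  have h1 : ∫ y, (bubbleField a ρ Q).div y ^ 2 ≤
      d * ∑ j, ∫ y, (fderiv ℝ (fun y => bubble a ρ y * pval (Q j) y) y
        (EuclideanSpace.single j 1)) ^ 2 := by
    rw [← integral_finsetSum _ fun j _ => hL j, ← integral_const_mul]
    refine integral_mono_of_nonneg (ae_of_all _ fun y => sq_nonneg _)
      ((integrable_finsetSum _ fun j _ => hL j).const_mul _) (ae_of_all _ fun y => ?_)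
    have := sq_sum_le_card_mul_sum_sq (s := (Finset.univ : Finset (Fin d)))
      (f := fun j => fderiv ℝ (fun y => bubble a ρ y * pval (Q j) y) y (EuclideanSpace.single j 1))
    rw [Finset.card_univ, Fintype.card_fin] at this
    exact this
  calc ρ ^ 2 * ∫ y, (bubbleField a ρ Q).div y ^ 2
      ≤ ρ ^ 2 * (d * ∑ j, ∫ y, (fderiv ℝ (fun y => bubble a ρ y * pval (Q j) y) y
        (EuclideanSpace.single j 1)) ^ 2) := mul_le_mul_of_nonneg_left h1 (sq_nonneg _)
    _ = d * ∑ j, ρ ^ 2 * ∫ y, (fderiv ℝ (fun y => bubble a ρ y * pval (Q j) y) y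
        (EuclideanSpace.single j 1)) ^ 2 := by rw [← Finset.mul_sum]; ring
    _ ≤ d * (C * bubbleEnergy a ρ Q) := by
        refine mul_le_mul_of_nonneg_left ?_ (Nat.cast_nonneg _)
        rw [bubbleEnergy, Finset.mul_sum]
        exact Finset.sum_le_sum fun j _ => hC j

namespace IsApproximation

variable {k mo me mφ : ℕ} {Sf : Idx G Nh → E d → ℝ} {p : Idx G Nh → VField d}
  {φ : Idx G Nh → E d → ℝ} {ph : Idx G Nh → VField d} {tn : Idx G Nh → Fin n → E d → ℝ}
  {φt : Idx G Nh → E d → ℝ} {gφt : Idx G Nh → E d → E d} {tφt : Idx G Nh → E d → ℝ}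

/-- The squared `L²` norm, over an element, of the flux defect. -/
def _root_.SPN.DDMesh.defectSq (T : DDMesh Ωs) (X : CrossSections d G) (ph : Idx G Nh → VField d)
    (gφt : Idx G Nh → E d → E d) (K : Fin T.size) : ℝ :=
  ∫ x in T.el K, ∑ a, ‖∑ b, (X.To Nh x a b • (ph b).val x + matH G Nh a b • gφt b x)‖ ^ 2

/-- Tested with the bubble field, the error equation returns the weighted energy `W`. The squared
norm of the test is at most the maximal coefficient times `(1 + R ^ 2 * (d * C)) * W`: the 1 is the
field, the rest its divergence with `h ≤ R * ρ`. After absorption, one more `C` goes from `W` to the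
unweighted norm. That norm is kept in this form because the Robin estimate needs it as well. -/
theorem defectSq_le (h : IsApproximation Ω T k mo me mφ X Sf p φ ph tn φt gφt tφt)
    {a : E d} {ρ : ℝ} (hreg : (T.cell K).IsRegular a ρ) {R C : ℝ} (hR : 0 < R) (hC : 0 < C)
    (hhR : (T.cell K).h ≤ R * ρ)
    (hinv : ∀ P : MvPolynomial (Fin d) ℝ, P.totalDegree ≤ mo + d * (k + 1) + mφ →
      ∫ y in Metric.closedBall a (T.cell K).h, pval P y ^ 2 ≤
        C * ∫ y, bubble a ρ y * pval P y ^ 2 ∧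
      ∀ j : Fin d, ρ ^ 2 * ∫ y, (fderiv ℝ (fun y => bubble a ρ y * pval P y) y
          (EuclideanSpace.single j 1)) ^ 2 ≤ C * ∫ y, bubble a ρ y * pval P y ^ 2)
    (hL : T.localNorm Ω X K (fun a => p a - ph a) (fun a x => φ a x - φt a x) ≠ ⊤) :
    T.defectSq X ph gφt K ≤ C * (1 + R ^ 2 * (d * C)) * T.diagMax (X.To Nh) K *
      (T.localNorm Ω X K (fun a => p a - ph a) (fun a x => φ a x - φt a x)).toReal ^ 2 := by
  set l := (T.localNorm Ω X K (fun a => p a - ph a) (fun a x => φ a x - φt a x)).toReal with hl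
  have hl0 : 0 ≤ l := ENNReal.toReal_nonneg
  obtain ⟨hmin, hdiag⟩ := h.diag_odd K
  have hmax : 0 < T.diagMax (X.To Nh) K := hmin.trans_le (h.diag_odd_le K)
  choose Q hQdeg hQ using h.exists_defect_eq K
  have hρ := hreg.pos
  have hball : Metric.closedBall a ρ ⊆ T.el K := hreg.ball.trans interior_subset
  have haK : a ∈ T.el K := hball (Metric.mem_closedBall_self hρ.le)
  set q : Idx G Nh → VField d := fun i => bubbleField a ρ (Q i) with hq
  have hloc : ∀ i, IsLocalField (T.el K) ∅ (q i) := fun i =>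
    isLocalField_bubbleField hρ hball (Q i)
  set W := ∑ i, bubbleEnergy a ρ (Q i) with hW
  have hW0 : 0 ≤ W := Finset.sum_nonneg fun i _ => bubbleEnergy_nonneg _ _ _
  have hwz : ∀ i, ∀ y ∉ T.el K, bubble a ρ y * ‖polyField (Q i) y‖ ^ 2 = 0 := fun i y hy => by
    rw [bubble_eq_zero hρ fun hb => hy (hball hb), zero_mul]
  have hwi : ∀ i, Integrable fun y => bubble a ρ y * ‖polyField (Q i) y‖ ^ 2 := fun i => by
    simp_rw [norm_sq_polyField, Finset.mul_sum]
    exact integrable_finsetSum _ fun j _ => integrable_bubble_mul hρ (Q i j)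
  have hform : formD Ω X (fun a => p a - ph a) (fun a x => φ a x - φt a x) q (fun _ _ => 0) = W := by
    rw [h.formD_field (empty_subset _) (empty_subset _) hloc, Measure.restrict_empty,
      integral_zero_measure, add_zero, ← integral_neg]
    have : ∀ᵐ x ∂(volume.restrict (T.el K)), -∑ i, (inner ℝ
        (∑ b, (X.To Nh x i b • (ph b).val x + matH G Nh i b • gφt b x)) ((q i).val x) : ℝ) =
        ∑ i, bubble a ρ x * ‖polyField (Q i) x‖ ^ 2 := by
      filter_upwards [ae_all_iff.2 hQ] with x hx
      rw [← Finset.sum_neg_distrib]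
      refine Finset.sum_congr rfl fun i _ => ?_
      rw [hx i, inner_neg_left, neg_neg]
      simp only [hq, bubbleField]
      rw [real_inner_smul_right, real_inner_self_eq_norm_sq]
    rw [integral_congr_ae this, integral_finsetSum _ fun i _ => (hwi i).restrict]
    refine Finset.sum_congr rfl fun i _ => ?_
    rw [setIntegral_eq_integral_of_forall_compl_eq_zero fun y hy => hwz i y hy,
      integral_bubble_norm_sq hρ]
  have hval : (∫ x in T.el K, ∑ i, ‖(q i).val x‖ ^ 2) ≤ W := by
    rw [integral_finsetSum _ fun i _ => ((hloc i).memLp_val.restrict _).integrable_norm_sq]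
    refine Finset.sum_le_sum fun i _ => le_trans ?_ (integral_norm_bubbleField_sq_le hρ (Q i))
    exact setIntegral_le_integral (hloc i).memLp_val.integrable_norm_sq
      (ae_of_all _ fun _ => sq_nonneg _)
  have hdiv : (T.cell K).h ^ 2 * (∫ x in T.el K, ∑ i, (q i).div x ^ 2) ≤ R ^ 2 * (d * C) * W := by
    rw [integral_finsetSum _ fun i _ => ((hloc i).memLp_div.restrict _).integrable_sq]
    have h1 : ∀ i, ∫ x in T.el K, (q i).div x ^ 2 ≤ ∫ x, (q i).div x ^ 2 := fun i =>
      setIntegral_le_integral (hloc i).memLp_div.integrable_sq (ae_of_all _ fun _ => sq_nonneg _)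
    have h2 : ∀ i, ρ ^ 2 * ∫ x, (q i).div x ^ 2 ≤ d * (C * bubbleEnergy a ρ (Q i)) := fun i =>
      integral_div_bubbleField_sq_le hρ fun j => (hinv (Q i j) (hQdeg i j)).2 j
    have h3 : (T.cell K).h ^ 2 ≤ R ^ 2 * ρ ^ 2 := by
      rw [← mul_pow]
      exact pow_le_pow_left₀ hreg.h_pos.le hhR 2
    calc (T.cell K).h ^ 2 * ∑ i, ∫ x in T.el K, (q i).div x ^ 2
        ≤ R ^ 2 * ρ ^ 2 * ∑ i, ∫ x, (q i).div x ^ 2 := by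
          refine mul_le_mul h3 (Finset.sum_le_sum fun i _ => h1 i)
            (Finset.sum_nonneg fun i _ => integral_nonneg fun _ => sq_nonneg _) (by positivity)
      _ = R ^ 2 * ∑ i, ρ ^ 2 * ∫ x, (q i).div x ^ 2 := by rw [← Finset.mul_sum]; ring
      _ ≤ R ^ 2 * ∑ i, d * (C * bubbleEnergy a ρ (Q i)) :=
          mul_le_mul_of_nonneg_left (Finset.sum_le_sum fun i _ => h2 i) (sq_nonneg _)
      _ = R ^ 2 * (d * C) * W := by
          rw [hW, Finset.mul_sum, Finset.mul_sum]
          exact Finset.sum_congr rfl fun i _ => by ring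
  have hnorm : T.normS Ω X q (fun _ _ => 0) ≤
      Real.sqrt (T.diagMax (X.To Nh) K * (1 + R ^ 2 * (d * C)) * W) := by
    refine (IsLocalField.normS_le h.partition hloc fun i x hx =>
      ⟨hmin.le.trans (hdiag i x hx).1, (hdiag i x hx).2⟩).trans (Real.sqrt_le_sqrt ?_)
    rw [T.bdrySum_eq_zero Ω X fun _ _ => rfl, add_zero, mul_assoc]
    refine mul_le_mul_of_nonneg_left ?_ hmax.le
    linarith
  have hin : T.InLocal Ω K q (fun _ _ => 0) :=
    inLocal_of_isLocalField h.pos_dim hloc h.domain.isOpen h.partition (empty_subset _)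
      (empty_subset _) (by simp)
  have hmain := hin.formD_le hnorm hL
  rw [hform] at hmain
  have hWl := le_mul_sq_of_le_sqrt_mul hW0 (by positivity) hl0 hmain
  -- The element lies in the closed ball of radius `h` about `a`, where the inverse inequality
  -- controls the polynomials.
  have hsq : T.defectSq X ph gφt K ≤ C * W := by
    have e : T.defectSq X ph gφt K = ∑ i, ∑ j, ∫ x in T.el K, pval (Q i j) x ^ 2 := by
      have hi : ∀ i j, Integrable (fun x => pval (Q i j) x ^ 2) (volume.restrict (T.el K)) :=
        fun i j => ((continuous_pval _).pow 2).continuousOn.integrableOn_compact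
          (T.cell K).isCompact_carrier
      simp_rw [← integral_finsetSum _ fun j _ => hi _ j]
      rw [← integral_finsetSum _ fun i _ => integrable_finsetSum _ fun j _ => hi i j]
      refine integral_congr_ae ?_
      filter_upwards [ae_all_iff.2 hQ] with x hx
      refine Finset.sum_congr rfl fun i _ => ?_
      rw [hx i, norm_neg, norm_sq_polyField]
    rw [e, hW, Finset.mul_sum]
    refine Finset.sum_le_sum fun i _ => ?_
    rw [bubbleEnergy, Finset.mul_sum]
    refine Finset.sum_le_sum fun j _ => le_trans ?_ (hinv (Q i j) (hQdeg i j)).1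
    exact setIntegral_mono_set (((continuous_pval _).pow 2).continuousOn.integrableOn_compact
      (isCompact_closedBall _ _)) (ae_of_all _ fun _ => sq_nonneg _)
      ((T.cell K).subset_closedBall haK).eventuallyLE
  refine hsq.trans ((mul_le_mul_of_nonneg_left hWl hC.le).trans (le_of_eq ?_))
  ring

/-- Bounding the weight by the inverse of the minimal coefficient, against the maximal one in
`defectSq_le`, produces the ratio in the theorem. -/
theorem etaF_le (h : IsApproximation Ω T k mo me mφ X Sf p φ ph tn φt gφt tφt) (K : Fin T.size) :
    T.etaF X ph gφt K ≤ Real.sqrt ((T.diagMin (X.To Nh) K)⁻¹ * T.defectSq X ph gφt K) := by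
  obtain ⟨hmin, hdiag⟩ := h.diag_odd K
  refine Real.sqrt_le_sqrt ?_
  rw [DDMesh.defectSq, ← integral_const_mul]
  refine integral_mono_of_nonneg ?_ ((integrable_finsetSum _ fun a _ =>
    (h.memLp_defect K a).integrable_norm_sq).const_mul _) ?_
  · filter_upwards [T.ae_mem_interior K] with x hx
    exact Finset.sum_nonneg fun a _ => mul_nonneg
      (inv_nonneg.2 (hmin.le.trans (hdiag a x hx).1)) (sq_nonneg _)
  · filter_upwards [T.ae_mem_interior K] with x hx
    rw [Finset.mul_sum]
    exact Finset.sum_le_sum fun a _ => mul_le_mul_of_nonneg_right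
      (inv_anti₀ hmin (hdiag a x hx).1) (sq_nonneg _)

end IsApproximation

end

section

variable {d G Nh n : ℕ} {Ωs : Fin n → Set (E d)}

/-! ### The matrix of the vacuum boundary condition -/

section Gamma

open Polynomial

theorem alpha_pos (m : ℕ) : 0 < alpha m := by
  induction m with
  | zero => simp [alpha]
  | succ m ih =>
    rw [alpha]
    have : (0 : ℝ) ≤ m := Nat.cast_nonneg m
    exact div_pos (by nlinarith) (by positivity)

/-- The leading term of a monic polynomial of degree `2 * m` survives `m` derivatives with a nonzero
coefficient. -/
theorem degree_legendreP (m : ℕ) : (legendreP m).degree = m := by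
  have hm : ((X ^ 2 - 1 : ℝ[X]) ^ m).Monic := (monic_X_pow_sub_C (1 : ℝ) two_ne_zero).pow m
  have hdeg : ((X ^ 2 - 1 : ℝ[X]) ^ m).natDegree = 2 * m := by
    have h2 : (X ^ 2 - 1 : ℝ[X]).natDegree = 2 := natDegree_X_pow_sub_C (r := (1 : ℝ))
    rw [natDegree_pow, h2, mul_comm]
  have hc : (1 / ((2 : ℝ) ^ m * (m.factorial : ℝ))) ≠ 0 := by positivity
  rw [legendreP, degree_C_mul hc]
  have hcoeff : (derivative^[m] ((X ^ 2 - 1 : ℝ[X]) ^ m)).coeff m ≠ 0 := by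
    rw [coeff_iterate_derivative, ← two_mul, ← hdeg, hm.coeff_natDegree, nsmul_eq_mul, mul_one,
      Nat.cast_ne_zero, ne_eq, Nat.descFactorial_eq_zero_iff_lt]
    omega
  refine degree_eq_of_le_of_coeff_ne_zero (degree_le_of_natDegree_le ?_) hcoeff
  refine (natDegree_iterate_derivative _ _).trans ?_
  omega

/-- The Legendre polynomials, as a sequence of polynomials. -/
def legendreSequence : Polynomial.Sequence ℝ := ⟨legendreP, degree_legendreP⟩

/-- The moments of a vector, combined into a polynomial. -/
def momentPoly (v : Fin Nh → ℝ) : ℝ[X] :=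
  ∑ i : Fin Nh, (v i * alpha (2 * (i : ℕ))) • legendreP (2 * (i : ℕ))

/-- Polynomials of distinct degrees are linearly independent, and the factors `alpha` do not vanish.
-/
theorem momentPoly_ne_zero {v : Fin Nh → ℝ} (hv : v ≠ 0) : momentPoly v ≠ 0 := by
  intro h0
  have hli : LinearIndependent ℝ fun i : Fin Nh => legendreP (2 * (i : ℕ)) :=
    legendreSequence.linearIndependent.comp (fun i : Fin Nh => 2 * (i : ℕ)) fun i j hij =>
      Fin.ext (by simpa using hij)
  refine hv (funext fun i => ?_)
  have := Fintype.linearIndependent_iff.1 hli (fun i => v i * alpha (2 * (i : ℕ))) h0 i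
  exact (mul_eq_zero.1 this).resolve_right (alpha_pos _).ne'

theorem integral_mul_sq_pos {P : ℝ[X]} (hP : P ≠ 0) : 0 < ∫ x in (0 : ℝ)..1, x * P.eval x ^ 2 := by
  have hfin := Polynomial.finite_setOfPred_isRoot hP
  obtain ⟨c, hc, hroot⟩ := (Ioo_infinite (zero_lt_one (α := ℝ))).exists_notMem_finite hfin
  refine intervalIntegral.integral_pos one_pos (by fun_prop)
    (fun x hx => mul_nonneg hx.1.le (sq_nonneg _)) ⟨c, Ioo_subset_Icc_self hc, ?_⟩
  exact mul_pos hc.1 (lt_of_le_of_ne (sq_nonneg _) (pow_ne_zero 2 hroot).symm)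

end Gamma

/-- `GammaHat` is the Gram matrix of the scaled even Legendre polynomials for the weight `x` on [0,
1]; its positive definiteness follows. -/
theorem dotProduct_GammaHat (v : Fin Nh → ℝ) :
    v ⬝ᵥ (GammaHat Nh *ᵥ v) = ∫ x in (0 : ℝ)..1, x * (momentPoly v).eval x ^ 2 := by
  have hi : ∀ i j : Fin Nh, IntervalIntegrable (fun x : ℝ =>
      x * (legendreP (2 * (i : ℕ))).eval x * (legendreP (2 * (j : ℕ))).eval x) volume 0 1 :=
    fun i j => (by fun_prop : Continuous _).intervalIntegrable _ _
  have e : ∀ x : ℝ, x * (momentPoly v).eval x ^ 2 = ∑ i : Fin Nh, ∑ j : Fin Nh,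
      (v i * alpha (2 * (i : ℕ)) * (v j * alpha (2 * (j : ℕ)))) *
        (x * (legendreP (2 * (i : ℕ))).eval x * (legendreP (2 * (j : ℕ))).eval x) := by
    intro x
    rw [momentPoly, Polynomial.eval_finsetSum, sq, Finset.sum_mul_sum, Finset.mul_sum]
    refine Finset.sum_congr rfl fun i _ => ?_
    rw [Finset.mul_sum]
    refine Finset.sum_congr rfl fun j _ => ?_
    rw [Polynomial.eval_smul, Polynomial.eval_smul, smul_eq_mul, smul_eq_mul]
    ring
  simp_rw [e]
  rw [intervalIntegral.integral_of_le zero_le_one, integral_sum_sum_mul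
    (fun i j : Fin Nh => v i * alpha (2 * (i : ℕ)) * (v j * alpha (2 * (j : ℕ))))
    fun i j => (hi i j).1]
  simp only [Matrix.mulVec, dotProduct, Finset.mul_sum]
  refine Finset.sum_congr rfl fun i _ => Finset.sum_congr rfl fun j _ => ?_
  rw [GammaHat, intervalIntegral.integral_of_le zero_le_one]
  ring

theorem posDef_GammaHat (Nh : ℕ) : (GammaHat Nh).PosDef := by
  refine Matrix.posDef_iff_dotProduct_mulVec.2 ⟨?_, fun v hv => ?_⟩
  · refine Matrix.IsHermitian.ext fun i j => ?_
    simp only [GammaHat, star_trivial]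
    rw [mul_comm (alpha (2 * (j : ℕ)))]
    congr 1
    refine intervalIntegral.integral_congr fun x _ => ?_
    ring
  · rw [star_trivial, dotProduct_GammaHat]
    exact integral_mul_sq_pos (momentPoly_ne_zero hv)

theorem isUnit_Hhat (Nh : ℕ) : IsUnit (Hhat Nh) := by
  rw [Matrix.isUnit_iff_isUnit_det, Matrix.det_of_isUpperTriangular]
  · simp [Hhat]
  · intro i j hij
    have : (j : ℕ) < i := hij
    rw [Hhat, if_neg]
    omega

/-- The diagonal block of `Γ̃_e`. -/
def GammaTHat (Nh : ℕ) : Matrix (Fin Nh) (Fin Nh) ℝ := Hhat Nh * (GammaHat Nh)⁻¹ * (Hhat Nh)ᵀ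

/-- A congruence by the invertible triangular matrix `Hhat` preserves positive definiteness. -/
theorem posDef_GammaTHat (Nh : ℕ) : (GammaTHat Nh).PosDef := by
  have := (posDef_GammaHat Nh).inv.mul_mul_conjTranspose_same (B := Hhat Nh)
    (Matrix.vecMul_injective_iff_isUnit.2 (isUnit_Hhat Nh))
  rwa [Matrix.conjTranspose_eq_transpose_of_trivial] at this

theorem groupDiag_mul (A B : Matrix (Fin Nh) (Fin Nh) ℝ) :
    groupDiag G A * groupDiag G B = groupDiag G (A * B) := by
  ext a b
  simp only [Matrix.mul_apply, groupDiag, Fintype.sum_prod_type]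
  rw [Finset.sum_eq_single a.1]
  · by_cases h : a.1 = b.1 <;> simp [h]
  · intro g _ hg
    simp [hg.symm]
  · simp

theorem groupDiag_one : groupDiag G (1 : Matrix (Fin Nh) (Fin Nh) ℝ) = 1 := by
  ext a b
  rw [groupDiag, Matrix.one_apply, Matrix.one_apply]
  by_cases h : a.1 = b.1 <;> by_cases h' : a.2 = b.2 <;> simp [h, h', Prod.ext_iff]

theorem groupDiag_transpose (A : Matrix (Fin Nh) (Fin Nh) ℝ) :
    (groupDiag G A)ᵀ = groupDiag G Aᵀ := by
  ext a b
  simp [groupDiag, eq_comm]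

theorem groupDiag_inv {A : Matrix (Fin Nh) (Fin Nh) ℝ} (hA : IsUnit A) :
    (groupDiag G A)⁻¹ = groupDiag G A⁻¹ := by
  refine Matrix.inv_eq_right_inv ?_
  rw [groupDiag_mul, Matrix.mul_nonsing_inv _ ((Matrix.isUnit_iff_isUnit_det _).1 hA),
    groupDiag_one]

theorem matGammaT_eq (G Nh : ℕ) : matGammaT G Nh = groupDiag G (GammaTHat Nh) := by
  rw [matGammaT, matH, matGamma, groupDiag_inv (posDef_GammaHat Nh).isUnit, groupDiag_transpose,
    groupDiag_mul, groupDiag_mul, GammaTHat]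

theorem matGammaT_mulVec_inv (G Nh : ℕ) (y : Idx G Nh → ℝ) :
    matGammaT G Nh *ᵥ ((matGammaT G Nh)⁻¹ *ᵥ y) = y := by
  have hU := (posDef_GammaTHat Nh).isUnit
  rw [matGammaT_eq, groupDiag_inv hU, Matrix.mulVec_mulVec, groupDiag_mul,
    Matrix.mul_nonsing_inv _ ((Matrix.isUnit_iff_isUnit_det _).1 hU), groupDiag_one,
    Matrix.one_mulVec]

/-- The constant is the minimum of the form on the compact unit sphere, or 1 when that sphere is
empty. -/
theorem _root_.Matrix.PosDef.exists_pos_mul_le {A : Matrix (Fin Nh) (Fin Nh) ℝ} (hA : A.PosDef) :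
    ∃ c : ℝ, 0 < c ∧ ∀ v : Fin Nh → ℝ, c * (v ⬝ᵥ v) ≤ v ⬝ᵥ (A *ᵥ v) := by
  have hpos := (Matrix.posDef_iff_dotProduct_mulVec.1 hA).2
  set S : Set (EuclideanSpace ℝ (Fin Nh)) := Metric.sphere 0 1 with hS
  have hcont : Continuous fun v : EuclideanSpace ℝ (Fin Nh) =>
      (fun i => v i) ⬝ᵥ (A *ᵥ fun i => v i) := by
    simp only [dotProduct, Matrix.mulVec]
    fun_prop
  have hnorm : ∀ v : Fin Nh → ℝ, ‖(WithLp.toLp 2 v : EuclideanSpace ℝ (Fin Nh))‖ ^ 2 = v ⬝ᵥ v := by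
    intro v
    rw [EuclideanSpace.norm_sq_eq]
    simp [dotProduct, sq]
  have hne0 : ∀ v ∈ S, (fun i => v i) ≠ 0 := by
    intro v hv h0
    have : v = 0 := by ext i; exact congrFun h0 i
    rw [this] at hv
    simp [hS] at hv
  obtain ⟨c, hc, hcS⟩ : ∃ c : ℝ, 0 < c ∧ ∀ v ∈ S, c ≤ (fun i => v i) ⬝ᵥ (A *ᵥ fun i => v i) := by
    rcases S.eq_empty_or_nonempty with h | h
    · exact ⟨1, one_pos, by simp [h]⟩
    · obtain ⟨w, hw, hmin⟩ := (isCompact_sphere _ _).exists_isMinOn h hcont.continuousOn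
      exact ⟨_, by simpa using hpos (hne0 w hw), fun v hv => hmin hv⟩
  refine ⟨c, hc, fun v => ?_⟩
  by_cases hv : v = 0
  · simp [hv]
  · set w : EuclideanSpace ℝ (Fin Nh) := WithLp.toLp 2 v with hw
    have hw0 : 0 < ‖w‖ := norm_pos_iff.2 fun h => hv (by simpa [hw] using h)
    have h1 := hcS (‖w‖⁻¹ • w) (by simp [hS, norm_smul, hw0.ne'])
    have e : (fun i => (‖w‖⁻¹ • w) i) = ‖w‖⁻¹ • v := rfl
    rw [e, Matrix.mulVec_smul, dotProduct_smul, smul_dotProduct, smul_eq_mul, smul_eq_mul,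
      ← mul_assoc, ← sq, inv_pow, hnorm, inv_mul_eq_div, le_div_iff₀ (by rw [← hnorm]; positivity)]
      at h1
    exact h1

/-- All diagonal blocks are the same matrix, so the constant of one block serves for every number of
groups. The Robin constant can therefore be fixed before `G`. -/
theorem exists_matGammaT_coercive (Nh : ℕ) : ∃ c : ℝ, 0 < c ∧ ∀ (G : ℕ) (y : Idx G Nh → ℝ),
    c * (y ⬝ᵥ y) ≤ y ⬝ᵥ (matGammaT G Nh *ᵥ y) := by
  obtain ⟨c, hc, h⟩ := (posDef_GammaTHat Nh).exists_pos_mul_le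
  refine ⟨c, hc, fun G y => ?_⟩
  have e : matGammaT G Nh *ᵥ y = fun a => (GammaTHat Nh *ᵥ fun i => y (a.1, i)) a.2 := by
    funext a
    simp only [matGammaT_eq, Matrix.mulVec, dotProduct, groupDiag, Fintype.sum_prod_type]
    rw [Finset.sum_eq_single a.1]
    · simp
    · intro g _ hg
      simp [hg.symm]
    · simp
  rw [e]
  simp only [dotProduct, Fintype.sum_prod_type, Finset.mul_sum]
  refine Finset.sum_le_sum fun g _ => ?_
  have := h fun i => y (g, i)
  simpa only [dotProduct, Finset.mul_sum] using this

end

section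

variable {d G Nh n : ℕ} {Ωs : Fin n → Set (E d)}

variable {Ω : Set (E d)} {T : DDMesh Ωs} {K : Fin T.size} {F : Set (E d)} {X : CrossSections d G}

/-! ### The Robin estimator -/

namespace IsApproximation

variable {k mo me mφ : ℕ} {Sf : Idx G Nh → E d → ℝ} {p : Idx G Nh → VField d}
  {φ : Idx G Nh → E d → ℝ} {ph : Idx G Nh → VField d} {tn : Idx G Nh → Fin n → E d → ℝ}
  {φt : Idx G Nh → E d → ℝ} {gφt : Idx G Nh → E d → E d} {tφt : Idx G Nh → E d → ℝ}

/-- With `y` the Robin defect, `z` its image under the inverse matrix and `S` the integral of `y ·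
z`, the squared estimator is `S / (δ * hp)`. The cone field with trace `z` gives the pairing `S -
J`, where `J` is the flux defect tested with it. Its squared norm is at most `δ * hp * S * C₁`, and
`J ^ 2` is at most `δ * hp * S * C₂ * l ^ 2` by the Cauchy-Schwarz inequality and the flux bound.
Cancelling one factor `√S` leaves the sum of the two roots. -/
theorem etaBC_le (h : IsApproximation Ω T k mo me mφ X Sf p φ ph tn φt gφt tφt)
    {a : E d} {ρ : ℝ} (hreg : (T.cell K).IsRegular a ρ) {R : ℝ} (hR : 0 < R)
    (hhR : (T.cell K).h ≤ R * ρ) (hF : F ∈ T.bdryFacets Ω K) {c D : ℝ} (hc : 0 < c) (hD : 0 < D)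
    (hcoer : ∀ y : Idx G Nh → ℝ, c * (y ⬝ᵥ y) ≤ y ⬝ᵥ (matGammaT G Nh *ᵥ y))
    (hL : T.localNorm Ω X K (fun a => p a - ph a) (fun a x => φ a x - φt a x) ≠ ⊤)
    (hdef : T.defectSq X ph gφt K ≤ D * T.diagMax (X.To Nh) K *
      (T.localNorm Ω X K (fun a => p a - ph a) (fun a x => φ a x - φt a x)).toReal ^ 2) :
    T.etaBC X ph tφt K F ≤
      (Real.sqrt (R ^ 2 * (1 + d ^ 2) / c + 1) + Real.sqrt (D * R ^ 2 / c)) *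
      (T.localNorm Ω X K (fun a => p a - ph a) (fun a x => φ a x - φt a x)).toReal := by
  set l := (T.localNorm Ω X K (fun a => p a - ph a) (fun a x => φ a x - φt a x)).toReal with hl
  have hl0 : 0 ≤ l := ENNReal.toReal_nonneg
  obtain ⟨hmin, hdiag⟩ := h.diag_odd K
  set δ := T.diagMax (X.To Nh) K with hδ
  have hmax : 0 < δ := hmin.trans_le (h.diag_odd_le K)
  obtain ⟨hFf, hFΩ⟩ := DDMesh.mem_bdryFacets.1 hF
  rcases F.eq_empty_or_nonempty with hFe | hFne
  · rw [DDMesh.etaBC, hFe, Measure.restrict_empty, integral_zero_measure, Real.sqrt_zero, mul_zero]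
    positivity
  have hd1 : (1 : ℝ) ≤ d := by exact_mod_cast h.pos_dim
  obtain ⟨u, H, hB, hρH, hHp, -, hFeq⟩ := hreg.exists_isBase h.pos_dim hFf hFne
  have hH := hB.pos
  set hp := (T.cell K).hperp F with hhp
  have hp0 : 0 < hp := hH.trans_le hHp
  have hFK : F ⊆ T.el K := (T.cell K).facet_subset hFf
  have hai : a ∈ interior (T.el K) := hreg.ball (Metric.mem_closedBall_self hreg.pos.le)
  have haK : a ∈ (T.cell K).carrier := interior_subset hai
  have hFm : MeasurableSet F := hB.compact.measurableSet
  have hiso := hB.ae_isolated h.domain h.partition hai hFeq hFΩ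
  set μF := (surf d).restrict F with hμF
  set y : E d → Idx G Nh → ℝ := fun x =>
    (matH G Nh *ᵥ fun b => tφt b x) - matGammaT G Nh *ᵥ fun b => (ph b).tr x with hy
  set z : E d → Idx G Nh → ℝ := fun x => (matGammaT G Nh)⁻¹ *ᵥ y x with hz
  have hyz : ∀ x, matGammaT G Nh *ᵥ z x = y x := fun x => matGammaT_mulVec_inv G Nh (y x)
  have hyL : ∀ i, MemLp (fun x => y x i) 2 μF := fun i =>
    (MemLp.mulVec _ (h.memLp_tφt hFΩ) i).sub (MemLp.mulVec _ (h.memLp_tr_ph hFK hFΩ) i)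
  have hzL : ∀ i, MemLp (fun x => z x i) 2 μF := fun i => MemLp.mulVec _ hyL i
  -- A measurable representative of `z` that vanishes off `F` everywhere, since the cone
  -- construction evaluates it pointwise.
  set g : Idx G Nh → E d → ℝ := fun i => F.indicator ((hzL i).1.mk _) with hg
  have hgm : ∀ i, Measurable (g i) := fun i =>
    (hzL i).1.stronglyMeasurable_mk.measurable.indicator hFm
  have hg0 : ∀ i, ∀ x ∉ F, g i x = 0 := fun i x hx => indicator_of_notMem hx _
  have hgz : ∀ᵐ x ∂μF, (fun i => g i x) = z x := by
    filter_upwards [ae_all_iff.2 fun i => (hzL i).1.ae_eq_mk, ae_restrict_mem hFm] with x hx hxF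
    funext i
    rw [hg, hx i]
    exact indicator_of_mem hxF _
  have hgL : ∀ i, MemLp (g i) 2 μF := fun i => (hzL i).ae_eq (by
    filter_upwards [hgz] with x hx using (congrFun hx i).symm)
  set q : Idx G Nh → VField d := fun i => coneVField a u H (g i) with hq
  have hloc : ∀ i, IsLocalField (T.el K) F (q i) := fun i =>
    hB.isLocalField_coneVField (hgm i) (hg0 i) (hgL i) haK hFK
  set S := ∫ x in F, y x ⬝ᵥ z x ∂(surf d) with hS
  have hzy : ∀ x, z x ⬝ᵥ (matGammaT G Nh *ᵥ z x) = y x ⬝ᵥ z x := fun x => by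
    rw [hyz, dotProduct_comm]
  have hyg : ∫ x in F, y x ⬝ᵥ (fun i => (q i).tr x) ∂(surf d) = S := by
    refine integral_congr_ae ?_
    filter_upwards [hgz] with x hx
    rw [← hx]
    rfl
  have hbd : T.bdrySum Ω X q = δ * hp * S := by
    rw [IsLocalField.bdrySum_eq hloc hF (hiso.mono fun x hx => hx.2)]
    congr 1
    refine integral_congr_ae ?_
    filter_upwards [hgz] with x hx
    rw [← hzy, ← hx]
    rfl
  set B := ∑ i, ∫ x in F, g i x ^ 2 ∂(surf d) with hBdef
  have hB0 : 0 ≤ B := Finset.sum_nonneg fun i _ => integral_nonneg fun _ => sq_nonneg _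
  have hBS : c * B ≤ S := by
    rw [hBdef, ← integral_finsetSum _ fun i _ => (hgL i).integrable_sq, ← integral_const_mul]
    refine integral_mono_ae ((integrable_finsetSum _ fun i _ => (hgL i).integrable_sq).const_mul c)
      (integrable_dotProduct hyL hzL) ?_
    filter_upwards [hgz] with x hx
    have h1 := hcoer (z x)
    have h2 : ∑ i, g i x ^ 2 = z x ⬝ᵥ z x := by
      rw [← hx]
      simp only [dotProduct, sq]
    rw [h2, ← hzy]
    exact h1
  have hBS' : B ≤ S / c := by
    rw [le_div_iff₀ hc, mul_comm]
    exact hBS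
  have hS0 : 0 ≤ S := le_trans (by positivity) hBS
  -- The inscribed ball gives `ρ ≤ H`, so the height of the cone is comparable with the diameter.
  have hhH : ((T.cell K).h / H) ^ 2 ≤ R ^ 2 := by
    refine pow_le_pow_left₀ (div_nonneg hreg.h_pos.le hH.le) ?_ 2
    rw [div_le_iff₀ hH]
    exact hhR.trans (mul_le_mul_of_nonneg_left hρH hR.le)
  have hHd : H / d ≤ hp := (div_le_self hH.le hd1).trans hHp
  set V := ∫ x in T.el K, ∑ i, ‖(q i).val x‖ ^ 2 with hV
  have hVB : V ≤ R ^ 2 * (hp * B) := by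
    rw [hV, integral_finsetSum _ fun i _ => ((hloc i).memLp_val.restrict _).integrable_norm_sq]
    rw [hBdef, Finset.mul_sum, Finset.mul_sum]
    refine Finset.sum_le_sum fun i _ => ?_
    have h1 : ∫ x in T.el K, ‖(q i).val x‖ ^ 2 ≤ ∫ x, ‖(q i).val x‖ ^ 2 :=
      setIntegral_le_integral (hloc i).memLp_val.integrable_norm_sq
        (ae_of_all _ fun _ => sq_nonneg _)
    refine h1.trans ((hB.integral_norm_coneField_sq_le (hgm i) (hg0 i) (hgL i) haK hFK).trans ?_)
    have h2 : 0 ≤ ∫ x in F, g i x ^ 2 ∂(surf d) := integral_nonneg fun _ => sq_nonneg _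
    gcongr
  have hdivB : (T.cell K).h ^ 2 * (∫ x in T.el K, ∑ i, (q i).div x ^ 2) ≤
      R ^ 2 * (d ^ 2 * (hp * B)) := by
    rw [integral_finsetSum _ fun i _ => ((hloc i).memLp_div.restrict _).integrable_sq, hBdef]
    simp only [Finset.mul_sum]
    refine Finset.sum_le_sum fun i _ => ?_
    have h1 : ∫ x in T.el K, (q i).div x ^ 2 ≤ ∫ x, (q i).div x ^ 2 :=
      setIntegral_le_integral (hloc i).memLp_div.integrable_sq (ae_of_all _ fun _ => sq_nonneg _)
    rw [hB.integral_coneDiv_sq (hgm i) (hg0 i)] at h1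
    have h2 : 0 ≤ ∫ x in F, g i x ^ 2 ∂(surf d) := integral_nonneg fun _ => sq_nonneg _
    calc (T.cell K).h ^ 2 * ∫ x in T.el K, (q i).div x ^ 2
        ≤ (T.cell K).h ^ 2 * ((d / H) ^ 2 * (H / d * ∫ x in F, g i x ^ 2 ∂(surf d))) :=
          mul_le_mul_of_nonneg_left h1 (sq_nonneg _)
      _ = ((T.cell K).h / H) ^ 2 * (d ^ 2 * (H / d * ∫ x in F, g i x ^ 2 ∂(surf d))) := by
          rw [div_pow, div_pow]
          ring
      _ ≤ R ^ 2 * (d ^ 2 * (hp * ∫ x in F, g i x ^ 2 ∂(surf d))) := by gcongr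
  -- In the bracket, 1 comes from the field and `d ^ 2` from its divergence; division by `c` passes
  -- from the norm of `z` to `S`. The final 1 is the boundary part of the norm, which is exactly `δ
  -- * hp * S`. In `C₂`, `D` comes from the flux defect and `R ^ 2 / c` from the field.
  set C₁ := R ^ 2 * (1 + (d : ℝ) ^ 2) / c + 1 with hC₁
  set C₂ := D * R ^ 2 / c with hC₂
  have hC₁0 : 0 ≤ C₁ := by positivity
  have hC₂0 : 0 ≤ C₂ := by positivity
  have hnorm : T.normS Ω X q (fun _ _ => 0) ≤ Real.sqrt (δ * hp * S * C₁) := by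
    refine (IsLocalField.normS_le h.partition hloc fun i x hx =>
      ⟨hmin.le.trans (hdiag i x hx).1, (hdiag i x hx).2⟩).trans (Real.sqrt_le_sqrt ?_)
    rw [hbd]
    have h1 : V + (T.cell K).h ^ 2 * (∫ x in T.el K, ∑ i, (q i).div x ^ 2) ≤
        R ^ 2 * (1 + d ^ 2) * hp * (S / c) :=
      calc V + (T.cell K).h ^ 2 * (∫ x in T.el K, ∑ i, (q i).div x ^ 2)
          ≤ R ^ 2 * (hp * B) + R ^ 2 * (d ^ 2 * (hp * B)) := add_le_add hVB hdivB
        _ = R ^ 2 * (1 + d ^ 2) * hp * B := by ring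
        _ ≤ R ^ 2 * (1 + d ^ 2) * hp * (S / c) :=
          mul_le_mul_of_nonneg_left hBS' (by positivity)
    calc δ * (V + (T.cell K).h ^ 2 * (∫ x in T.el K, ∑ i, (q i).div x ^ 2)) + δ * hp * S
        ≤ δ * (R ^ 2 * (1 + d ^ 2) * hp * (S / c)) + δ * hp * S := by gcongr
      _ = δ * hp * S * C₁ := by rw [hC₁]; ring
  have hin : T.InLocal Ω K q (fun _ _ => 0) :=
    inLocal_of_isLocalField h.pos_dim hloc h.domain.isOpen h.partition hFK hFΩ
      (hiso.mono fun x hx => hx.1)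
  have hmain := hin.formD_le hnorm hL
  rw [h.formD_field hFK hFΩ hloc, hyg] at hmain
  set J := ∫ x in T.el K, ∑ i, (inner ℝ
    (∑ b, (X.To Nh x i b • (ph b).val x + matH G Nh i b • gφt b x)) ((q i).val x) : ℝ) with hJ
  have hV0 : 0 ≤ V := integral_nonneg fun _ => Finset.sum_nonneg fun _ _ => sq_nonneg _
  have hJle : J ≤ Real.sqrt (δ * hp * S * C₂) * l := by
    have h1 : J ^ 2 ≤ T.defectSq X ph gφt K * V :=
      sq_integral_sum_inner_le (h.memLp_defect K) fun i => (hloc i).memLp_val.restrict _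
    have h2 : J ^ 2 ≤ δ * hp * S * C₂ * l ^ 2 :=
      calc J ^ 2 ≤ T.defectSq X ph gφt K * V := h1
        _ ≤ D * δ * l ^ 2 * (R ^ 2 * (hp * (S / c))) := by
          refine mul_le_mul hdef (hVB.trans ?_) hV0 (by positivity)
          gcongr
        _ = δ * hp * S * C₂ * l ^ 2 := by rw [hC₂]; ring
    have h3 := (le_abs_self J).trans (Real.abs_le_sqrt h2)
    rwa [Real.sqrt_mul (by positivity), Real.sqrt_sq hl0] at h3
  set Cb := Real.sqrt C₁ + Real.sqrt C₂ with hCb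
  have hCb0 : 0 ≤ Cb := by positivity
  have hfin : S ≤ Real.sqrt (δ * hp * Cb ^ 2 * S) * l := by
    have e : Real.sqrt (δ * hp * Cb ^ 2 * S) = Real.sqrt (δ * hp * S) * Cb := by
      rw [show δ * hp * Cb ^ 2 * S = δ * hp * S * Cb ^ 2 by ring, Real.sqrt_mul (by positivity),
        Real.sqrt_sq hCb0]
    rw [Real.sqrt_mul (by positivity)] at hmain hJle
    rw [e, hCb]
    linarith
  have hSl := le_mul_sq_of_le_sqrt_mul hS0 (by positivity) hl0 hfin
  have heta : T.etaBC X ph tφt K F = (Real.sqrt (δ * hp))⁻¹ * Real.sqrt S := rfl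
  rw [heta, inv_mul_le_iff₀ (Real.sqrt_pos.2 (by positivity))]
  refine (Real.sqrt_le_sqrt hSl).trans (le_of_eq ?_)
  rw [show δ * hp * Cb ^ 2 * l ^ 2 = δ * hp * (Cb * l) ^ 2 by ring, Real.sqrt_mul (by positivity),
    Real.sqrt_sq (by positivity)]

end IsApproximation

end

/-! ### Assembly of the three bounds -/

section

variable {d G Nh n : ℕ} {Ωs : Fin n → Set (E d)}

/-- The local norm is a supremum in [0, ∞]. If it is infinite, a positive constant makes the
right-hand side infinite, so real inequalities are needed only when it is finite. -/
theorem ofReal_le_ofReal_mul {x C : ℝ} {L : ℝ≥0∞} (hC : 0 < C)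
    (h : L ≠ ⊤ → x ≤ C * L.toReal) : ENNReal.ofReal x ≤ ENNReal.ofReal C * L := by
  by_cases hL : L = ⊤
  · rw [hL, ENNReal.mul_top (by simpa using hC)]
    exact le_top
  · conv_rhs => rw [← ENNReal.ofReal_toReal hL, ← ENNReal.ofReal_mul hC.le]
    exact ENNReal.ofReal_le_ofReal (h hL)

end

end

end SPN

theorem mainTheorem7
    (d : ℕ) (hd : d = 2 ∨ d = 3) (k mo me mφ : ℕ) (κ : ℝ) (hκ : 0 < κ) :
    ∃ cr cf : ℝ, 0 < cr ∧ 0 < cf ∧ ∀ (Nh : ℕ), 2 ≤ Nh → ∃ cb : ℝ, 0 < cb ∧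
    ∀ (G : ℕ), 2 ≤ G →
    -- the domain, its partition and the mesh
    ∀ (Ω : Set (SPN.E d)), SPN.IsLipschitzDomain Ω →
    ∀ (n : ℕ) (Ωs : Fin n → Set (SPN.E d)), SPN.IsPartition Ω Ωs →
    ∀ (T : SPN.DDMesh Ωs),
    -- the data, piecewise polynomial on the mesh
    ∀ (X : SPN.CrossSections d G), SPN.PosSPN Ω X Nh →
    (∀ a b, T.PiecewisePolyCoef mo (fun x => X.To Nh x a b)) →
    (∀ a b, T.PiecewisePolyCoef me (fun x => X.Te Nh x a b)) →
    ∀ (Sf : SPN.Idx G Nh → SPN.E d → ℝ), (∀ a, T.InLh k (Sf a)) →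
    -- the exact solution
    ∀ (p : SPN.Idx G Nh → SPN.VField d) (φ : SPN.Idx G Nh → SPN.E d → ℝ),
    SPN.IsExactSolution Ω X Sf p φ →
    -- the discrete multi-domain solution
    ∀ (Mh : Submodule ℝ (SPN.Pair n → SPN.E d → ℝ)), SPN.IsMultiplierSpace Ωs Mh →
    SPN.DiscreteDDAssumption Ω T k Mh →
    ∀ (ph : SPN.Idx G Nh → SPN.VField d) (tn : SPN.Idx G Nh → Fin n → SPN.E d → ℝ)
      (φh : SPN.Idx G Nh → SPN.E d → ℝ) (lh : SPN.Idx G Nh → SPN.Pair n → SPN.E d → ℝ),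
    T.IsDiscreteSolution Ω k Mh X Sf ph tn φh lh →
    -- the reconstruction, with its gradient and its trace
    ∀ (φt : SPN.Idx G Nh → SPN.E d → ℝ) (gφt : SPN.Idx G Nh → SPN.E d → SPN.E d)
      (tφt : SPN.Idx G Nh → SPN.E d → ℝ),
    (∀ a, SPN.IsH1 Ω (φt a) (gφt a)) → (∀ a, SPN.IsTrace Ω (φt a) (gφt a) (tφt a)) →
    (∀ a, T.PiecewisePoly mφ (φt a)) →
    ∀ K : Fin T.size, κ ≤ (T.cell K).kappa →
      ENNReal.ofReal (T.etaR X Sf ph φt K) ≤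
        ENNReal.ofReal (cr * Real.sqrt (T.diagMax (X.Te Nh) K / T.diagMin (X.Te Nh) K)) *
          T.localNorm Ω X K (fun a => p a - ph a) (fun a => φ a - φt a) ∧
      ENNReal.ofReal (T.etaF X ph gφt K) ≤
        ENNReal.ofReal (cf * Real.sqrt (T.diagMax (X.To Nh) K / T.diagMin (X.To Nh) K)) *
          T.localNorm Ω X K (fun a => p a - ph a) (fun a => φ a - φt a) ∧
      ∀ F ∈ T.bdryFacets Ω K,
        ENNReal.ofReal (T.etaBC X ph tφt K F) ≤
          ENNReal.ofReal cb *
            T.localNorm Ω X K (fun a => p a - ph a) (fun a => φ a - φt a) := by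
  have hd1 : 1 ≤ d := by omega
  -- The inscribed ball has radius `c₀ * h`, so `c₀⁻¹` bounds the ratio of diameter to radius in
  -- terms of `d` and `κ` only.
  obtain ⟨c₀, hc₀, hreg⟩ := SPN.Cell.exists_isRegular hd1 hκ
  have hR : 0 < c₀⁻¹ := inv_pos.2 hc₀
  -- The degree is that of the flux defect, the only quantity to which inverse inequalities are
  -- applied.
  obtain ⟨C, hC, hinv⟩ := SPN.exists_inverse d (mo + d * (k + 1) + mφ) c₀⁻¹
  have hD : 0 < C * (1 + c₀⁻¹ ^ 2 * (d * C)) := by positivity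
  refine ⟨1, Real.sqrt (C * (1 + c₀⁻¹ ^ 2 * (d * C))), one_pos, Real.sqrt_pos.2 hD,
    fun Nh hNh => ?_⟩
  obtain ⟨γ, hγ, hcoer⟩ := SPN.exists_matGammaT_coercive Nh
  refine ⟨Real.sqrt (c₀⁻¹ ^ 2 * (1 + d ^ 2) / γ + 1) +
    Real.sqrt (C * (1 + c₀⁻¹ ^ 2 * (d * C)) * c₀⁻¹ ^ 2 / γ), by positivity, ?_⟩
  intro G hG Ω hΩ n Ωs hP T X hX hTo hTe Sf hSf p φ hsol Mh _ _ ph tn φh lh hdisc φt gφt tφt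
    hH1 htr hpoly K hK
  have h : SPN.IsApproximation Ω T k mo me mφ X Sf p φ ph tn φt gφt tφt :=
    ⟨hd1, ⟨(⟨0, by omega⟩, ⟨0, by omega⟩)⟩, hΩ, hP, hX, hTo, hTe, hSf, hsol, hdisc.1, hH1, htr,
      hpoly⟩
  obtain ⟨a, ha⟩ := hreg (T.cell K) hK
  have hh : (T.cell K).h ≤ c₀⁻¹ * (c₀ * (T.cell K).h) := by
    rw [inv_mul_cancel_left₀ hc₀.ne']
  have hdef := h.defectSq_le ha hR hC hh (hinv a _ _ ha.pos hh)
  obtain ⟨hemin, -⟩ := h.diag_even K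
  obtain ⟨homin, -⟩ := h.diag_odd K
  have hle := h.diag_even_le K
  have homax := homin.trans_le (h.diag_odd_le K)
  refine ⟨SPN.ofReal_le_ofReal_mul ?_ fun hL => ?_, SPN.ofReal_le_ofReal_mul ?_ fun hL => ?_,
    fun F hF => SPN.ofReal_le_ofReal_mul (by positivity) fun hL => ?_⟩
  · have := hemin.trans_le hle
    positivity
  · refine (h.etaR_le hL).trans ?_
    rw [one_mul]
    -- The residual bound holds with constant 1; the ratio of coefficients is at least 1 and only
    -- weakens it.
    refine le_mul_of_one_le_left ENNReal.toReal_nonneg (Real.one_le_sqrt.2 ?_)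
    rwa [one_le_div hemin]
  · have := Real.sqrt_pos.2 hD
    positivity
  · refine (h.etaF_le K).trans ((Real.sqrt_le_sqrt
      (mul_le_mul_of_nonneg_left (hdef hL) (inv_nonneg.2 homin.le))).trans (le_of_eq ?_))
    rw [← Real.sqrt_mul hD.le]
    conv_rhs => rw [← Real.sqrt_sq (ENNReal.toReal_nonneg (a := T.localNorm Ω X K
      (fun a => p a - ph a) (fun a => φ a - φt a))), ← Real.sqrt_mul (by positivity)]
    congr 1
    rw [div_eq_inv_mul]
    change _ = _ * (T.localNorm Ω X K (fun a => p a - ph a)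
      (fun a x => φ a x - φt a x)).toReal ^ 2
    ring
  · exact h.etaBC_le ha hR hh hF hγ hD (hcoer G) hL (hdef hL)
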